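/- Let $\rho$ run over the nontrivial zeros of the Riemann zeta function (the zeros with $0<\mathrm{Re}\,\rho<1$), counted with multiplicity, and list them in pairs $\rho=\tfrac12\pm i\tau_k$, $k=1,2,\dots$, with $\mathrm{Re}\,\tau_k>0$. All complex powers below have their principal value ($-\pi<\arg\le\pi$). Define $$\mathcal Z(\sigma)=\sum_k (\tau_k^2)^{-\sigma},\qquad \mathfrak Z(\sigma,a)=\sum_k(\tau_k+a)^{-2\sigma}\quad(\mathrm{Re}\,\sigma>\tfrac12),\qquad \xi(s,x)=(2\pi)^s\sum_\rho (x-\rho)^{-s}\quad(\mathrm{Re}\,s>1),$$ for $a\in\mathbb C$ with $a\neq-\tau_k$ for all $k$ (in particular if $|\arg a|\le\pi/2$ or $a=0$), and for $x\in\mathbb C$ that is not a nontrivial zero of $\zeta$. Let $B_n$ be the Bernoulli numbers, $E_n$ the Euler numbers ($1/\cosh t=\sum_n E_nt^n/n!$), and put $$\mathcal R_m=\frac{(-1)^m}{8\pi m}(1-2^{1-2m})B_{2m}\ (m\ge1),\qquad r_n(a)=-\frac{a^n}{4\pi n}+\sum_{0<2m\le n}\binom{n-1}{2m-1}\mathcal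 R_m\,a^{n-2m}\ (n\ge1).$$ Then the three series converge absolutely in the stated half-planes and extend meromorphically to $\mathbb C$ in $\sigma$, resp. $s$, as follows. (1) $\mathcal Z$ is holomorphic except at $\sigma=\tfrac12-m$, $m=0,1,2,\dots$; at $\sigma=\tfrac12$ it has the double pole with polar part $\frac1{8\pi}(\sigma-\frac12)^{-2}-\frac{\log2\pi}{4\pi}(\sigma-\frac12)^{-1}$; at $\sigma=\frac12-m$, $m\ge1$, it has at most a simple pole, with residue $\mathcal R_m$; and $\mathcal Z(-m)=(-1)^m2^{-2m}(1-\tfrac18E_{2m})$ for $m=0,1,2,\dots$. (2) For each such $a$, $\mathfrak Z(\cdot,a)$ is holomorphic except at $\sigma=\tfrac12(1-n)$, $n=0,1,2,\dots$; at $\sigma=\frac12$ it has the same polar part $\frac1{8\pi}(\sigma-\frac12)^{-2}-\frac{\log2\pi}{4\pi}(\sigma-\frac12)^{-1}$, independent of $a$; at $\sigma=\tfrac12(1-n)$, $n\ge1$, it has at most a simple pole, with residue $r_n(a)$. At $\sigma=0$ the residue is $r_1(a)=-\frac{a}{4\pi}$ and the finite part (constant Laurent coefficient) is $\frac78+\frac{\log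 2\pi}{2\pi}a$. (3) For each such $x$, $\xi(\cdot,x)$ is holomorphic on $\mathbb C\setminus\{1\}$, with a simple pole of residue $-\pi$ at $s=1$; and for every $y\in\mathbb C$ such that $\frac12+y$ is not a nontrivial zero, and every $n=1,2,\dots$, $$\xi(1-n,\tfrac12+y)=\frac{2}{(2\pi)^{n-1}}\Bigl[-\pi\frac{r_n(iy)}{i^n}+\sum_{0\le2m<n}(-1)^m\binom{n-1}{2m}\mathcal Z(-m)\,y^{n-2m-1}\Bigr].$$ -/

import Mathlib

open Complex Filter Topology

namespace RiemannZetaZeros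

/-- The nontrivial zeros `ρ` of the Riemann zeta function: those in the open critical strip. -/
def NontrivialZero : Type :=
  {ρ : ℂ // riemannZeta ρ = 0 ∧ 0 < ρ.re ∧ ρ.re < 1}

/-- The nontrivial zeros in the upper half-plane. They are the `ρ = 1/2 + i τ` with `0 < Re τ`,
one from each pair `1/2 ± i τ`. -/
def UpperZero : Type :=
  {ρ : ℂ // riemannZeta ρ = 0 ∧ 0 < ρ.re ∧ ρ.re < 1 ∧ 0 < ρ.im}

/-- The number `τ` attached to the zero `ρ = 1/2 + i τ`. -/
noncomputable def UpperZero.tau (ρ : UpperZero) : ℂ := (ρ.1 - 1 / 2) / I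

/-- The multiplicity of a zero of the Riemann zeta function. -/
noncomputable def zeroMult (ρ : ℂ) : ℂ := (analyticOrderNatAt riemannZeta ρ : ℂ)

/-- The term of `∑ₖ (τₖ² + v)^(-σ)` at `v = 0`, weighted by multiplicity
(a zero of multiplicity `q` stands for `q` indices `k`). -/
noncomputable def calZTerm (σ : ℂ) (ρ : UpperZero) : ℂ :=
  zeroMult ρ.1 * (ρ.tau ^ 2) ^ (-σ)

/-- The term of `∑ₖ (τₖ + a)^(-2σ)`, weighted by multiplicity. -/
noncomputable def frakZTerm (σ a : ℂ) (ρ : UpperZero) : ℂ :=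
  zeroMult ρ.1 * (ρ.tau + a) ^ (-2 * σ)

/-- The term of `∑_ρ (x - ρ)^(-s)`, weighted by multiplicity. -/
noncomputable def xiTerm (s x : ℂ) (ρ : NontrivialZero) : ℂ :=
  zeroMult ρ.1 * (x - ρ.1) ^ (-s)

/-- `F (σ) = c₂ / (σ - p)² + c₁ / (σ - p) + c₀ + O(σ - p)` near `p`, with a remainder that is
analytic at `p`: polar part `c₂ / (σ - p)² + c₁ / (σ - p)` and finite part `c₀`. -/
def HasLaurentAt (F : ℂ → ℂ) (p c₂ c₁ c₀ : ℂ) : Prop :=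
  ∃ G : ℂ → ℂ, AnalyticAt ℂ G p ∧ G p = c₀ ∧
    ∀ᶠ σ in 𝓝[≠] p, F σ = c₂ / (σ - p) ^ 2 + c₁ / (σ - p) + G σ

/-- The Euler numbers: `1 / cosh t = ∑ Eₙ tⁿ / n!`. -/
noncomputable def eulerNumber (n : ℕ) : ℚ :=
  n.factorial * PowerSeries.coeff n
    (PowerSeries.mk fun k => if Even k then ((k.factorial : ℚ))⁻¹ else 0)⁻¹

/-- `ℛₘ = (-1)^m / (8 π m) * (1 - 2^(1 - 2m)) * B_{2m}`, for `m ≥ 1`. -/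
noncomputable def calR (m : ℕ) : ℂ :=
  (-1) ^ m / (8 * Real.pi * m) * (1 - 2 ^ (1 - 2 * (m : ℤ))) * (bernoulli (2 * m) : ℂ)

/-- `rₙ(a) = -aⁿ / (4 π n) + ∑_{0 < 2m ≤ n} C(n-1, 2m-1) ℛₘ a^(n-2m)`, for `n ≥ 1`. -/
noncomputable def resR (n : ℕ) (a : ℂ) : ℂ :=
  -a ^ n / (4 * Real.pi * n) +
    ∑ m ∈ (Finset.range (n + 1)).filter (fun m => 0 < 2 * m ∧ 2 * m ≤ n),
      ((n - 1).choose (2 * m - 1) : ℂ) * calR m * a ^ (n - 2 * m)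

end RiemannZetaZeros

/-! ### Positivity of the theta kernel and bounds for the completed zeta function -/

namespace RiemannZetaZeros

/-! Everything comes from the resolvent sum R(v) = ∑ₖ 1/(τₖ² + v), where multiplicities are counted.
The completed zeta function multiplied by s(s − 1) is entire, has order one and is even about s =
1/2; its zeros there are ±iτₖ. Hadamard's theory gives its logarithmic derivative at a real point y
as 2y R(y²) (`logDeriv_xiEven_eq_tsum`). The same logarithmic derivative is an explicit combination
of 1/(y ± 1/2), a digamma value, and ζ'/ζ(1/2 + y), which is exponentially small. Gauss's integral
and Watson's lemma expand the digamma term, with Bernoulli and Euler numbers as coefficients. So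
R(v) has a full expansion as v → ∞: a term in v^(-1/2) log v, one in v^(-1/2), and then v^(-(j+2)/2)
for j ≥ 0 (`norm_resolventSum_sub_le`).

For 1/2 < Re σ < 1 one has ∑ τₖ^(-2σ) = (sin πσ / π) ∫ v^(-σ) R(v) dv (`mellin_resolventSum`). Each
term of the expansion yields an explicit polar term of the Mellin transform, and subtracting more
terms continues it further left. The sine factor does the rest: at half-integers it is ±1, so that
poles survive with residues ℛₘ; at the integers −m it vanishes and turns the pole into the value
𝒵(−m).

For the shifted sum, (τ + a)^(-s) is expanded in powers of a/τ. Each term is a binomial coefficient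
in −s times 𝒵((s + k)/2), and the tail converges farther to the left. At s = 1 − n the coefficient
of the term k = n vanishes exactly where 𝒵 has its double pole; this leaves the simple-pole
contribution −aⁿ/(4πn). The tail vanishes there because the binomial expansion terminates, so the
finite part is a polynomial in a (`exists_hasLaurentAt_shiftAux_one_sub`).

For ξ(s, x), write x = 1/2 + y. The zeros 1/2 ± iτ give x − ρ = ∓i(τ ± iy), so ξ combines the
shifted sums at a = ±iy with factors (∓i)^(-s). These factors split off without crossing a branch
cut for all but finitely many zeros. The exceptional zeros contribute an entire function that
vanishes at s = 1 − n. By parity of rₙ all poles cancel except the one at s = 1, and the derivatives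
of (∓i)^(-s) turn the cancelled residues into the rₙ term of the special values. -/

open HurwitzZeta in
lemma one_le_cosKernel_zero {t : ℝ} (ht : 0 < t) : 1 ≤ cosKernel 0 t := by
  have h := hasSum_nat_cosKernel₀ 0 ht
  have h0 : 0 ≤ cosKernel (0 : ℝ) t - 1 := by
    refine h.nonneg fun n => ?_
    simp only [mul_zero, zero_mul, Real.cos_zero, mul_one]
    positivity
  have e : ((0 : ℝ) : UnitAddCircle) = 0 := rfl
  rw [e] at h0
  linarith

-- For x > 1 the kernel is θ(x) − 1, and for x < 1 the functional equation of θ makes it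
-- x^(-1/2)(θ(1/x) − 1). Positivity allows its Mellin transform to be bounded by values on the real
-- axis.
open HurwitzZeta in
lemma hurwitzEvenFEPair_f_modif_nonneg {x : ℝ} (hx : 0 < x) :
    ∃ r : ℝ, 0 ≤ r ∧ (hurwitzEvenFEPair 0).f_modif x = r := by
  rcases lt_trichotomy 1 x with h | h | h
  · refine ⟨cosKernel 0 x - 1, sub_nonneg.2 (one_le_cosKernel_zero hx), ?_⟩
    rw [WeakFEPair.f_modif, Pi.add_apply, Set.indicator_of_mem (Set.mem_Ioi.2 h),
      Set.indicator_of_notMem (fun hh => absurd hh.2 (not_lt.2 h.le))]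
    simp [hurwitzEvenFEPair, evenKernel_eq_cosKernel_of_zero]
  · refine ⟨0, le_rfl, ?_⟩
    rw [← h]
    simp [WeakFEPair.f_modif]
  · refine ⟨x ^ (-(1 / 2) : ℝ) * (cosKernel 0 (1 / x) - 1),
      mul_nonneg (by positivity) (sub_nonneg.2 (one_le_cosKernel_zero (by positivity))), ?_⟩
    rw [WeakFEPair.f_modif, Pi.add_apply, Set.indicator_of_notMem (by simpa using h.le),
      Set.indicator_of_mem (Set.mem_Ioo.2 ⟨hx, h⟩)]
    have := evenKernel_functional_equation 0 x
    simp only [hurwitzEvenFEPair, Function.comp_apply, this, zero_add, one_mul, smul_eq_mul,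
      mul_one]
    rw [Real.rpow_neg hx.le]
    push_cast
    ring

/-- A Mellin transform of a nonnegative function is bounded by its values on the real axis. -/
lemma norm_completedRiemannZeta₀_le {s : ℂ} {σ : ℝ} (h1 : 1 - σ ≤ s.re) (h2 : s.re ≤ σ) :
    ‖completedRiemannZeta₀ s‖ ≤ 2 * (completedRiemannZeta₀ σ).re := by
  set P := HurwitzZeta.hurwitzEvenFEPair 0 with hP
  have hconv : ∀ z : ℂ, MellinConvergent P.f_modif z := fun z =>
    (P.isStrongFEPair_toStrongFEPair.hasMellin z).1
  choose! φ hφ0 hφ using fun (x : ℝ) (hx : 0 < x) => hurwitzEvenFEPair_f_modif_nonneg hx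
  have hnorm : ∀ z : ℂ, ∀ x ∈ Set.Ioi (0 : ℝ),
      ‖(x : ℂ) ^ (z - 1) • P.f_modif x‖ = x ^ (z.re - 1) * φ x := by
    intro z x hx
    rw [hP, hφ x hx, norm_smul, Complex.norm_cpow_eq_rpow_re_of_pos hx, norm_real,
      Real.norm_of_nonneg (hφ0 x hx)]
    simp
  have hre : ∀ b : ℝ, (mellin P.f_modif b).re = ∫ x in Set.Ioi (0 : ℝ), x ^ (b - 1) * φ x := by
    intro b
    rw [mellin, ← RCLike.re_eq_complex_re, ← integral_re (hconv b)]
    refine MeasureTheory.setIntegral_congr_fun measurableSet_Ioi fun x hx => ?_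
    have hx' : (0 : ℝ) < x := hx
    simp only [hP]
    rw [hφ x hx, smul_eq_mul, ← ofReal_one, ← ofReal_sub, ← ofReal_cpow hx'.le, ← ofReal_mul]
    simp
  have hint : ∀ b : ℝ, MeasureTheory.IntegrableOn (fun x => x ^ (b - 1) * φ x) (Set.Ioi 0) := by
    intro b
    refine (hconv b).norm.congr ?_
    filter_upwards [MeasureTheory.ae_restrict_mem measurableSet_Ioi] with x hx
    rw [hnorm b x hx, ofReal_re]
  have key : ‖mellin P.f_modif (s / 2)‖ ≤
      (mellin P.f_modif (σ / 2 : ℝ)).re + (mellin P.f_modif ((1 - σ) / 2 : ℝ)).re := by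
    rw [hre, hre, ← MeasureTheory.integral_add (hint _) (hint _), mellin]
    refine MeasureTheory.norm_integral_le_of_norm_le ((hint _).add (hint _)) ?_
    filter_upwards [MeasureTheory.ae_restrict_mem measurableSet_Ioi] with x hx
    have hx' : (0 : ℝ) < x := hx
    rw [hnorm _ x hx]
    have hs : (s / 2).re = s.re / 2 := by simp
    rw [hs, ← add_mul]
    refine mul_le_mul_of_nonneg_right ?_ (hφ0 x hx)
    -- The exponent of x lies between those belonging to 1 − σ and σ, so the power is at most the
    -- larger of the two, hence at most their sum.
    rcases le_total 1 x with h | h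
    · have := Real.rpow_le_rpow_of_exponent_le h (show s.re / 2 - 1 ≤ σ / 2 - 1 by linarith)
      have := Real.rpow_nonneg hx'.le ((1 - σ) / 2 - 1)
      linarith
    · have := Real.rpow_le_rpow_of_exponent_ge hx' h
        (show (1 - σ) / 2 - 1 ≤ s.re / 2 - 1 by linarith)
      have := Real.rpow_nonneg hx'.le (σ / 2 - 1)
      linarith
  have hdef : ∀ z : ℂ, completedRiemannZeta₀ z = mellin P.f_modif (z / 2) / 2 := fun z => rfl
  -- The functional equation identifies the two endpoint values, whence the factor 2 in the bound.
  have hsymm : completedRiemannZeta₀ ((1 - σ : ℝ) : ℂ) = completedRiemannZeta₀ σ := by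
    rw [← completedRiemannZeta₀_one_sub]; push_cast; ring_nf
  have e1 : (completedRiemannZeta₀ σ).re = (mellin P.f_modif (σ / 2 : ℝ)).re / 2 := by
    rw [hdef]; push_cast; simp
  have e2 : (completedRiemannZeta₀ σ).re = (mellin P.f_modif ((1 - σ) / 2 : ℝ)).re / 2 := by
    rw [← hsymm, hdef]; push_cast; simp
  rw [hdef, norm_div, Complex.norm_two]
  linarith

/-! ### The entire function s(s − 1)Λ(s): zeros, a zero-free rectangle, order one -/

/-- The entire function `s (s - 1) Λ(s)`. -/
noncomputable def riemannXi (s : ℂ) : ℂ := 1 + s * (s - 1) * completedRiemannZeta₀ s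

lemma differentiable_riemannXi : Differentiable ℂ riemannXi := by
  have := differentiable_completedZeta₀
  unfold riemannXi
  fun_prop

lemma riemannXi_one_sub (s : ℂ) : riemannXi (1 - s) = riemannXi s := by
  simp only [riemannXi, completedRiemannZeta₀_one_sub]; ring

lemma riemannXi_eq_completed {s : ℂ} (h0 : s ≠ 0) (h1 : s ≠ 1) :
    riemannXi s = s * (s - 1) * completedRiemannZeta s := by
  have h1' : (1 : ℂ) - s ≠ 0 := sub_ne_zero.2 h1.symm
  rw [riemannXi, completedRiemannZeta_eq]
  field_simp
  ring

lemma riemannXi_eq_zeta {s : ℂ} (h0 : 0 < s.re) (h1 : s ≠ 1) :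
    riemannXi s = s * (s - 1) * Gammaℝ s * riemannZeta s := by
  have hs : s ≠ 0 := by rintro rfl; simp at h0
  rw [riemannXi_eq_completed hs h1, riemannZeta_def_of_ne_zero hs]
  have := Gammaℝ_ne_zero_of_re_pos h0
  field_simp

lemma riemannXi_ne_zero_of_one_le_re {s : ℂ} (h : 1 ≤ s.re) : riemannXi s ≠ 0 := by
  by_cases h1 : s = 1
  · simp [h1, riemannXi]
  have h0 : 0 < s.re := by linarith
  have hs : s ≠ 0 := by rintro rfl; simp at h0
  rw [riemannXi_eq_zeta h0 h1]
  exact mul_ne_zero (mul_ne_zero (mul_ne_zero hs (sub_ne_zero.2 h1))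
    (Gammaℝ_ne_zero_of_re_pos h0)) (riemannZeta_ne_zero_of_one_le_re h)

lemma riemannXi_eq_zero_iff {s : ℂ} :
    riemannXi s = 0 ↔ riemannZeta s = 0 ∧ 0 < s.re ∧ s.re < 1 := by
  constructor
  · intro h
    have hlt : s.re < 1 := by
      by_contra! hh
      exact riemannXi_ne_zero_of_one_le_re hh h
    have hpos : 0 < s.re := by
      by_contra! hh
      refine riemannXi_ne_zero_of_one_le_re (s := 1 - s) ?_ (by rw [riemannXi_one_sub, h])
      simp; linarith
    have h1 : s ≠ 1 := by rintro rfl; simp at hlt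
    have hs : s ≠ 0 := by rintro rfl; simp at hpos
    refine ⟨?_, hpos, hlt⟩
    rw [riemannXi_eq_zeta hpos h1] at h
    have h' := Gammaℝ_ne_zero_of_re_pos hpos
    have h'' := sub_ne_zero.2 h1
    simpa [hs, h', h''] using h
  · rintro ⟨hz, hpos, hlt⟩
    have h1 : s ≠ 1 := by rintro rfl; simp at hlt
    rw [riemannXi_eq_zeta hpos h1, hz, mul_zero]

/-- The factor s(s − 1)Γ_ℝ(s) is analytic and nonzero here, so zeros of ζ and of the entire function
have the same multiplicity. -/
lemma analyticOrderAt_riemannXi {s : ℂ} (h0 : 0 < s.re) (h1 : s ≠ 1) :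
    analyticOrderAt riemannXi s = analyticOrderAt riemannZeta s := by
  have hs : s ≠ 0 := by rintro rfl; simp at h0
  have hev : riemannXi =ᶠ[𝓝 s] (fun z => z * (z - 1) * Gammaℝ z) * riemannZeta := by
    have o1 : ∀ᶠ z : ℂ in 𝓝 s, 0 < z.re :=
      (isOpen_lt continuous_const continuous_re).mem_nhds h0
    filter_upwards [o1, isOpen_ne.mem_nhds h1] with z hz hz1
    exact riemannXi_eq_zeta hz hz1
  have hG : AnalyticAt ℂ (fun z => z * (z - 1) * Gammaℝ z) s := by
    refine DifferentiableOn.analyticAt (s := {z | 0 < z.re}) (fun z hz => ?_)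
      ((isOpen_lt continuous_const continuous_re).mem_nhds h0)
    have : DifferentiableAt ℂ Gammaℝ z := by
      unfold Gammaℝ
      have : DifferentiableAt ℂ Gamma (z / 2) := by
        refine differentiableAt_Gamma _ fun m hm => ?_
        have hz' : 0 < (z / 2).re := by
          have : 0 < z.re := hz
          simpa using this
        rw [hm] at hz'
        simp at hz'
        linarith [(Nat.cast_nonneg m : (0 : ℝ) ≤ m)]
      have h2 : DifferentiableAt ℂ (fun z : ℂ => Gamma (z / 2)) z :=
        DifferentiableAt.comp (f := fun z : ℂ => z / 2) z this (by fun_prop)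
      have hp : (Real.pi : ℂ) ≠ 0 := by exact_mod_cast Real.pi_ne_zero
      exact DifferentiableAt.mul (DifferentiableAt.const_cpow (by fun_prop) (Or.inl hp)) h2
    exact (by fun_prop : DifferentiableAt ℂ
      (fun z => z * (z - 1) * Gammaℝ z) z).differentiableWithinAt
  have hz : AnalyticAt ℂ riemannZeta s := analyticOn_riemannZeta s h1
  rw [analyticOrderAt_congr hev, analyticOrderAt_mul hG hz,
    hG.analyticOrderAt_eq_zero.2, zero_add]
  exact mul_ne_zero (mul_ne_zero hs (sub_ne_zero.2 h1)) (Gammaℝ_ne_zero_of_re_pos h0)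

/-- Λ(2) = π/6 gives Λ₀(2) = π/6 − 1/2 ≈ 0.024. This is the numerical input for the zero-free
rectangle. -/
lemma completedRiemannZeta₀_two_re_lt : (completedRiemannZeta₀ (2 : ℝ)).re < 1 / 8 := by
  have h2 : completedRiemannZeta₀ (2 : ℝ) = ((Real.pi / 6 - 1 / 2 : ℝ) : ℂ) := by
    have e := completedRiemannZeta_eq 2
    have z := riemannZeta_def_of_ne_zero (s := 2) two_ne_zero
    rw [riemannZeta_two] at z
    have hg : Gammaℝ 2 = (Real.pi : ℂ)⁻¹ := by
      simp [Gammaℝ_def, cpow_neg_one]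
    have hp : (Real.pi : ℂ) ≠ 0 := by exact_mod_cast Real.pi_ne_zero
    rw [hg, div_eq_mul_inv _ (_ : ℂ)⁻¹, inv_inv] at z
    have : completedRiemannZeta 2 = Real.pi / 6 := by
      field_simp at z ⊢
      linear_combination -z
    rw [this] at e
    push_cast
    linear_combination -e
  rw [h2, ofReal_re]
  have := Real.pi_lt_d2
  linarith

/-- A zero forces |s(s − 1)Λ₀(s)| = 1, while in the rectangle 0 < Re s < 1, |Im s| ≤ 1 the product
is at most (9/4)(1/4). Hence there are no zeros on the real axis to upset the pairing, and Re τ > 1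
> |Im τ|, which puts τ² in the right half-plane. -/
lemma one_lt_abs_im_of_riemannXi_eq_zero {s : ℂ} (h : riemannXi s = 0) : 1 < |s.im| := by
  obtain ⟨-, h0, h1⟩ := riemannXi_eq_zero_iff.1 h
  by_contra! him
  have hb := norm_completedRiemannZeta₀_le (s := s) (σ := 2) (by linarith) (by linarith)
  have hlt := completedRiemannZeta₀_two_re_lt
  have him2 : s.im ^ 2 ≤ 1 := by
    rw [← sq_abs]; exact pow_le_one₀ (abs_nonneg _) him
  have n1 : ‖s‖ ≤ 3 / 2 := by
    refine abs_le_of_sq_le_sq' ?_ (by norm_num) |>.2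
    rw [Complex.sq_norm, normSq_apply]; nlinarith
  have n2 : ‖s - 1‖ ≤ 3 / 2 := by
    refine abs_le_of_sq_le_sq' ?_ (by norm_num) |>.2
    rw [Complex.sq_norm, normSq_apply]; simp; nlinarith
  have h1 : s * (s - 1) * completedRiemannZeta₀ s = -1 := by
    rw [riemannXi] at h; linear_combination h
  have h2 : ‖s * (s - 1) * completedRiemannZeta₀ s‖ = 1 := by rw [h1]; simp
  rw [norm_mul, norm_mul] at h2
  have h3 : ‖s‖ * ‖s - 1‖ ≤ 3 / 2 * (3 / 2) := by gcongr
  have h4 : ‖s‖ * ‖s - 1‖ * ‖completedRiemannZeta₀ s‖ ≤ 3 / 2 * (3 / 2) * (1 / 4) := by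
    have : ‖completedRiemannZeta₀ s‖ ≤ 1 / 4 := by linarith
    gcongr
  linarith

/-- Crude bounds suffice: π^(-k) ≤ 1, Γ(k) ≤ k^k and ζ(2k) ≤ ζ(2) ≤ 2. -/
lemma completedRiemannZeta₀_even_re_le {k : ℕ} (hk : 1 ≤ k) :
    (completedRiemannZeta₀ (2 * k : ℝ)).re ≤ 2 * (k : ℝ) ^ k + 1 := by
  have hk' : (1 : ℝ) ≤ k := by exact_mod_cast hk
  have hk0 : (2 * k : ℂ) ≠ 0 := by
    have : (k : ℂ) ≠ 0 := by exact_mod_cast (by omega : k ≠ 0)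
    simpa using this
  have e := completedRiemannZeta_eq (2 * k)
  have hre : (1 : ℝ) < ((2 * k : ℕ) : ℂ).re := by simp; linarith
  have hGpos : 0 < (2 * k : ℂ).re := by simp; omega
  have hG := Gammaℝ_ne_zero_of_re_pos hGpos
  have z : completedRiemannZeta (2 * k) = Gammaℝ (2 * k) * riemannZeta (2 * k) := by
    rw [riemannZeta_def_of_ne_zero hk0]; field_simp
  have hzeta : ‖riemannZeta (2 * k)‖ ≤ 2 := by
    have h2k : 1 < 2 * k := by omega
    have := zeta_nat_eq_tsum_of_gt_one h2k
    push_cast at this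
    rw [this]
    have hs2 : HasSum (fun n : ℕ => 1 / (n : ℝ) ^ 2) (Real.pi ^ 2 / 6) := hasSum_zeta_two
    refine (tsum_of_norm_bounded hs2 fun n => ?_).trans ?_
    · rcases Nat.eq_zero_or_pos n with rfl | hn
      · simp [show k ≠ 0 by omega]
      · rw [norm_div, norm_pow, Complex.norm_natCast, norm_one]
        have hn' : (1 : ℝ) ≤ n := by exact_mod_cast hn
        gcongr
        omega
    · have := Real.pi_lt_d2
      have := Real.pi_pos
      nlinarith
  have hGam : ‖Gammaℝ (2 * k)‖ ≤ (k : ℝ) ^ k := by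
    rw [Gammaℝ_def, norm_mul]
    have h1 : ‖(Real.pi : ℂ) ^ (-(2 * k : ℂ) / 2)‖ ≤ 1 := by
      rw [Complex.norm_cpow_eq_rpow_re_of_pos Real.pi_pos]
      refine Real.rpow_le_one_of_one_le_of_nonpos (by linarith [Real.pi_gt_three]) ?_
      have : (-(2 * k : ℂ) / 2) = ((-k : ℝ) : ℂ) := by push_cast; ring
      rw [this, ofReal_re]; linarith
    have h2 : ‖Gamma (2 * k / 2)‖ ≤ (k : ℝ) ^ k := by
      obtain ⟨j, rfl⟩ : ∃ j, k = j + 1 := ⟨k - 1, by omega⟩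
      have : (2 * ((j + 1 : ℕ) : ℂ) / 2) = j + 1 := by push_cast; ring
      rw [this, Gamma_nat_eq_factorial, Complex.norm_natCast]
      have h3 : j.factorial ≤ (j + 1) ^ (j + 1) :=
        (Nat.factorial_le (Nat.le_succ j)).trans (Nat.factorial_le_pow (j + 1))
      exact_mod_cast h3
    calc _ ≤ 1 * (k : ℝ) ^ k := by gcongr
      _ = _ := one_mul _
  have hL : ‖completedRiemannZeta (2 * k)‖ ≤ (k : ℝ) ^ k * 2 := by
    rw [z, norm_mul]; gcongr
  have e' : completedRiemannZeta₀ (2 * k : ℝ) =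
      completedRiemannZeta (2 * k) + ((1 / (2 * k) + 1 / (1 - 2 * k) : ℝ) : ℂ) := by
    push_cast; rw [e]; ring
  rw [e', add_re, ofReal_re]
  have h5 : 1 / (2 * (k : ℝ)) ≤ 1 := by
    rw [div_le_one (by linarith)]; linarith
  have h6 : 1 / (1 - 2 * (k : ℝ)) ≤ 0 := by
    apply div_nonpos_of_nonneg_of_nonpos <;> linarith
  have := (Complex.re_le_norm (completedRiemannZeta (2 * k))).trans hL
  linarith

/-- Bounding Λ₀ by its value at 2k, with k an integer just above |z|, leaves the growth of k^k, that
is, order one. -/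
lemma norm_riemannXi_le {ε : ℝ} (hε : 0 < ε) :
    ∃ C : ℝ, 0 < C ∧ ∀ z : ℂ, ‖riemannXi (1 / 2 + z)‖ ≤ Real.exp (C * (1 + ‖z‖) ^ (1 + ε)) := by
  -- In the constant, 3/ε comes from k + 2 ≤ 3k and log k ≤ k^ε/ε, the summand 2 from 7 ≤ e², and
  -- the power of 2 from k ≤ 2(1 + |z|).
  refine ⟨(3 / ε + 2) * 2 ^ (1 + ε), by positivity, fun z => ?_⟩
  obtain ⟨k, hk1, hk2⟩ : ∃ k : ℕ, ‖z‖ + 1 ≤ k ∧ (k : ℝ) ≤ ‖z‖ + 2 := by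
    refine ⟨⌈‖z‖⌉₊ + 1, ?_, ?_⟩
    · push_cast; linarith [Nat.le_ceil ‖z‖]
    · push_cast; linarith [Nat.ceil_lt_add_one (norm_nonneg z)]
  have hz := norm_nonneg z
  have hk : (1 : ℝ) ≤ k := by linarith
  have hkN : 1 ≤ k := by exact_mod_cast hk
  have hre := abs_le.1 (Complex.abs_re_le_norm z)
  have hb := norm_completedRiemannZeta₀_le (s := 1 / 2 + z) (σ := 2 * k)
    (by simp; linarith) (by simp; linarith)
  have hb2 := completedRiemannZeta₀_even_re_le hkN
  push_cast at hb hb2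
  have hkk : (1 : ℝ) ≤ (k : ℝ) ^ k := one_le_pow₀ hk
  have n1 : ‖1 / 2 + z‖ ≤ k := (norm_add_le _ _).trans (by norm_num; linarith)
  have n2 : ‖1 / 2 + z - 1‖ ≤ k := by
    rw [show 1 / 2 + z - 1 = z - 1 / 2 by ring]
    exact (norm_sub_le _ _).trans (by norm_num; linarith)
  have hX : ‖riemannXi (1 / 2 + z)‖ ≤ 7 * (k : ℝ) ^ (k + 2) := by
    rw [riemannXi]
    refine (norm_add_le _ _).trans ?_
    rw [norm_mul, norm_mul, norm_one]
    have h3 : ‖completedRiemannZeta₀ (1 / 2 + z)‖ ≤ 6 * (k : ℝ) ^ k := by linarith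
    have h4 : ‖1 / 2 + z‖ * ‖1 / 2 + z - 1‖ * ‖completedRiemannZeta₀ (1 / 2 + z)‖ ≤
        k * k * (6 * (k : ℝ) ^ k) := by gcongr
    have h5 : (1 : ℝ) ≤ (k : ℝ) ^ (k + 2) := one_le_pow₀ hk
    have h6 : k * k * (6 * (k : ℝ) ^ k) = 6 * (k : ℝ) ^ (k + 2) := by ring
    linarith
  refine hX.trans ?_
  have h7 : (7 : ℝ) ≤ Real.exp 2 := by
    have := Real.exp_one_gt_d9
    rw [show (2 : ℝ) = 1 + 1 by norm_num, Real.exp_add]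
    nlinarith
  have h8 : (k : ℝ) ^ (k + 2) = Real.exp ((k + 2) * Real.log k) := by
    rw [← Real.exp_log (show (0 : ℝ) < (k : ℝ) ^ (k + 2) by positivity), Real.log_pow]
    push_cast; rfl
  have hlog : Real.log k ≤ (k : ℝ) ^ ε / ε := Real.log_le_rpow_div (by linarith) hε
  have hlog0 : 0 ≤ Real.log k := Real.log_nonneg hk
  have hke : (1 : ℝ) ≤ (k : ℝ) ^ ε := Real.one_le_rpow hk hε.le
  have hk1e : (k : ℝ) ^ (1 + ε) = k * (k : ℝ) ^ ε := by
    rw [Real.rpow_add (by linarith), Real.rpow_one]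
  calc 7 * (k : ℝ) ^ (k + 2) ≤ Real.exp 2 * Real.exp ((k + 2) * Real.log k) := by
        rw [h8]; gcongr
    _ = Real.exp (2 + (k + 2) * Real.log k) := (Real.exp_add _ _).symm
    _ ≤ Real.exp ((3 / ε + 2) * (k : ℝ) ^ (1 + ε)) := by
        gcongr
        rw [hk1e]
        have : ((k : ℝ) + 2) * Real.log k ≤ (3 * k) * ((k : ℝ) ^ ε / ε) := by
          gcongr; linarith
        have h9 : (2 : ℝ) ≤ 2 * (k * (k : ℝ) ^ ε) := by nlinarith
        calc _ ≤ 2 * (k * (k : ℝ) ^ ε) + (3 * k) * ((k : ℝ) ^ ε / ε) := by linarith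
          _ = _ := by ring
    _ ≤ Real.exp ((3 / ε + 2) * (2 * (1 + ‖z‖)) ^ (1 + ε)) := by
        gcongr
        linarith
    _ = _ := by
        rw [Real.mul_rpow (by norm_num) (by positivity)]
        ring_nf

/-! ### Entire functions with their zeros in a disc divided out -/

section Hadamard

lemma analyticOrderAt_ne_top_of_entire {h : ℂ → ℂ} (hd : Differentiable ℂ h) (h0 : h 0 ≠ 0)
    (z : ℂ) : analyticOrderAt h z ≠ ⊤ := by
  have ha : AnalyticOnNhd ℂ h Set.univ := fun z _ => hd.analyticAt z
  refine ha.analyticOrderAt_ne_top_of_isPreconnected (x := 0) isPreconnected_univ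
    (Set.mem_univ _) (Set.mem_univ _) ?_
  rw [(hd.analyticAt 0).analyticOrderAt_eq_zero.2 h0]
  exact ENat.zero_ne_top

lemma finite_zeros_closedBall {h : ℂ → ℂ} (hd : Differentiable ℂ h) (h0 : h 0 ≠ 0) (R : ℝ) :
    {z : ℂ | ‖z‖ ≤ R ∧ h z = 0}.Finite := by
  have ha : AnalyticOnNhd ℂ h Set.univ := fun z _ => hd.analyticAt z
  have hc := ha.preimage_zero_mem_codiscrete h0
  have hc' := mem_codiscrete'.mp hc
  have hfin : (Metric.closedBall (0 : ℂ) R ∩ h ⁻¹' {0}).Finite := by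
    have h1 : IsClosed (h ⁻¹' {0}) := isClosed_singleton.preimage hd.continuous
    refine ((isCompact_closedBall _ _).inter_right h1).finite ?_
    have h2 := hc'.2
    rw [Set.preimage_compl, compl_compl] at h2
    exact h2.mono Set.inter_subset_right
  refine hfin.subset fun z hz => ⟨by simpa using hz.1, hz.2⟩

lemma exists_eq_pow_mul_of_entire {g : ℂ → ℂ} (hg : Differentiable ℂ g) {a : ℂ} {n : ℕ}
    (hn : analyticOrderAt g a = n) :
    ∃ g₁ : ℂ → ℂ, Differentiable ℂ g₁ ∧ (∀ z, g z = (z - a) ^ n * g₁ z) ∧ g₁ a ≠ 0 := by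
  obtain ⟨u, hu, hua, hev⟩ := (hg.analyticAt a).analyticOrderAt_eq_natCast.1 hn
  have heq : Function.update (fun z => g z / (z - a) ^ n) a (u a) =ᶠ[𝓝 a] u := by
    filter_upwards [hev] with z hz
    by_cases hza : z = a
    · simp [hza]
    · rw [Function.update_of_ne hza, hz, smul_eq_mul,
        mul_div_cancel_left₀ _ (pow_ne_zero _ (sub_ne_zero.2 hza))]
  refine ⟨Function.update (fun z => g z / (z - a) ^ n) a (u a), fun z => ?_, fun z => ?_, ?_⟩
  · by_cases hza : z = a
    · subst hza
      exact hu.differentiableAt.congr_of_eventuallyEq heq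
    · have : Function.update (fun z => g z / (z - a) ^ n) a (u a) =ᶠ[𝓝 z]
          fun z => g z / (z - a) ^ n := by
        filter_upwards [isOpen_ne.mem_nhds hza] with w hw
        rw [Function.update_of_ne hw]
      refine DifferentiableAt.congr_of_eventuallyEq ?_ this
      exact (hg z).div (by fun_prop) (pow_ne_zero _ (sub_ne_zero.2 hza))
  · by_cases hza : z = a
    · subst hza
      rw [hev.self_of_nhds, smul_eq_mul, Function.update_self]
    · rw [Function.update_of_ne hza, mul_div_cancel₀ _ (pow_ne_zero _ (sub_ne_zero.2 hza))]
  · simpa using hua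

lemma exists_eq_prod_mul {h : ℂ → ℂ} (hd : Differentiable ℂ h) (h0 : h 0 ≠ 0) (S : Finset ℂ) :
    ∃ g : ℂ → ℂ, Differentiable ℂ g ∧
      (∀ z, h z = (∏ ρ ∈ S, (z - ρ) ^ analyticOrderNatAt h ρ) * g z) ∧ ∀ ρ ∈ S, g ρ ≠ 0 := by
  classical
  induction S using Finset.induction_on with
  | empty => exact ⟨h, hd, by simp, by simp⟩
  | insert a S ha ih =>
    obtain ⟨g, hg, hgz, hgS⟩ := ih
    have hP : Differentiable ℂ (fun z => ∏ ρ ∈ S, (z - ρ) ^ analyticOrderNatAt h ρ) := by fun_prop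
    have hPa : ∏ ρ ∈ S, (a - ρ) ^ analyticOrderNatAt h ρ ≠ 0 := by
      refine Finset.prod_ne_zero_iff.2 fun ρ hρ => pow_ne_zero _ (sub_ne_zero.2 ?_)
      rintro rfl; exact ha hρ
    have ho : analyticOrderAt g a = analyticOrderNatAt h a := by
      rw [Nat.cast_analyticOrderNatAt (analyticOrderAt_ne_top_of_entire hd h0 a)]
      have : h = (fun z => ∏ ρ ∈ S, (z - ρ) ^ analyticOrderNatAt h ρ) * g := funext hgz
      conv_rhs => rw [this, analyticOrderAt_mul (hP.analyticAt a) (hg.analyticAt a),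
        (hP.analyticAt a).analyticOrderAt_eq_zero.2 hPa, zero_add]
    obtain ⟨g₁, hg₁, hg₁z, hg₁a⟩ := exists_eq_pow_mul_of_entire hg ho
    refine ⟨g₁, hg₁, fun z => ?_, fun ρ hρ => ?_⟩
    · rw [hgz, hg₁z, Finset.prod_insert ha]; ring
    · rcases Finset.mem_insert.1 hρ with rfl | hρ
      · exact hg₁a
      · have := hgS ρ hρ
        rw [hg₁z] at this
        exact right_ne_zero_of_mul this

/-- The zeros of an entire function in a closed disc about `0`. -/
noncomputable def zerosIn {h : ℂ → ℂ} (hd : Differentiable ℂ h) (h0 : h 0 ≠ 0) (R : ℝ) :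
    Finset ℂ :=
  (finite_zeros_closedBall hd h0 R).toFinset

lemma mem_zerosIn {h : ℂ → ℂ} (hd : Differentiable ℂ h) (h0 : h 0 ≠ 0) {R : ℝ} {z : ℂ} :
    z ∈ zerosIn hd h0 R ↔ ‖z‖ ≤ R ∧ h z = 0 := by
  simp [zerosIn]

/-- Dividing out the zeros in a disc does not increase the maximum on a larger circle. -/
lemma exists_zerosIn_factor {h : ℂ → ℂ} (hd : Differentiable ℂ h) (h0 : h 0 ≠ 0) {R q B : ℝ}
    (hR : 0 < R) (hq : 0 < q) (hB : ∀ z, ‖z‖ = (1 + q) * R → ‖h z‖ ≤ B) :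
    ∃ g : ℂ → ℂ, Differentiable ℂ g ∧
      (∀ z, h z = (∏ ρ ∈ zerosIn hd h0 R, (z - ρ) ^ analyticOrderNatAt h ρ) * g z) ∧
      (∀ z, ‖z‖ ≤ R → g z ≠ 0) ∧
      ∀ z, ‖z‖ ≤ (1 + q) * R → ‖g z‖ * (q ^ (∑ ρ ∈ zerosIn hd h0 R, analyticOrderNatAt h ρ)) *
        ‖h 0‖ ≤ ‖g 0‖ * B := by
  obtain ⟨g, hg, hgz, hgS⟩ := exists_eq_prod_mul hd h0 (zerosIn hd h0 R)
  refine ⟨g, hg, hgz, fun z hz hgz0 => ?_, ?_⟩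
  · by_cases hh : h z = 0
    · exact hgS z ((mem_zerosIn hd h0).2 ⟨hz, hh⟩) hgz0
    · exact hh (by rw [hgz, hgz0, mul_zero])
  have hsphere : ∀ z, ‖z‖ = (1 + q) * R →
      ‖g z‖ * (q ^ (∑ ρ ∈ zerosIn hd h0 R, analyticOrderNatAt h ρ)) * ‖h 0‖ ≤ ‖g 0‖ * B := by
    intro z hz
    set N := analyticOrderNatAt h
    -- On |z| = (1 + q)R each zero has |ρ| ≤ R, so |z − ρ| ≥ qR ≥ q|ρ|: each factor is at least q
    -- times its modulus at 0.
    have hP : (∏ ρ ∈ zerosIn hd h0 R, ‖0 - ρ‖ ^ N ρ) * q ^ (∑ ρ ∈ zerosIn hd h0 R, N ρ) ≤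
        ∏ ρ ∈ zerosIn hd h0 R, ‖z - ρ‖ ^ N ρ := by
      rw [← Finset.prod_pow_eq_pow_sum, ← Finset.prod_mul_distrib]
      refine Finset.prod_le_prod (fun ρ _ => by positivity) fun ρ hρ => ?_
      rw [← mul_pow]
      have hρR := ((mem_zerosIn hd h0).1 hρ).1
      have := norm_sub_norm_le z ρ
      refine pow_le_pow_left₀ (by positivity) ?_ _
      rw [zero_sub, norm_neg]
      nlinarith
    have e0 := congrArg norm (hgz 0)
    have ez := congrArg norm (hgz z)
    rw [norm_mul, norm_prod] at e0 ez
    simp only [norm_pow] at e0 ez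
    have hBz := hB z hz
    calc ‖g z‖ * q ^ (∑ ρ ∈ zerosIn hd h0 R, N ρ) * ‖h 0‖
        = ‖g 0‖ * (((∏ ρ ∈ zerosIn hd h0 R, ‖0 - ρ‖ ^ N ρ) *
            q ^ (∑ ρ ∈ zerosIn hd h0 R, N ρ)) * ‖g z‖) := by rw [e0]; ring
      _ ≤ ‖g 0‖ * ((∏ ρ ∈ zerosIn hd h0 R, ‖z - ρ‖ ^ N ρ) * ‖g z‖) := by gcongr
      _ ≤ _ := by rw [← ez]; gcongr
  intro z hz
  have hc : 0 < q ^ (∑ ρ ∈ zerosIn hd h0 R, analyticOrderNatAt h ρ) * ‖h 0‖ :=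
    mul_pos (by positivity) (norm_pos_iff.2 h0)
  -- The quotient is entire, so the maximum principle carries the bound from the circle to the disc.
  have key : ‖g z‖ ≤ ‖g 0‖ * B /
      (q ^ (∑ ρ ∈ zerosIn hd h0 R, analyticOrderNatAt h ρ) * ‖h 0‖) := by
    refine Complex.norm_le_of_forall_mem_frontier_norm_le
      (U := Metric.ball (0 : ℂ) ((1 + q) * R)) Metric.isBounded_ball hg.diffContOnCl
      (fun w hw => ?_) ?_
    · rw [frontier_ball _ (by positivity), mem_sphere_zero_iff_norm] at hw
      rw [le_div_iff₀ hc, ← mul_assoc]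
      exact hsphere w hw
    · rw [closure_ball _ (by positivity)]
      simpa using hz
  rw [le_div_iff₀ hc, ← mul_assoc] at key
  exact key

/-- Jensen's bound for the number of zeros in a disc. -/
lemma two_pow_card_zerosIn_le {h : ℂ → ℂ} (hd : Differentiable ℂ h) (h0 : h 0 ≠ 0) {R B : ℝ}
    (hR : 0 < R) (hB : ∀ z, ‖z‖ = 3 * R → ‖h z‖ ≤ B) :
    2 ^ (∑ ρ ∈ zerosIn hd h0 R, analyticOrderNatAt h ρ) * ‖h 0‖ ≤ B := by
  obtain ⟨g, -, -, hg0, hgb⟩ := exists_zerosIn_factor hd h0 (q := 2) hR two_pos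
    (by norm_num; exact hB)
  have h1 := hgb 0 (by simp; positivity)
  have h2 : 0 < ‖g 0‖ := norm_pos_iff.2 (hg0 0 (by simpa using hR.le))
  rw [mul_assoc] at h1
  exact le_of_mul_le_mul_left h1 h2

lemma logDeriv_prod_pow_sub (S : Finset ℂ) (N : ℂ → ℕ) {z : ℂ} (hz : ∀ ρ ∈ S, N ρ ≠ 0 → z ≠ ρ) :
    logDeriv (fun z => ∏ ρ ∈ S, (z - ρ) ^ N ρ) z = ∑ ρ ∈ S, N ρ / (z - ρ) := by
  rw [logDeriv_prod]
  · refine Finset.sum_congr rfl fun ρ _ => ?_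
    rw [logDeriv_fun_pow (by fun_prop), logDeriv_apply]
    have : deriv (fun z => z - ρ) z = 1 := by simp
    rw [this]; ring
  · intro ρ hρ
    by_cases hN : N ρ = 0
    · simp [hN]
    · exact pow_ne_zero _ (sub_ne_zero.2 (hz ρ hρ hN))
  · intro ρ _; fun_prop

/-- The logarithmic derivative of an even entire function is, up to a small error, the sum of the
principal parts at the zeros in a large disc. -/
lemma norm_logDeriv_sub_sum_le {h : ℂ → ℂ} (hd : Differentiable ℂ h) (h0 : h 0 ≠ 0)
    (heven : ∀ z, h (-z) = h z) {R A : ℝ} (hR : 0 < R) (hA : 0 < A)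
    (hB : ∀ z, ‖z‖ = 2 * R → ‖h z‖ ≤ Real.exp A * ‖h 0‖) {z : ℂ} (hz : ‖z‖ < R / 4)
    (hhz : h z ≠ 0) :
    ‖logDeriv h z - ∑ ρ ∈ zerosIn hd h0 R, analyticOrderNatAt h ρ / (z - ρ)‖ ≤
      32 * A * ‖z‖ / R ^ 2 := by
  -- With q = 1 the power of q disappears, and |g| ≤ e^A |g(0)| however many zeros were removed.
  obtain ⟨g, hg, hgz, hg0, hgb⟩ := exists_zerosIn_factor hd h0 (q := 1) hR one_pos
    (by norm_num; exact hB)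
  norm_num at hgb
  have hgb' : ∀ w, ‖w‖ < R → ‖g w‖ ≤ ‖g 0‖ * Real.exp A := by
    intro w hw
    have h1 := hgb w (by linarith)
    have h2 : 0 < ‖h 0‖ := norm_pos_iff.2 h0
    rw [← mul_assoc] at h1
    exact le_of_mul_le_mul_right h1 h2
  set S := zerosIn hd h0 R with hS
  set N := analyticOrderNatAt h with hN
  have hsplit : ∀ w, ‖w‖ ≤ R → h w ≠ 0 →
      logDeriv h w = ∑ ρ ∈ S, N ρ / (w - ρ) + logDeriv g w := by
    intro w hw hhw
    have hP : ∏ ρ ∈ S, (w - ρ) ^ N ρ ≠ 0 := by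
      intro h'; exact hhw (by rw [hgz, h', zero_mul])
    have e : h = fun w => (∏ ρ ∈ S, (w - ρ) ^ N ρ) * g w := funext hgz
    conv_lhs => rw [e]
    rw [logDeriv_mul w hP (hg0 w hw) (by fun_prop) (hg w), logDeriv_prod_pow_sub]
    rintro ρ hρ - rfl
    exact hhw ((mem_zerosIn hd h0).1 hρ).2
  -- By evenness, the logarithmic derivative of h and the sum over zeros both vanish at 0, hence so
  -- does that of g. This gives the Schwarz lemma below its extra factor |z|/R, without which the
  -- error would not tend to 0.
  have hmem : ∀ ρ ∈ S, -ρ ∈ S := by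
    intro ρ hρ
    have := (mem_zerosIn hd h0).1 hρ
    exact (mem_zerosIn hd h0).2 ⟨by simpa using this.1, by rw [heven]; exact this.2⟩
  have hNneg : ∀ ρ, N (-ρ) = N ρ := by
    intro ρ
    simp only [hN, analyticOrderNatAt]
    congr 1
    have e : h ∘ Neg.neg = h := funext heven
    conv_rhs => rw [← e]
    have h1 : AnalyticAt ℂ (Neg.neg : ℂ → ℂ) ρ := analyticAt_id.neg
    rw [analyticOrderAt_comp_of_deriv_ne_zero h1 (by rw [deriv_neg]; simp)]
  have hd0 : logDeriv h 0 = 0 := by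
    have e : (fun z => h (-z)) = h := funext heven
    have h1 : deriv h 0 = - deriv h 0 := by
      conv_lhs => rw [← e, deriv_comp_neg, neg_zero]
    have h2 : deriv h 0 = 0 := by linear_combination h1 / 2
    rw [logDeriv_apply, h2, zero_div]
  have hsum0 : ∑ ρ ∈ S, (N ρ : ℂ) / (0 - ρ) = 0 := by
    have h1 : ∑ ρ ∈ S, (N ρ : ℂ) / (0 - ρ) = ∑ ρ ∈ S, -((N ρ : ℂ) / (0 - ρ)) := by
      refine Finset.sum_bij' (fun ρ _ => -ρ) (fun ρ _ => -ρ) hmem hmem (by simp) (by simp) ?_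
      intro ρ _
      rw [hNneg, zero_sub, zero_sub, neg_neg, div_neg]
    rw [Finset.sum_neg_distrib] at h1
    linear_combination h1 / 2
  have hq0 : logDeriv g 0 = 0 := by
    have := hsplit 0 (by simpa using hR.le) h0
    rw [hd0, hsum0] at this
    simpa using this.symm
  have hqd : DifferentiableOn ℂ (logDeriv g) (Metric.ball 0 R) := by
    intro w hw
    have hw' : g w ≠ 0 := hg0 w (by simpa using (Metric.mem_ball.1 hw).le)
    have h1 : DifferentiableAt ℂ (deriv g) w := hg.contDiff.differentiable_deriv_two w
    exact (h1.div (hg w) hw').differentiableWithinAt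
  obtain ⟨ℓ, hℓ0, hℓ⟩ := hqd.isExactOn_ball.with_val_at 0 0
  have hexp : ∀ w ∈ Metric.ball (0 : ℂ) R, g w = g 0 * exp (ℓ w) := by
    have hconst : ∀ w ∈ Metric.ball (0 : ℂ) R, g w * exp (-ℓ w) = g 0 * exp (-ℓ 0) := by
      intro w hw
      refine (convex_ball (0 : ℂ) R).is_const_of_fderivWithin_eq_zero (𝕜 := ℂ)
        (f := fun w => g w * exp (-ℓ w)) ?_ ?_ hw (Metric.mem_ball_self hR)
      · intro v hv
        exact ((hg v).mul (hℓ v hv).differentiableAt.neg.cexp).differentiableWithinAt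
      · intro v hv
        have hv' : g v ≠ 0 := hg0 v (by simpa using (Metric.mem_ball.1 hv).le)
        have h1 : HasDerivAt (fun w => g w * exp (-ℓ w)) 0 v := by
          have := (hg v).hasDerivAt.mul (hℓ v hv).neg.cexp
          refine this.congr_deriv ?_
          simp only [Pi.neg_apply]
          rw [logDeriv_apply]
          field_simp
          ring
        rw [fderivWithin_of_isOpen Metric.isOpen_ball hv]
        have := h1.hasFDerivAt.fderiv
        rw [this]; ext; simp
    intro w hw
    have := hconst w hw
    rw [hℓ0, neg_zero, Complex.exp_zero, mul_one] at this
    rw [← this, mul_assoc, ← Complex.exp_add, neg_add_cancel, Complex.exp_zero, mul_one]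
  have hg00 : 0 < ‖g 0‖ := norm_pos_iff.2 (hg0 0 (by simpa using hR.le))
  have hℓd : DifferentiableOn ℂ ℓ (Metric.ball 0 R) := fun w hw =>
    (hℓ w hw).differentiableAt.differentiableWithinAt
  -- Here ℓ is a logarithm of g/g(0), and its real part is at most A; Borel–Carathéodory bounds its
  -- modulus.
  have hBC : ∀ w, ‖w‖ ≤ R / 2 → ‖ℓ w‖ ≤ 2 * A := by
    intro w hw
    have := borelCaratheodory_zero hA hℓd (fun v hv => ?_) hR
      (mem_ball_zero_iff.2 (by linarith : ‖w‖ < R)) hℓ0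
    · refine this.trans ?_
      rw [div_le_iff₀ (by linarith)]
      nlinarith
    · have h1 := hgb' v (mem_ball_zero_iff.1 hv)
      rw [hexp v hv, norm_mul, Complex.norm_exp] at h1
      exact Real.exp_le_exp.1 (le_of_mul_le_mul_left h1 hg00)
  have hq : ∀ w, ‖w‖ < R / 4 → ‖logDeriv g w‖ ≤ 8 * A / R := by
    intro w hw
    have hsub : Metric.closedBall w (R / 4) ⊆ Metric.ball 0 R := by
      intro v hv
      have := norm_sub_norm_le v w
      rw [Metric.mem_closedBall, dist_eq_norm] at hv
      rw [mem_ball_zero_iff]; linarith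
    rw [← (hℓ w (mem_ball_zero_iff.2 (by linarith))).deriv]
    refine (Complex.norm_deriv_le_of_forall_mem_sphere_norm_le (R := R / 4) (C := 2 * A)
      (by linarith) ?_ fun v hv => ?_).trans (le_of_eq (by field_simp; ring))
    · refine (hℓd.mono ?_).diffContOnCl
      rw [closure_ball _ (by linarith)]; exact hsub
    · refine hBC v ?_
      have := norm_sub_norm_le v w
      rw [mem_sphere_iff_norm] at hv
      linarith
  rw [hsplit z (by linarith) hhz, add_sub_cancel_left]
  -- Schwarz lemma on the disc of radius R/4: the Cauchy bound 8A/R divided by R/4 gives 32A/R².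
  have hmaps : Set.MapsTo (logDeriv g) (Metric.ball 0 (R / 4))
      (Metric.closedBall (logDeriv g 0) (8 * A / R)) := by
    intro w hw
    rw [hq0, mem_closedBall_zero_iff]
    exact hq w (mem_ball_zero_iff.1 hw)
  have := dist_le_div_mul_dist_of_mapsTo_ball
    (hqd.mono (Metric.ball_subset_ball (by linarith))) hmaps (mem_ball_zero_iff.2 hz)
  rw [hq0, dist_zero_right, dist_zero_right] at this
  refine this.trans (le_of_eq ?_)
  field_simp
  ring

end Hadamard

/-- `riemannXi`, recentred so that the functional equation says that it is even. -/
noncomputable def xiEven (z : ℂ) : ℂ := riemannXi (1 / 2 + z)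

lemma differentiable_xiEven : Differentiable ℂ xiEven := by
  have := differentiable_riemannXi
  unfold xiEven
  fun_prop

lemma xiEven_neg (z : ℂ) : xiEven (-z) = xiEven z := by
  rw [xiEven, xiEven, ← riemannXi_one_sub]; ring_nf

lemma xiEven_ofReal_ne_zero (y : ℝ) : xiEven y ≠ 0 := by
  intro h
  have := one_lt_abs_im_of_riemannXi_eq_zero h
  norm_num at this

lemma xiEven_zero_ne_zero : xiEven 0 ≠ 0 := by simpa using xiEven_ofReal_ne_zero 0

lemma analyticOrderNatAt_comp_neg (h : ℂ → ℂ) (heven : ∀ z, h (-z) = h z) (z : ℂ) :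
    analyticOrderNatAt h (-z) = analyticOrderNatAt h z := by
  simp only [analyticOrderNatAt]
  congr 1
  have e : h ∘ Neg.neg = h := funext heven
  conv_rhs => rw [← e]
  have h1 : AnalyticAt ℂ (Neg.neg : ℂ → ℂ) z := analyticAt_id.neg
  rw [analyticOrderAt_comp_of_deriv_ne_zero h1 (by rw [deriv_neg]; simp)]

/-! ### The numbers τ: location, counting, and partial fractions -/

namespace UpperZero

/-- The multiplicity of an upper zero. -/
noncomputable def mult (ρ : UpperZero) : ℕ := analyticOrderNatAt riemannZeta ρ.1

lemma zeroMult_eq (ρ : UpperZero) : zeroMult ρ.1 = ρ.mult := rfl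

lemma I_mul_tau (ρ : UpperZero) : I * ρ.tau = ρ.1 - 1 / 2 := by
  rw [tau, mul_div_cancel₀ _ I_ne_zero]

lemma tau_eq (ρ : UpperZero) : ρ.tau = -I * (ρ.1 - 1 / 2) := by
  rw [← I_mul_tau, ← mul_assoc]; simp

lemma tau_re (ρ : UpperZero) : ρ.tau.re = ρ.1.im := by simp [tau_eq]

lemma tau_im (ρ : UpperZero) : ρ.tau.im = 1 / 2 - ρ.1.re := by simp [tau_eq]

lemma xiEven_I_mul_tau (ρ : UpperZero) : xiEven (I * ρ.tau) = 0 := by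
  rw [I_mul_tau, xiEven, riemannXi_eq_zero_iff]
  simpa using ⟨ρ.2.1, ρ.2.2.1, ρ.2.2.2.1⟩

lemma one_lt_tau_re (ρ : UpperZero) : 1 < ρ.tau.re := by
  have h := one_lt_abs_im_of_riemannXi_eq_zero (s := ρ.1)
    (riemannXi_eq_zero_iff.2 ⟨ρ.2.1, ρ.2.2.1, ρ.2.2.2.1⟩)
  rwa [tau_re, ← abs_of_pos ρ.2.2.2.2]

lemma abs_tau_im_lt (ρ : UpperZero) : |ρ.tau.im| < 1 / 2 := by
  have h1 := ρ.2.2.1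
  have h2 := ρ.2.2.2.1
  rw [tau_im, abs_lt]
  constructor <;> linarith

lemma one_lt_norm_tau (ρ : UpperZero) : 1 < ‖ρ.tau‖ :=
  ρ.one_lt_tau_re.trans_le (re_le_norm _)

lemma tau_ne_zero (ρ : UpperZero) : ρ.tau ≠ 0 :=
  norm_pos_iff.1 (zero_lt_one.trans ρ.one_lt_norm_tau)

lemma tau_sq_re_pos (ρ : UpperZero) : 0 < (ρ.tau ^ 2).re := by
  have h1 := ρ.one_lt_tau_re
  have h2 := abs_lt.1 ρ.abs_tau_im_lt
  rw [sq, mul_re]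
  nlinarith

lemma tau_injective : Function.Injective tau := by
  intro ρ ρ' h
  have := ρ.I_mul_tau
  rw [h, I_mul_tau] at this
  exact Subtype.ext (sub_left_injective this).symm

lemma mult_eq (ρ : UpperZero) : ρ.mult = analyticOrderNatAt xiEven (I * ρ.tau) := by
  have h1 : AnalyticAt ℂ (fun z : ℂ => 1 / 2 + z) (I * ρ.tau) := by fun_prop
  have e : xiEven = riemannXi ∘ fun z : ℂ => 1 / 2 + z := rfl
  have hne : ρ.1 ≠ 1 := by
    intro h
    have := ρ.2.2.2.1
    rw [h] at this
    simp at this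
  rw [mult, analyticOrderNatAt, analyticOrderNatAt, e,
    analyticOrderAt_comp_of_deriv_ne_zero h1 (by simp), I_mul_tau, add_sub_cancel,
    analyticOrderAt_riemannXi ρ.2.2.1 hne]

lemma exists_of_xiEven_eq_zero {z : ℂ} (h : xiEven z = 0) :
    ∃ ρ : UpperZero, z = I * ρ.tau ∨ z = -(I * ρ.tau) := by
  have key : ∀ w : ℂ, xiEven w = 0 → 0 < w.im → ∃ ρ : UpperZero, w = I * ρ.tau := by
    intro w hw him
    obtain ⟨h1, h2, h3⟩ := riemannXi_eq_zero_iff.1 hw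
    obtain ⟨ρ, hρ⟩ : ∃ ρ : UpperZero, ρ.1 = 1 / 2 + w :=
      ⟨⟨1 / 2 + w, h1, h2, h3, by simpa using him⟩, rfl⟩
    refine ⟨ρ, ?_⟩
    rw [I_mul_tau, hρ]; ring
  have him := one_lt_abs_im_of_riemannXi_eq_zero h
  rcases lt_trichotomy z.im 0 with h0 | h0 | h0
  · obtain ⟨ρ, hρ⟩ := key (-z) (by rw [xiEven_neg, h]) (by simpa using h0)
    exact ⟨ρ, Or.inr (by rw [← hρ, neg_neg])⟩
  · simp [h0] at him
    linarith
  · obtain ⟨ρ, hρ⟩ := key z h h0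
    exact ⟨ρ, Or.inl hρ⟩

lemma finite_norm_tau_le (R : ℝ) : {ρ : UpperZero | ‖ρ.tau‖ ≤ R}.Finite := by
  refine Set.Finite.of_finite_image (f := fun ρ => I * ρ.tau)
    ((finite_zeros_closedBall differentiable_xiEven xiEven_zero_ne_zero R).subset ?_) ?_
  · rintro _ ⟨ρ, hρ, rfl⟩
    exact ⟨by simpa using hρ, ρ.xiEven_I_mul_tau⟩
  · intro ρ _ ρ' _ h
    exact tau_injective (mul_left_cancel₀ I_ne_zero h)

/-- The upper zeros with `|τ| ≤ R`. -/
noncomputable def upTo (R : ℝ) : Finset UpperZero := (finite_norm_tau_le R).toFinset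

lemma mem_upTo {R : ℝ} {ρ : UpperZero} : ρ ∈ upTo R ↔ ‖ρ.tau‖ ≤ R := by simp [upTo]

lemma sum_zerosIn_xiEven {E : Type*} [AddCommMonoid E] (R : ℝ) (F : ℂ → E) :
    ∑ z ∈ zerosIn differentiable_xiEven xiEven_zero_ne_zero R, F z =
      ∑ ρ ∈ upTo R, (F (I * ρ.tau) + F (-(I * ρ.tau))) := by
  classical
  have e : zerosIn differentiable_xiEven xiEven_zero_ne_zero R =
      (upTo R).image (fun ρ => I * ρ.tau) ∪ (upTo R).image (fun ρ => -(I * ρ.tau)) := by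
    ext z
    simp only [mem_zerosIn, Finset.mem_union, Finset.mem_image, mem_upTo]
    constructor
    · rintro ⟨h1, h2⟩
      obtain ⟨ρ, rfl | rfl⟩ := exists_of_xiEven_eq_zero h2
      · exact Or.inl ⟨ρ, by simpa using h1, rfl⟩
      · exact Or.inr ⟨ρ, by simpa using h1, rfl⟩
    · rintro (⟨ρ, h1, rfl⟩ | ⟨ρ, h1, rfl⟩)
      · exact ⟨by simpa using h1, ρ.xiEven_I_mul_tau⟩
      · exact ⟨by simpa using h1, by rw [xiEven_neg, ρ.xiEven_I_mul_tau]⟩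
  have hdisj : Disjoint ((upTo R).image (fun ρ => I * ρ.tau))
      ((upTo R).image (fun ρ => -(I * ρ.tau))) := by
    rw [Finset.disjoint_left]
    intro z hz hz'
    obtain ⟨ρ, -, rfl⟩ := Finset.mem_image.1 hz
    obtain ⟨ρ', -, h⟩ := Finset.mem_image.1 hz'
    have := congrArg Complex.im h
    simp at this
    linarith [ρ.one_lt_tau_re, ρ'.one_lt_tau_re]
  have hinj : Function.Injective fun ρ : UpperZero => I * ρ.tau := fun ρ ρ' h =>
    tau_injective (mul_left_cancel₀ I_ne_zero h)
  rw [e, Finset.sum_union hdisj, Finset.sum_image (fun _ _ _ _ h => hinj h),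
    Finset.sum_image (fun _ _ _ _ h => hinj (neg_injective h)), Finset.sum_add_distrib]

/-- Jensen's bound on the circle of radius 3R: the growth estimate controls the logarithm of the
maximum, and each τ is counted twice, for ±iτ. -/
lemma sum_mult_upTo_le {ε : ℝ} (hε : 0 < ε) :
    ∃ C : ℝ, 0 < C ∧ ∀ R : ℝ, 0 < R →
      ((∑ ρ ∈ upTo R, ρ.mult : ℕ) : ℝ) ≤ C * (1 + R) ^ (1 + ε) := by
  obtain ⟨C, hC, hb⟩ := norm_riemannXi_le hε
  have hl := Real.log_pos one_lt_two
  set K := |Real.log ‖xiEven 0‖|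
  refine ⟨(C * 3 ^ (1 + ε) + K) / Real.log 2, by positivity, fun R hR => ?_⟩
  have h0 : 0 < ‖xiEven 0‖ := norm_pos_iff.2 xiEven_zero_ne_zero
  have h1 := two_pow_card_zerosIn_le differentiable_xiEven xiEven_zero_ne_zero hR
    (B := Real.exp (C * (1 + 3 * R) ^ (1 + ε))) (fun z hz => by
      have := hb z
      rwa [hz] at this)
  rw [sum_zerosIn_xiEven] at h1
  have h2 : ∑ ρ ∈ upTo R, (analyticOrderNatAt xiEven (I * ρ.tau) +
      analyticOrderNatAt xiEven (-(I * ρ.tau))) = 2 * ∑ ρ ∈ upTo R, ρ.mult := by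
    rw [Finset.mul_sum]
    refine Finset.sum_congr rfl fun ρ _ => ?_
    rw [analyticOrderNatAt_comp_neg _ xiEven_neg, ← mult_eq]; ring
  rw [h2] at h1
  have h3 := Real.log_le_log (by positivity) h1
  rw [Real.log_mul (by positivity) h0.ne', Real.log_pow, Real.log_exp] at h3
  push_cast at h3
  set n : ℝ := ∑ ρ ∈ upTo R, (ρ.mult : ℝ)
  have hn : 0 ≤ n := Finset.sum_nonneg fun _ _ => Nat.cast_nonneg _
  have h4 : (1 + 3 * R) ^ (1 + ε) ≤ 3 ^ (1 + ε) * (1 + R) ^ (1 + ε) := by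
    rw [← Real.mul_rpow (by norm_num) (by positivity)]
    gcongr
    linarith
  have h5 : (1 : ℝ) ≤ (1 + R) ^ (1 + ε) := Real.one_le_rpow (by linarith) (by linarith)
  have h6 : -Real.log ‖xiEven 0‖ ≤ K := neg_le_abs _
  have hK : 0 ≤ K := abs_nonneg _
  push_cast
  rw [div_mul_eq_mul_div, le_div_iff₀ hl]
  have h7 : C * (1 + 3 * R) ^ (1 + ε) ≤ C * (3 ^ (1 + ε) * (1 + R) ^ (1 + ε)) := by gcongr
  nlinarith [mul_nonneg hn hl.le]

/-- Split into dyadic blocks 2^i ≤ |τ| < 2^(i+1). With counting exponent e = 1 + (r − 1)/2 < r, the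
blocks are dominated by a geometric series of ratio 2^(e−r) < 1. -/
lemma summable_mult_mul_rpow {r : ℝ} (hr : 1 < r) :
    Summable fun ρ : UpperZero => (ρ.mult : ℝ) * ‖ρ.tau‖ ^ (-r) := by
  classical
  obtain ⟨C, hC, hb⟩ := sum_mult_upTo_le (ε := (r - 1) / 2) (by linarith)
  set e : ℝ := 1 + (r - 1) / 2 with he
  choose j hj1 hj2 using fun ρ : UpperZero =>
    exists_nat_pow_near ρ.one_lt_norm_tau.le (one_lt_two (α := ℝ))
  set q : ℝ := 2 ^ (e - r) with hq
  have hq0 : 0 < q := by positivity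
  have hq1 : q < 1 := Real.rpow_lt_one_of_one_lt_of_neg one_lt_two (by rw [he]; linarith)
  have hgeo : Summable fun i : ℕ => C * 4 ^ e * q ^ i :=
    (summable_geometric_of_lt_one hq0.le hq1).mul_left _
  refine summable_of_sum_le (c := ∑' i : ℕ, C * 4 ^ e * q ^ i) (fun ρ => by positivity) fun S => ?_
  have hmaps : ∀ ρ ∈ S, j ρ ∈ S.image j := fun ρ hρ => Finset.mem_image_of_mem j hρ
  rw [← Finset.sum_fiberwise_of_maps_to hmaps]
  refine (Finset.sum_le_sum fun i _ => ?_).trans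
    (hgeo.sum_le_tsum (S.image j) (fun _ _ => by positivity))
  have h2i : (1 : ℝ) ≤ 2 ^ i := one_le_pow₀ one_le_two
  calc ∑ ρ ∈ S with j ρ = i, (ρ.mult : ℝ) * ‖ρ.tau‖ ^ (-r)
      ≤ ∑ ρ ∈ S with j ρ = i, (ρ.mult : ℝ) * ((2 : ℝ) ^ i) ^ (-r) := by
        refine Finset.sum_le_sum fun ρ hρ => ?_
        have hi : j ρ = i := (Finset.mem_filter.1 hρ).2
        have := hj1 ρ
        rw [hi] at this
        gcongr ?_ * ?_
        exact Real.rpow_le_rpow_of_nonpos (by positivity) this (by linarith)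
    _ = ((∑ ρ ∈ S with j ρ = i, ρ.mult : ℕ) : ℝ) * ((2 : ℝ) ^ i) ^ (-r) := by
        push_cast; rw [Finset.sum_mul]
    _ ≤ ((∑ ρ ∈ upTo (2 ^ (i + 1)), ρ.mult : ℕ) : ℝ) * ((2 : ℝ) ^ i) ^ (-r) := by
        gcongr
        intro ρ hρ
        have hi : j ρ = i := (Finset.mem_filter.1 hρ).2
        rw [mem_upTo, ← hi]
        exact (hj2 ρ).le
    _ ≤ C * (1 + 2 ^ (i + 1)) ^ e * ((2 : ℝ) ^ i) ^ (-r) := by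
        gcongr
        exact hb _ (by positivity)
    _ ≤ C * (4 * 2 ^ i) ^ e * ((2 : ℝ) ^ i) ^ (-r) := by
        have h1e : 0 ≤ e := by rw [he]; linarith
        gcongr
        rw [pow_succ]; linarith
    _ = C * 4 ^ e * q ^ i := by
        rw [Real.mul_rpow (by norm_num) (by positivity), hq, ← Real.rpow_natCast (2 ^ (e - r)),
          ← Real.rpow_mul (by norm_num), mul_assoc, mul_assoc, mul_assoc,
          ← Real.rpow_add (by positivity), ← Real.rpow_natCast 2 i, ← Real.rpow_mul (by norm_num)]
        ring_nf

/-- Since Re τ² > 0, adding v ≥ 0 moves the point away from 0. This gives a majorant for the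
resolvent sum that is uniform in v. -/
lemma norm_tau_sq_le_norm_add {v : ℝ} (hv : 0 ≤ v) (ρ : UpperZero) :
    ‖ρ.tau‖ ^ 2 ≤ ‖(v : ℂ) + ρ.tau ^ 2‖ := by
  rw [← norm_pow]
  refine abs_le_of_sq_le_sq' ?_ (norm_nonneg _) |>.2
  have := ρ.tau_sq_re_pos
  rw [Complex.sq_norm, Complex.sq_norm, normSq_apply, normSq_apply]
  simp only [add_re, ofReal_re, add_im, ofReal_im, zero_add]
  nlinarith

lemma norm_mult_div_le {v : ℝ} (hv : 0 ≤ v) (ρ : UpperZero) :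
    ‖(ρ.mult : ℂ) / (v + ρ.tau ^ 2)‖ ≤ ρ.mult * ‖ρ.tau‖ ^ (-2 : ℝ) := by
  have h0 : 0 < ‖ρ.tau‖ := norm_pos_iff.2 ρ.tau_ne_zero
  rw [norm_div, Complex.norm_natCast, Real.rpow_neg h0.le, div_eq_mul_inv]
  have := norm_tau_sq_le_norm_add hv ρ
  have h2 : ‖ρ.tau‖ ^ (2 : ℝ) = ‖ρ.tau‖ ^ 2 := by exact_mod_cast Real.rpow_natCast _ 2
  rw [h2]
  gcongr

lemma summable_mult_div {v : ℝ} (hv : 0 ≤ v) :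
    Summable fun ρ : UpperZero => (ρ.mult : ℂ) / (v + ρ.tau ^ 2) :=
  Summable.of_norm_bounded (summable_mult_mul_rpow one_lt_two) (norm_mult_div_le hv)

lemma tendsto_upTo : Tendsto (fun n : ℕ => upTo n) atTop atTop := by
  refine tendsto_atTop_finset_of_monotone (fun a b hab ρ hρ => ?_) fun ρ => ?_
  · rw [mem_upTo] at hρ ⊢
    exact hρ.trans (by exact_mod_cast hab)
  · obtain ⟨n, hn⟩ := exists_nat_ge ‖ρ.tau‖
    exact ⟨n, mem_upTo.2 hn⟩

/-- The partial fraction expansion of the logarithmic derivative. -/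
lemma logDeriv_xiEven_eq_tsum {y : ℝ} :
    logDeriv xiEven y = 2 * y * ∑' ρ : UpperZero, (ρ.mult : ℂ) / ((y ^ 2 : ℝ) + ρ.tau ^ 2) := by
  obtain ⟨C, hC, hb⟩ := norm_riemannXi_le (ε := 1 / 2) (by norm_num)
  have h0 : 0 < ‖xiEven 0‖ := norm_pos_iff.2 xiEven_zero_ne_zero
  set K := |Real.log ‖xiEven 0‖|
  have hK : 0 ≤ K := abs_nonneg _
  have hterm : ∀ ρ : UpperZero,
      (analyticOrderNatAt xiEven (I * ρ.tau) : ℂ) / (y - I * ρ.tau) +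
        (analyticOrderNatAt xiEven (-(I * ρ.tau)) : ℂ) / (y - -(I * ρ.tau)) =
      2 * y * ((ρ.mult : ℂ) / ((y ^ 2 : ℝ) + ρ.tau ^ 2)) := by
    intro ρ
    rw [analyticOrderNatAt_comp_neg _ xiEven_neg, ← mult_eq]
    have h1 : (y : ℂ) ^ 2 + ρ.tau ^ 2 = (y - I * ρ.tau) * (y - -(I * ρ.tau)) := by
      ring_nf; rw [I_sq]; ring
    have h2 : ((y ^ 2 : ℝ) : ℂ) + ρ.tau ^ 2 ≠ 0 := by
      intro h
      have h3 := norm_tau_sq_le_norm_add (sq_nonneg y) ρ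
      rw [h, norm_zero] at h3
      have := ρ.one_lt_norm_tau
      nlinarith
    push_cast at h2 ⊢
    rw [h1] at h2 ⊢
    have ha := left_ne_zero_of_mul h2
    have hb := right_ne_zero_of_mul h2
    rw [div_add_div _ _ ha hb, ← mul_div_assoc]
    congr 1
    ring
  have hS := (summable_mult_div (sq_nonneg y)).hasSum.mul_left (2 * (y : ℂ))
  have ht1 := hS.comp tendsto_upTo
  refine tendsto_nhds_unique ?_ ht1
  rw [tendsto_iff_norm_sub_tendsto_zero]
  -- Growth exponent 3/2 makes the bound A of size n^(3/2), so the error 32A|y|/n² is O(n^(-1/2)).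
  have hlim : Tendsto (fun n : ℕ => 32 * ((3 : ℝ) ^ (3 / 2 : ℝ) * C + K + 1) * |y| *
      ((n : ℝ) ^ (-(1 / 2) : ℝ))) atTop (𝓝 0) := by
    have := (tendsto_rpow_neg_atTop (y := 1 / 2) (by norm_num)).comp
      (tendsto_natCast_atTop_atTop (R := ℝ))
    simpa using this.const_mul (32 * ((3 : ℝ) ^ (3 / 2 : ℝ) * C + K + 1) * |y|)
  refine squeeze_zero' (Eventually.of_forall fun _ => norm_nonneg _) ?_ hlim
  obtain ⟨n0, hn0⟩ := exists_nat_gt (4 * |y|)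
  filter_upwards [eventually_ge_atTop n0, eventually_ge_atTop 1] with n hn hn1
  have hn' : (n0 : ℝ) ≤ n := by exact_mod_cast hn
  have hn1' : (1 : ℝ) ≤ n := by exact_mod_cast hn1
  have hA : ∀ z : ℂ, ‖z‖ = 2 * (n : ℝ) → ‖xiEven z‖ ≤
      Real.exp (((3 : ℝ) ^ (3 / 2 : ℝ) * C + K + 1) * (n : ℝ) ^ (3 / 2 : ℝ)) * ‖xiEven 0‖ := by
    intro z hz
    have h1 := hb z
    rw [hz] at h1
    refine h1.trans ?_
    rw [← Real.exp_log h0, ← Real.exp_add]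
    have h2 : (1 + 2 * (n : ℝ)) ^ (1 + 1 / 2 : ℝ) ≤ 3 ^ (3 / 2 : ℝ) * (n : ℝ) ^ (3 / 2 : ℝ) := by
      rw [← Real.mul_rpow (by norm_num) (by positivity), show (1 + 1 / 2 : ℝ) = 3 / 2 by norm_num]
      gcongr
      linarith
    have h3 : (1 : ℝ) ≤ (n : ℝ) ^ (3 / 2 : ℝ) := Real.one_le_rpow hn1' (by norm_num)
    have h4 : -Real.log ‖xiEven 0‖ ≤ K := neg_le_abs _
    gcongr
    have h5 : C * (1 + 2 * (n : ℝ)) ^ (1 + 1 / 2 : ℝ) ≤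
        C * (3 ^ (3 / 2 : ℝ) * (n : ℝ) ^ (3 / 2 : ℝ)) := by gcongr
    nlinarith
  have hb2 := norm_logDeriv_sub_sum_le differentiable_xiEven xiEven_zero_ne_zero xiEven_neg
    (R := n) (by linarith) (by positivity) hA (z := y)
    (by rw [norm_real, Real.norm_eq_abs]; linarith) (xiEven_ofReal_ne_zero y)
  rw [sum_zerosIn_xiEven, Finset.sum_congr rfl (fun ρ _ => hterm ρ)] at hb2
  rw [norm_sub_rev]
  refine hb2.trans (le_of_eq ?_)
  rw [norm_real, Real.norm_eq_abs]
  have h7 : (n : ℝ) ^ (3 / 2 : ℝ) / (n : ℝ) ^ 2 = (n : ℝ) ^ (-(1 / 2) : ℝ) := by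
    rw [← Real.rpow_natCast _ 2, ← Real.rpow_sub (by linarith)]
    norm_num
  rw [← h7]
  ring

end UpperZero

/-! ### Arithmetic of asymptotic expansions at 0 from the right -/

section Expansion

open Asymptotics

/-- `f` has the asymptotic expansion `φ` at `0` from the right. -/
def HasExpansion (f : ℝ → ℝ) (φ : PowerSeries ℝ) : Prop :=
  ∀ N : ℕ, (fun t => f t - ∑ j ∈ Finset.range N, PowerSeries.coeff j φ * t ^ j) =O[𝓝[>] 0]
    fun t => t ^ N

lemma hasExpansion_iff_trunc {f : ℝ → ℝ} {φ : PowerSeries ℝ} :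
    HasExpansion f φ ↔ ∀ N : ℕ, (fun t => f t - (PowerSeries.trunc N φ).eval t) =O[𝓝[>] 0]
      fun t => t ^ N := by
  have : ∀ N t, (PowerSeries.trunc N φ).eval t =
      ∑ j ∈ Finset.range N, PowerSeries.coeff j φ * t ^ j := fun N t => by
    rw [Polynomial.eval, PowerSeries.eval₂_trunc_eq_sum_range]; simp
  simp only [HasExpansion, this]

lemma isBigO_eval_of_coeff_eq_zero {P : Polynomial ℝ} {N : ℕ} (h : ∀ j < N, P.coeff j = 0) :
    (fun t => P.eval t) =O[𝓝[>] 0] fun t => t ^ N := by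
  obtain ⟨Q, rfl⟩ := Polynomial.X_pow_dvd_iff.2 h
  have h1 : (fun t => Q.eval t) =O[𝓝[>] 0] fun _ => (1 : ℝ) :=
    (Q.continuous.tendsto 0).mono_left nhdsWithin_le_nhds |>.isBigO_one ℝ
  simpa using (isBigO_refl (fun t : ℝ => t ^ N) _).mul h1

lemma HasExpansion.isBigO_one {f : ℝ → ℝ} {φ : PowerSeries ℝ} (h : HasExpansion f φ) :
    f =O[𝓝[>] 0] fun _ => (1 : ℝ) := by simpa using h 0

lemma HasExpansion.congr {f g : ℝ → ℝ} {φ : PowerSeries ℝ} (h : HasExpansion f φ)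
    (hfg : ∀ t, 0 < t → f t = g t) : HasExpansion g φ := fun N =>
  (h N).congr' (by
    filter_upwards [self_mem_nhdsWithin] with t ht
    rw [hfg t ht]) EventuallyEq.rfl

lemma HasExpansion.add {f g : ℝ → ℝ} {φ ψ : PowerSeries ℝ} (hf : HasExpansion f φ)
    (hg : HasExpansion g ψ) : HasExpansion (fun t => f t + g t) (φ + ψ) := fun N =>
  ((hf N).add (hg N)).congr_left fun t => by
    simp only [map_add, add_mul, Finset.sum_add_distrib]; ring

lemma HasExpansion.const_mul {f : ℝ → ℝ} {φ : PowerSeries ℝ} (hf : HasExpansion f φ) (c : ℝ) :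
    HasExpansion (fun t => c * f t) (c • φ) := fun N =>
  ((hf N).const_mul_left c).congr_left fun t => by
    simp only [mul_sub, Finset.mul_sum, PowerSeries.coeff_smul, smul_eq_mul, mul_assoc]

lemma HasExpansion.sub {f g : ℝ → ℝ} {φ ψ : PowerSeries ℝ} (hf : HasExpansion f φ)
    (hg : HasExpansion g ψ) : HasExpansion (fun t => f t - g t) (φ - ψ) := fun N =>
  ((hf N).sub (hg N)).congr_left fun t => by
    simp only [map_sub, sub_mul, Finset.sum_sub_distrib]; ring

lemma hasExpansion_polynomial (P : Polynomial ℝ) :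
    HasExpansion (fun t => P.eval t) (P : PowerSeries ℝ) := by
  rw [hasExpansion_iff_trunc]
  intro N
  have : (fun t => P.eval t - (PowerSeries.trunc N (P : PowerSeries ℝ)).eval t) =
      fun t => (P - PowerSeries.trunc N (P : PowerSeries ℝ)).eval t := by
    ext t; simp
  rw [this]
  refine isBigO_eval_of_coeff_eq_zero fun j hj => ?_
  simp [PowerSeries.coeff_trunc, hj]

lemma HasExpansion.mul {f g : ℝ → ℝ} {φ ψ : PowerSeries ℝ} (hf : HasExpansion f φ)
    (hg : HasExpansion g ψ) : HasExpansion (fun t => f t * g t) (φ * ψ) := by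
  rw [hasExpansion_iff_trunc] at *
  intro N
  have h1 := (hf N).mul ((hasExpansion_iff_trunc.2 hg).isBigO_one)
  have h2 : (fun t => (PowerSeries.trunc N φ).eval t * (g t - (PowerSeries.trunc N ψ).eval t))
      =O[𝓝[>] 0] fun t => 1 * t ^ N :=
    ((((PowerSeries.trunc N φ).continuous.tendsto 0).mono_left nhdsWithin_le_nhds).isBigO_one ℝ).mul
      (hg N)
  have h3 : (fun t => (PowerSeries.trunc N φ * PowerSeries.trunc N ψ -
      PowerSeries.trunc N (φ * ψ)).eval t) =O[𝓝[>] 0] fun t => t ^ N := by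
    refine isBigO_eval_of_coeff_eq_zero fun j hj => ?_
    rw [Polynomial.coeff_sub, PowerSeries.coeff_trunc, if_pos hj,
      PowerSeries.coeff_mul_eq_coeff_trunc_mul_trunc φ ψ hj, ← Polynomial.coe_mul,
      Polynomial.coeff_coe, sub_self]
  simp only [mul_one, one_mul] at h1 h2
  refine ((h1.add h2).add h3).congr_left fun t => ?_
  simp only [Polynomial.eval_sub, Polynomial.eval_mul]
  ring

/-- Division of asymptotic expansions. -/
lemma HasExpansion.of_mul_eq {f g p : ℝ → ℝ} {φ ψ : PowerSeries ℝ} (hf : HasExpansion f φ)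
    (hp : HasExpansion p (φ * ψ)) (hfg : ∀ t, 0 < t → f t * g t = p t)
    (h0 : PowerSeries.coeff 0 φ ≠ 0) : HasExpansion g ψ := by
  rw [hasExpansion_iff_trunc]
  intro N
  have htend : Tendsto f (𝓝[>] 0) (𝓝 (PowerSeries.coeff 0 φ)) := by
    have h1 := hf 1
    simp only [Finset.range_one, Finset.sum_singleton, pow_zero, mul_one, pow_one] at h1
    have h2 : Tendsto (fun t : ℝ => t) (𝓝[>] 0) (𝓝 0) := tendsto_id.mono_left nhdsWithin_le_nhds
    have := (h1.trans_tendsto h2).add_const (PowerSeries.coeff 0 φ)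
    simpa using this
  have h1 := hp.sub (hf.mul (hasExpansion_polynomial (PowerSeries.trunc N ψ)))
  have h2 := h1 N
  have hz : ∀ j < N, PowerSeries.coeff j
      (φ * ψ - φ * ((PowerSeries.trunc N ψ : Polynomial ℝ) : PowerSeries ℝ)) = 0 := by
    intro j hj
    rw [← mul_sub, PowerSeries.coeff_mul]
    refine Finset.sum_eq_zero fun x hx => ?_
    have : x.2 < N := by
      have := Finset.HasAntidiagonal.mem_antidiagonal.1 hx
      omega
    simp [PowerSeries.coeff_trunc, this]
  have h3 : (fun t => f t * (g t - (PowerSeries.trunc N ψ).eval t)) =O[𝓝[>] 0]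
      fun t => t ^ N := by
    refine h2.congr' ?_ EventuallyEq.rfl
    filter_upwards [self_mem_nhdsWithin] with t ht
    rw [Finset.sum_eq_zero (fun j hj => by rw [hz j (Finset.mem_range.1 hj), zero_mul]), ← hfg t ht]
    ring
  have h4 : (fun t => (f t)⁻¹) =O[𝓝[>] 0] fun _ => (1 : ℝ) :=
    (htend.inv₀ h0).isBigO_one ℝ
  have h5 := h4.mul h3
  simp only [one_mul] at h5
  refine h5.congr' ?_ EventuallyEq.rfl
  filter_upwards [htend.eventually_ne h0] with t ht
  field_simp

lemma HasExpansion.comp_mul {f : ℝ → ℝ} {φ : PowerSeries ℝ} (hf : HasExpansion f φ) {c : ℝ}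
    (hc : 0 < c) : HasExpansion (fun t => f (c * t)) (PowerSeries.rescale c φ) := by
  intro N
  have ht : Tendsto (fun t : ℝ => c * t) (𝓝[>] 0) (𝓝[>] 0) := by
    refine tendsto_nhdsWithin_iff.2 ⟨?_, ?_⟩
    · have : Tendsto (fun t : ℝ => c * t) (𝓝 0) (𝓝 (c * 0)) :=
        (continuous_const.mul continuous_id).tendsto 0
      rw [mul_zero] at this
      exact this.mono_left nhdsWithin_le_nhds
    · filter_upwards [self_mem_nhdsWithin] with t ht
      exact mul_pos hc ht
  have h1 := (hf N).comp_tendsto ht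
  have h2 : (fun t : ℝ => (c * t) ^ N) =O[𝓝[>] 0] fun t => t ^ N :=
    ((isBigO_refl (fun t : ℝ => t ^ N) _).const_mul_left (c ^ N)).congr_left
      fun t => (mul_pow _ _ _).symm
  refine (h1.trans h2).congr_left fun t => ?_
  simp only [Function.comp_apply, PowerSeries.coeff_rescale, mul_pow]
  congr 1
  exact Finset.sum_congr rfl fun j _ => by ring

lemma hasExpansion_exp : HasExpansion Real.exp (PowerSeries.exp ℝ) := by
  intro N
  have h : (fun t : ℝ => Real.exp t - ∑ i ∈ Finset.range N, t ^ i / i.factorial) =O[𝓝 0]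
      fun t => t ^ N := by
    simpa using Real.exp_sub_sum_range_isBigO_pow N
  refine (h.mono nhdsWithin_le_nhds).congr_left fun t => ?_
  congr 1
  refine Finset.sum_congr rfl fun j _ => ?_
  rw [PowerSeries.coeff_exp]
  simp
  ring

lemma HasExpansion.div_X {f g : ℝ → ℝ} {φ : PowerSeries ℝ} (hf : HasExpansion f (PowerSeries.X * φ))
    (hfg : ∀ t, 0 < t → f t = t * g t) : HasExpansion g φ := by
  intro N
  have h := hf (N + 1)
  have h2 := (isBigO_refl (fun t : ℝ => t⁻¹) (𝓝[>] 0)).mul h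
  refine h2.congr' ?_ ?_
  · filter_upwards [self_mem_nhdsWithin] with t ht
    have ht' : t ≠ 0 := ne_of_gt ht
    rw [hfg t ht, Finset.sum_range_succ', mul_sub, ← mul_assoc, inv_mul_cancel₀ ht', one_mul]
    simp only [PowerSeries.coeff_succ_X_mul, PowerSeries.coeff_zero_X_mul, zero_mul, add_zero]
    congr 1
    rw [Finset.mul_sum]
    refine Finset.sum_congr rfl fun j _ => ?_
    field_simp
    ring
  · filter_upwards [self_mem_nhdsWithin] with t ht
    have ht' : t ≠ 0 := ne_of_gt ht
    field_simp
    ring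

/-- (e^t − 1)/t has an expansion with nonzero constant term whose product with the Bernoulli series
is 1, so the division lemma applies. -/
lemma hasExpansion_bernoulli :
    HasExpansion (fun t => t / (Real.exp t - 1)) (bernoulliPowerSeries ℝ) := by
  set S : PowerSeries ℝ := PowerSeries.mk fun n => ((n + 1).factorial : ℝ)⁻¹
  have hS : PowerSeries.X * S = PowerSeries.exp ℝ - 1 := by
    ext n
    rcases n with _ | n
    · simp
    · rw [PowerSeries.coeff_succ_X_mul, map_sub, PowerSeries.coeff_exp, PowerSeries.coeff_one]
      simp [S]
  have h1 : HasExpansion (fun t => Real.exp t - 1) (PowerSeries.X * S) := by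
    rw [hS]
    have := hasExpansion_exp.sub (hasExpansion_polynomial 1)
    simpa using this
  have h2 : HasExpansion (fun t => (Real.exp t - 1) / t) S :=
    h1.div_X fun t ht => by field_simp
  have h3 : S * bernoulliPowerSeries ℝ = 1 := by
    have := bernoulliPowerSeries_mul_exp_sub_one ℝ
    rw [← hS] at this
    have hX : (PowerSeries.X : PowerSeries ℝ) ≠ 0 := PowerSeries.X_ne_zero
    refine mul_left_cancel₀ hX ?_
    rw [mul_one]
    linear_combination this
  refine h2.of_mul_eq (p := fun _ => 1) ?_ (fun t ht => ?_) (by simp [S])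
  · rw [h3]; simpa using hasExpansion_polynomial 1
  · have : Real.exp t - 1 ≠ 0 := by
      have := Real.add_one_lt_exp ht.ne'
      linarith
    field_simp

/-- The power series of `1 / cosh`. -/
noncomputable def sechSeries : PowerSeries ℝ :=
  PowerSeries.mk fun n => (eulerNumber n : ℝ) / n.factorial

lemma hasExpansion_sech : HasExpansion (fun t => 1 / Real.cosh t) sechSeries := by
  set K : PowerSeries ℚ := PowerSeries.mk fun k => if Even k then ((k.factorial : ℚ))⁻¹ else 0
  set KR : PowerSeries ℝ := PowerSeries.map (algebraMap ℚ ℝ) K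
  have hE : sechSeries = PowerSeries.map (algebraMap ℚ ℝ) K⁻¹ := by
    ext n
    have : (n.factorial : ℝ) ≠ 0 := by exact_mod_cast n.factorial_ne_zero
    simp only [sechSeries, PowerSeries.coeff_mk, PowerSeries.coeff_map, eulerNumber]
    push_cast
    rw [mul_div_cancel_left₀ _ this]
    rfl
  have hmul : KR * sechSeries = 1 := by
    rw [hE, ← map_mul, PowerSeries.mul_inv_cancel, map_one]
    simp [K]
  have hcosh : HasExpansion Real.cosh KR := by
    have h1 := hasExpansion_exp
    have h2 : HasExpansion (fun t => Real.exp (-t))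
        (PowerSeries.rescale (-1) (PowerSeries.exp ℝ)) := by
      refine hasExpansion_exp.of_mul_eq (p := fun _ => 1) ?_ (fun t _ => ?_) (by simp)
      · have := PowerSeries.exp_mul_exp_neg_eq_one (A := ℝ)
        rw [PowerSeries.evalNegHom] at this
        rw [this]; simpa using hasExpansion_polynomial 1
      · rw [← Real.exp_add, add_neg_cancel, Real.exp_zero]
    have h3 := (h1.add h2).const_mul (1 / 2)
    have h4 : (1 / 2 : ℝ) • (PowerSeries.exp ℝ + PowerSeries.rescale (-1) (PowerSeries.exp ℝ)) =
        KR := by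
      ext n
      simp only [KR, K, PowerSeries.coeff_smul, map_add, PowerSeries.coeff_rescale,
        PowerSeries.coeff_exp, PowerSeries.coeff_map, PowerSeries.coeff_mk]
      rcases Nat.even_or_odd n with hn | hn
      · simp [hn, hn.neg_one_pow]; ring
      · simp [Nat.not_even_iff_odd.2 hn, hn.neg_one_pow]
    rw [h4] at h3
    refine h3.congr fun t _ => ?_
    rw [Real.cosh_eq]; ring
  refine hcosh.of_mul_eq (p := fun _ => 1) ?_ (fun t _ => ?_) (by simp [KR, K])
  · rw [hmul]; simpa using hasExpansion_polynomial 1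
  · have := (Real.cosh_pos t).ne'
    field_simp

end Expansion

/-! ### Taylor coefficients of the kernel in Gauss's integral -/

section Digamma

/-- The integrand of Gauss's integral for the digamma function, shifted by `1/4`. -/
noncomputable def gaussKernel (t : ℝ) : ℝ := 1 / t - Real.exp (-t / 4) / (1 - Real.exp (-t))

/-- The Taylor coefficients of `gaussKernel`. -/
noncomputable def gaussCoeff (j : ℕ) : ℝ :=
  (-((2 - 2 ^ (j + 1)) * bernoulli (j + 1) / (j + 1).factorial) - eulerNumber j / j.factorial) /
    4 ^ (j + 1)

lemma one_sub_exp_neg_pos {t : ℝ} (ht : 0 < t) : 0 < 1 - Real.exp (-t) := by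
  have := Real.exp_lt_one_iff.2 (show -t < 0 by linarith)
  linarith

/-- With x = e^(t/4) the exponential term is x³/(x⁴ − 1). Partial fractions split it into multiples
of 1/(x − 1), 1/(x² − 1) and x/(x² + 1): two Bernoulli generating functions and a hyperbolic secant,
which is where the Bernoulli and Euler numbers come from. -/
lemma gaussKernel_eq {t : ℝ} (ht : 0 < t) :
    t * gaussKernel t = 1 - 2 * ((4⁻¹ * t) / (Real.exp (4⁻¹ * t) - 1)) +
      (2⁻¹ * t) / (Real.exp (2⁻¹ * t) - 1) - 4⁻¹ * t * (1 / Real.cosh (4⁻¹ * t)) := by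
  set x := Real.exp (4⁻¹ * t) with hx
  have hx1 : 1 < x := Real.one_lt_exp_iff.2 (by positivity)
  have e2 : Real.exp (2⁻¹ * t) = x ^ 2 := by rw [hx, ← Real.exp_nat_mul]; congr 1; push_cast; ring
  have e4 : Real.exp (-t) = (x ^ 4)⁻¹ := by
    rw [hx, ← Real.exp_nat_mul, ← Real.exp_neg]; congr 1; push_cast; ring
  have e1 : Real.exp (-t / 4) = x⁻¹ := by rw [hx, ← Real.exp_neg]; congr 1; ring
  have ec : Real.cosh (4⁻¹ * t) = (x + x⁻¹) / 2 := by rw [Real.cosh_eq, Real.exp_neg]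
  have h1 : x - 1 ≠ 0 := by linarith
  have h2 : x ^ 2 - 1 ≠ 0 := by nlinarith
  have h4 : x ^ 4 - 1 ≠ 0 := by nlinarith [sq_nonneg (x ^ 2 - 1), sq_nonneg (x ^ 2)]
  have h5 : x ^ 2 + 1 ≠ 0 := by positivity
  have hx0 : x ≠ 0 := by linarith
  rw [gaussKernel, e2, e4, e1, ec]
  have a1 : 1 - (x ^ 4)⁻¹ = (x - 1) * (x + 1) * (x ^ 2 + 1) / x ^ 4 := by field_simp; ring
  have a2 : x ^ 2 - 1 = (x - 1) * (x + 1) := by ring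
  have a3 : (x + x⁻¹) / 2 = (x ^ 2 + 1) / (2 * x) := by field_simp
  have h6 : x + 1 ≠ 0 := by linarith
  rw [a1, a2, a3]
  field_simp
  ring

lemma hasExpansion_gaussKernel : HasExpansion gaussKernel (PowerSeries.mk gaussCoeff) := by
  have h1 : HasExpansion (fun t => t * gaussKernel t)
      (((1 : Polynomial ℝ) : PowerSeries ℝ) -
        (2 : ℝ) • PowerSeries.rescale 4⁻¹ (bernoulliPowerSeries ℝ) +
        PowerSeries.rescale 2⁻¹ (bernoulliPowerSeries ℝ) -
        ((Polynomial.C 4⁻¹ * Polynomial.X : Polynomial ℝ) : PowerSeries ℝ) *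
          PowerSeries.rescale 4⁻¹ sechSeries) := by
    refine HasExpansion.congr ((((hasExpansion_polynomial 1).sub
      ((hasExpansion_bernoulli.comp_mul (c := 4⁻¹) (by norm_num)).const_mul 2)).add
      (hasExpansion_bernoulli.comp_mul (c := 2⁻¹) (by norm_num))).sub
      ((hasExpansion_polynomial (Polynomial.C 4⁻¹ * Polynomial.X)).mul
        (hasExpansion_sech.comp_mul (c := 4⁻¹) (by norm_num)))) fun t ht => ?_
    rw [gaussKernel_eq ht]
    simp
  have h2 : (((1 : Polynomial ℝ) : PowerSeries ℝ) -
        (2 : ℝ) • PowerSeries.rescale 4⁻¹ (bernoulliPowerSeries ℝ) +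
        PowerSeries.rescale 2⁻¹ (bernoulliPowerSeries ℝ) -
        ((Polynomial.C 4⁻¹ * Polynomial.X : Polynomial ℝ) : PowerSeries ℝ) *
          PowerSeries.rescale 4⁻¹ sechSeries) = PowerSeries.X * PowerSeries.mk gaussCoeff := by
    ext n
    have e : ((Polynomial.C 4⁻¹ * Polynomial.X : Polynomial ℝ) : PowerSeries ℝ) *
          PowerSeries.rescale 4⁻¹ sechSeries = PowerSeries.X *
          ((4⁻¹ : ℝ) • PowerSeries.rescale 4⁻¹ sechSeries) := by
      rw [Polynomial.coe_mul, Polynomial.coe_C, Polynomial.coe_X, PowerSeries.smul_eq_C_mul]; ring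
    rw [e]
    rcases n with _ | n
    · simp only [map_sub, map_add, PowerSeries.coeff_smul, PowerSeries.coeff_rescale,
        bernoulliPowerSeries, PowerSeries.coeff_mk, PowerSeries.coeff_zero_X_mul,
        Polynomial.coe_one]
      simp
      norm_num
    · simp only [map_sub, map_add, PowerSeries.coeff_succ_X_mul, PowerSeries.coeff_smul,
        PowerSeries.coeff_rescale, bernoulliPowerSeries, PowerSeries.coeff_mk, sechSeries,
        gaussCoeff, Polynomial.coe_one, PowerSeries.coeff_one]
      simp only [Nat.succ_ne_zero, if_false, smul_eq_mul]
      have h24 : (2⁻¹ : ℝ) ^ (n + 1) = 2 ^ (n + 1) * 4⁻¹ ^ (n + 1) := by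
        rw [← mul_pow]; norm_num
      rw [h24]
      simp only [inv_pow, eq_ratCast, Rat.cast_div, Rat.cast_natCast]
      rw [pow_succ (4 : ℝ) n]
      field_simp
      ring
  rw [h2] at h1
  exact h1.div_X fun t _ => rfl

end Digamma

/-! ### Gauss's integral and the expansion of the digamma function -/

section Digamma

open MeasureTheory

lemma integrableOn_pow_mul_exp_neg_mul (n : ℕ) {u : ℝ} (hu : 0 < u) :
    IntegrableOn (fun t : ℝ => t ^ n * Real.exp (-(u * t))) (Set.Ioi 0) := by
  have h := integrableOn_rpow_mul_exp_neg_mul_rpow (p := 1) (s := n) (b := u)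
    (by linarith [(Nat.cast_nonneg n : (0 : ℝ) ≤ n)]) one_pos hu
  refine h.congr_fun (fun t _ => ?_) measurableSet_Ioi
  simp only [Real.rpow_natCast, Real.rpow_one, neg_mul]

lemma integral_pow_mul_exp_neg_mul (n : ℕ) {u : ℝ} (hu : 0 < u) :
    ∫ t in Set.Ioi (0 : ℝ), t ^ n * Real.exp (-(u * t)) = n.factorial / u ^ (n + 1) := by
  have h := Real.integral_rpow_mul_exp_neg_mul_Ioi (a := n + 1) (r := u) (by positivity) hu
  rw [Real.Gamma_nat_eq_factorial] at h
  have e : ∀ t : ℝ, t ^ ((n : ℝ) + 1 - 1) = t ^ n := fun t => by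
    rw [add_sub_cancel_right, Real.rpow_natCast]
  simp only [e] at h
  rw [h]
  have : (1 / u) ^ ((n : ℝ) + 1) = (1 / u) ^ (n + 1) := by
    rw [← Real.rpow_natCast]; push_cast; rfl
  rw [this, div_pow, one_pow]
  ring

/-- **Watson's lemma**, for a kernel with a globally bounded Taylor remainder. -/
lemma abs_laplace_sub_sum_le {k : ℝ → ℝ} {c : ℕ → ℝ} {N : ℕ} {C u : ℝ} (hu : 0 < u)
    (hk : IntegrableOn (fun t => Real.exp (-(u * t)) * k t) (Set.Ioi 0))
    (h : ∀ t, 0 < t → |k t - ∑ j ∈ Finset.range N, c j * t ^ j| ≤ C * t ^ N) :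
    |(∫ t in Set.Ioi (0 : ℝ), Real.exp (-(u * t)) * k t) -
      ∑ j ∈ Finset.range N, c j * (j.factorial / u ^ (j + 1))| ≤
        C * (N.factorial / u ^ (N + 1)) := by
  have h1 : ∑ j ∈ Finset.range N, c j * (j.factorial / u ^ (j + 1)) =
      ∫ t in Set.Ioi (0 : ℝ), ∑ j ∈ Finset.range N, c j * (t ^ j * Real.exp (-(u * t))) := by
    rw [integral_finsetSum _ fun j _ => (integrableOn_pow_mul_exp_neg_mul j hu).const_mul (c j)]
    refine Finset.sum_congr rfl fun j _ => ?_
    rw [integral_const_mul, integral_pow_mul_exp_neg_mul j hu]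
  have h2 : IntegrableOn (fun t => ∑ j ∈ Finset.range N, c j * (t ^ j * Real.exp (-(u * t))))
      (Set.Ioi 0) :=
    integrable_finsetSum _ fun j _ => (integrableOn_pow_mul_exp_neg_mul j hu).const_mul (c j)
  rw [h1, ← integral_sub hk h2, ← Real.norm_eq_abs, ← integral_pow_mul_exp_neg_mul N hu,
    ← integral_const_mul]
  refine norm_integral_le_of_norm_le ((integrableOn_pow_mul_exp_neg_mul N hu).const_mul C) ?_
  filter_upwards [ae_restrict_mem measurableSet_Ioi] with t ht
  have e : Real.exp (-(u * t)) * k t - ∑ j ∈ Finset.range N, c j * (t ^ j * Real.exp (-(u * t))) =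
      (k t - ∑ j ∈ Finset.range N, c j * t ^ j) * Real.exp (-(u * t)) := by
    rw [sub_mul, Finset.sum_mul, mul_comm]
    congr 1
    exact Finset.sum_congr rfl fun j _ => by ring
  rw [e, norm_mul, Real.norm_of_nonneg (Real.exp_pos _).le, ← mul_assoc]
  exact mul_le_mul_of_nonneg_right (h t ht) (Real.exp_pos _).le

/-- Away from 0 the kernel is bounded and every t^j with j < N is dominated by a multiple of t^N, so
the local remainder estimate becomes global and Watson's lemma needs no splitting of the integral.
-/
lemma abs_gaussKernel_sub_sum_le (N : ℕ) : ∃ C : ℝ, 0 ≤ C ∧ ∀ t, 0 < t →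
    |gaussKernel t - ∑ j ∈ Finset.range N, gaussCoeff j * t ^ j| ≤ C * t ^ N := by
  have h := hasExpansion_gaussKernel N
  simp only [PowerSeries.coeff_mk] at h
  obtain ⟨C₀, hC₀, hb⟩ := h.exists_pos
  rw [Asymptotics.IsBigOWith, eventually_nhdsWithin_iff, Metric.eventually_nhds_iff] at hb
  obtain ⟨δ, hδ, hb⟩ := hb
  set K : ℝ := 1 / δ + 1 / (1 - Real.exp (-δ))
  have hK : 0 < 1 - Real.exp (-δ) := one_sub_exp_neg_pos hδ
  set C₁ : ℝ := (K + ∑ j ∈ Finset.range N, |gaussCoeff j| * δ ^ j) / δ ^ N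
  have hC₁ : 0 ≤ C₁ := by positivity
  refine ⟨C₀ + C₁, by positivity, fun t ht => ?_⟩
  rcases lt_or_ge t δ with hlt | hge
  · have := hb (y := t) (by rw [Real.dist_eq, sub_zero, abs_of_pos ht]; exact hlt) ht
    rw [Real.norm_eq_abs, Real.norm_of_nonneg (by positivity)] at this
    refine this.trans ?_
    gcongr
    linarith
  · have h1 : |gaussKernel t| ≤ K := by
      rw [gaussKernel]
      refine (abs_sub _ _).trans ?_
      have ha : |1 / t| ≤ 1 / δ := by
        rw [abs_of_pos (by positivity)]; gcongr
      have hb' : |Real.exp (-t / 4) / (1 - Real.exp (-t))| ≤ 1 / (1 - Real.exp (-δ)) := by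
        rw [abs_of_pos (div_pos (Real.exp_pos _) (one_sub_exp_neg_pos ht))]
        gcongr
        rw [Real.exp_le_one_iff]; linarith
      exact add_le_add ha hb'
    have htd : 1 ≤ (t / δ) ^ N := one_le_pow₀ ((one_le_div hδ).2 hge)
    have h2 : ∀ j ∈ Finset.range N, |gaussCoeff j * t ^ j| ≤
        |gaussCoeff j| * δ ^ j * (t / δ) ^ N := by
      intro j hj
      rw [abs_mul, abs_of_nonneg (by positivity : 0 ≤ t ^ j), mul_assoc]
      refine mul_le_mul_of_nonneg_left ?_ (abs_nonneg _)
      calc t ^ j = δ ^ j * (t / δ) ^ j := by rw [← mul_pow, mul_div_cancel₀ _ hδ.ne']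
        _ ≤ δ ^ j * (t / δ) ^ N := by
          gcongr
          · exact (one_le_div hδ).2 hge
          · exact (Finset.mem_range.1 hj).le
    calc _ ≤ |gaussKernel t| + |∑ j ∈ Finset.range N, gaussCoeff j * t ^ j| := abs_sub _ _
      _ ≤ K * (t / δ) ^ N + ∑ j ∈ Finset.range N, |gaussCoeff j| * δ ^ j * (t / δ) ^ N := by
        refine add_le_add ?_ ((Finset.abs_sum_le_sum_abs _ _).trans (Finset.sum_le_sum h2))
        have hK' : 0 ≤ K := by positivity
        nlinarith
      _ = C₁ * t ^ N := by rw [← Finset.sum_mul, ← add_mul, div_pow]; ring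
      _ ≤ _ := by gcongr; linarith

lemma integrableOn_exp_mul_gaussKernel {u : ℝ} (hu : 0 < u) :
    IntegrableOn (fun t => Real.exp (-(u * t)) * gaussKernel t) (Set.Ioi 0) := by
  obtain ⟨C, hC, hb⟩ := abs_gaussKernel_sub_sum_le 0
  refine Integrable.mono' ((integrableOn_pow_mul_exp_neg_mul 0 hu).const_mul C) ?_ ?_
  · refine Measurable.aestronglyMeasurable ?_
    unfold gaussKernel
    fun_prop
  · filter_upwards [ae_restrict_mem measurableSet_Ioi] with t ht
    have := hb t ht
    simp only [Finset.range_zero, Finset.sum_empty, sub_zero, pow_zero, mul_one] at this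
    rw [norm_mul, Real.norm_of_nonneg (Real.exp_pos _).le, pow_zero, one_mul, mul_comm,
      Real.norm_eq_abs]
    gcongr

/-- The real digamma function. -/
noncomputable def psi (x : ℝ) : ℝ := logDeriv Real.Gamma x

lemma hasDerivAt_log_Gamma {x : ℝ} (hx : 0 < x) :
    HasDerivAt (Real.log ∘ Real.Gamma) (psi x) x := by
  have hd : DifferentiableAt ℝ Real.Gamma x :=
    Real.differentiableAt_Gamma fun m => by
      have : (0 : ℝ) ≤ m := Nat.cast_nonneg m
      linarith
  exact (hd.hasDerivAt.log (Real.Gamma_pos_of_pos hx).ne')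

lemma log_Gamma_add_one {x : ℝ} (hx : 0 < x) :
    Real.log (Real.Gamma (x + 1)) = Real.log x + Real.log (Real.Gamma x) := by
  rw [Real.Gamma_add_one hx.ne', Real.log_mul hx.ne' (Real.Gamma_pos_of_pos hx).ne']

lemma psi_add_one {x : ℝ} (hx : 0 < x) : psi (x + 1) = psi x + 1 / x := by
  have h1 : HasDerivAt (fun y => (Real.log ∘ Real.Gamma) (y + 1)) (psi (x + 1)) x :=
    (hasDerivAt_log_Gamma (show 0 < x + 1 by linarith)).comp_add_const x 1
  have h2 : HasDerivAt (fun y => Real.log y + (Real.log ∘ Real.Gamma) y) (x⁻¹ + psi x) x :=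
    (Real.hasDerivAt_log hx.ne').add (hasDerivAt_log_Gamma hx)
  have h3 := h2.congr_of_eventuallyEq (f₁ := fun y => (Real.log ∘ Real.Gamma) (y + 1)) (by
    filter_upwards [Ioi_mem_nhds hx] with y hy
    exact log_Gamma_add_one hy)
  rw [h1.unique h3, one_div]; ring

/-- Convexity of log Γ: its slope over [x, x + 1] is log x, which lies between ψ(x) and ψ(x + 1). -/
lemma psi_le_log {x : ℝ} (hx : 0 < x) : psi x ≤ Real.log x := by
  have h := Real.convexOn_log_Gamma.le_slope_of_hasDerivAt (x := x) (y := x + 1) hx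
    (by simp; linarith) (by linarith) (hasDerivAt_log_Gamma hx)
  rw [slope_def_field, Function.comp_apply, Function.comp_apply, log_Gamma_add_one hx] at h
  simpa using h

lemma log_sub_le_psi {x : ℝ} (hx : 0 < x) : Real.log x - 1 / x ≤ psi x := by
  have h := Real.convexOn_log_Gamma.slope_le_of_hasDerivAt (x := x) (y := x + 1) hx
    (by simp; linarith) (by linarith) (hasDerivAt_log_Gamma (by linarith))
  rw [slope_def_field, Function.comp_apply, Function.comp_apply, log_Gamma_add_one hx,
    psi_add_one hx] at h
  simp at h ⊢
  linarith

lemma tendsto_psi_sub_log : Tendsto (fun x => psi x - Real.log x) atTop (𝓝 0) := by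
  have h1 : Tendsto (fun x : ℝ => -(1 / x)) atTop (𝓝 0) := by
    simpa using (tendsto_inv_atTop_zero (𝕜 := ℝ)).neg
  refine tendsto_of_tendsto_of_tendsto_of_le_of_le' h1 tendsto_const_nhds ?_ ?_
  · filter_upwards [eventually_gt_atTop 0] with x hx
    linarith [log_sub_le_psi hx]
  · filter_upwards [eventually_gt_atTop 0] with x hx
    linarith [psi_le_log hx]

lemma integral_frullani_exp {u : ℝ} (hu : 0 < u)
    (hint : IntegrableOn (fun t => t⁻¹ * (Real.exp (-(u * t)) - Real.exp (-((u + 1) * t))))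
      (Set.Ioi 0)) :
    ∫ t in Set.Ioi (0 : ℝ), t⁻¹ * (Real.exp (-(u * t)) - Real.exp (-((u + 1) * t))) =
      Real.log ((u + 1) / u) := by
  have hc : Continuous fun t : ℝ => Real.exp (-t) := by fun_prop
  have h := Frullani.integral_Ioi_eq (f := fun t : ℝ => Real.exp (-t)) (a := u) (b := u + 1)
    (L := 1) (R := 0) (hc.locallyIntegrable.locallyIntegrableOn _) hu (by linarith) ?_ ?_ hint
  · simpa using h
  · have := hc.tendsto 0
    rw [neg_zero, Real.exp_zero] at this
    exact this.mono_left nhdsWithin_le_nhds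
  · exact Real.tendsto_exp_neg_atTop_nhds_zero

/-- The Laplace transform of `gaussKernel`. -/
noncomputable def gaussIntegral (u : ℝ) : ℝ :=
  ∫ t in Set.Ioi (0 : ℝ), Real.exp (-(u * t)) * gaussKernel t

/-- The difference of the two integrands carries the factor 1 − e^(-t), which cancels the
denominator of the kernel and leaves a Frullani integral and a pure exponential. So the transform
obeys the same difference equation as ψ(u + 1/4) − log u. -/
lemma gaussIntegral_add_one {u : ℝ} (hu : 0 < u) :
    gaussIntegral (u + 1) = gaussIntegral u - Real.log ((u + 1) / u) + 1 / (u + 1 / 4) := by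
  have i1 := integrableOn_exp_mul_gaussKernel hu
  have i2 := integrableOn_exp_mul_gaussKernel (show 0 < u + 1 by linarith)
  have i3 := integrableOn_pow_mul_exp_neg_mul 0 (show 0 < u + 1 / 4 by linarith)
  simp only [pow_zero, one_mul] at i3
  have e : ∀ t ∈ Set.Ioi (0 : ℝ),
      t⁻¹ * (Real.exp (-(u * t)) - Real.exp (-((u + 1) * t))) =
      Real.exp (-(u * t)) * gaussKernel t - Real.exp (-((u + 1) * t)) * gaussKernel t +
        Real.exp (-((u + 1 / 4) * t)) := by
    intro t ht
    have h1 : Real.exp (-((u + 1) * t)) = Real.exp (-(u * t)) * Real.exp (-t) := by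
      rw [← Real.exp_add]; congr 1; ring
    have h2 : Real.exp (-((u + 1 / 4) * t)) = Real.exp (-(u * t)) * Real.exp (-t / 4) := by
      rw [← Real.exp_add]; congr 1; ring
    have h3 := (one_sub_exp_neg_pos ht).ne'
    rw [h1, h2, gaussKernel]
    have ht' : t ≠ 0 := ne_of_gt ht
    field_simp
    ring
  have i4 : IntegrableOn (fun t => t⁻¹ * (Real.exp (-(u * t)) - Real.exp (-((u + 1) * t))))
      (Set.Ioi 0) := by
    refine IntegrableOn.congr_fun ((i1.sub i2).add i3) (fun t ht => ?_) measurableSet_Ioi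
    rw [e t ht]; rfl
  have i12 : IntegrableOn (fun t => Real.exp (-(u * t)) * gaussKernel t -
      Real.exp (-((u + 1) * t)) * gaussKernel t) (Set.Ioi 0) := i1.sub i2
  have h := integral_frullani_exp hu i4
  rw [setIntegral_congr_fun measurableSet_Ioi e, integral_add i12 i3,
    integral_sub i1 i2] at h
  have h3 := integral_pow_mul_exp_neg_mul 0 (show 0 < u + 1 / 4 by linarith)
  simp only [pow_zero, one_mul, Nat.factorial_zero, Nat.cast_one, zero_add, pow_one] at h3
  rw [h3] at h
  rw [gaussIntegral, gaussIntegral]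
  linarith

lemma abs_gaussIntegral_sub_sum_le (N : ℕ) : ∃ C : ℝ, 0 ≤ C ∧ ∀ u, 0 < u →
    |gaussIntegral u - ∑ j ∈ Finset.range N, gaussCoeff j * (j.factorial / u ^ (j + 1))| ≤
      C / u ^ (N + 1) := by
  obtain ⟨C, hC, hb⟩ := abs_gaussKernel_sub_sum_le N
  refine ⟨C * N.factorial, by positivity, fun u hu => ?_⟩
  refine (abs_laplace_sub_sum_le hu (integrableOn_exp_mul_gaussKernel hu) hb).trans
    (le_of_eq (by ring))

/-- Gauss's integral for the digamma function, shifted by `1/4`. -/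
lemma psi_add_quarter {u : ℝ} (hu : 0 < u) :
    psi (u + 1 / 4) = Real.log u + gaussIntegral u := by
  -- The defect Δ has period 1 and tends to 0 at infinity, hence is zero.
  set Δ : ℝ → ℝ := fun u => psi (u + 1 / 4) - Real.log u - gaussIntegral u with hΔ
  have hper : ∀ v, 0 < v → Δ (v + 1) = Δ v := by
    intro v hv
    have h1 := gaussIntegral_add_one hv
    have h2 := psi_add_one (show 0 < v + 1 / 4 by linarith)
    rw [Real.log_div (by linarith) hv.ne'] at h1
    simp only [hΔ]
    rw [h1, show v + 1 + 1 / 4 = v + 1 / 4 + 1 by ring, h2]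
    ring
  have hper' : ∀ n : ℕ, Δ (u + n) = Δ u := by
    intro n
    induction n with
    | zero => simp
    | succ n ih =>
      rw [Nat.cast_succ, ← add_assoc, hper _ (by positivity), ih]
  have hlim : Tendsto Δ atTop (𝓝 0) := by
    have h1 : Tendsto (fun u : ℝ => u + 1 / 4) atTop atTop :=
      tendsto_atTop_add_const_right _ _ tendsto_id
    have h2 := tendsto_psi_sub_log.comp h1
    have h3 : Tendsto (fun u : ℝ => Real.log (u + 1 / 4) - Real.log u) atTop (𝓝 0) := by
      have := Real.tendsto_log_comp_add_sub_log (1 / 4)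
      simpa using this
    have h4 : Tendsto gaussIntegral atTop (𝓝 0) := by
      obtain ⟨C, hC, hb⟩ := abs_gaussIntegral_sub_sum_le 0
      have h5 : Tendsto (fun u : ℝ => C / u ^ (0 + 1)) atTop (𝓝 0) := by
        simpa using tendsto_const_nhds.div_atTop (tendsto_id (α := ℝ) (x := atTop))
      refine squeeze_zero_norm' ?_ h5
      filter_upwards [eventually_gt_atTop 0] with v hv
      simpa using hb v hv
    have := (h2.add h3).sub h4
    simp only [add_zero, sub_zero] at this
    refine this.congr fun v => ?_
    simp only [hΔ, Function.comp_apply]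
    ring
  have h5 : Tendsto (fun n : ℕ => Δ (u + n)) atTop (𝓝 0) :=
    hlim.comp (tendsto_atTop_add_const_left _ _ tendsto_natCast_atTop_atTop)
  simp only [hper'] at h5
  have h6 : Δ u = 0 := tendsto_nhds_unique tendsto_const_nhds h5
  simp only [hΔ] at h6
  linarith

lemma abs_psi_sub_le (N : ℕ) : ∃ C : ℝ, 0 ≤ C ∧ ∀ u, 0 < u →
    |psi (u + 1 / 4) - Real.log u -
      ∑ j ∈ Finset.range N, gaussCoeff j * (j.factorial / u ^ (j + 1))| ≤ C / u ^ (N + 1) := by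
  obtain ⟨C, hC, hb⟩ := abs_gaussIntegral_sub_sum_le N
  refine ⟨C, hC, fun u hu => ?_⟩
  rw [psi_add_quarter hu, add_sub_cancel_left]
  exact hb u hu

lemma logDeriv_Gamma_ofReal {x : ℝ} (hx : 0 < x) : logDeriv Complex.Gamma x = psi x := by
  have hd : DifferentiableAt ℂ Complex.Gamma x := by
    refine Complex.differentiableAt_Gamma _ fun m hm => ?_
    have : x = -(m : ℝ) := by exact_mod_cast hm
    linarith [(Nat.cast_nonneg m : (0 : ℝ) ≤ m)]
  have h1 := hd.hasDerivAt.comp_ofReal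
  have hd' : DifferentiableAt ℝ Real.Gamma x :=
    Real.differentiableAt_Gamma fun m => by
      have : (0 : ℝ) ≤ m := Nat.cast_nonneg m
      linarith
  have h2 := hd'.hasDerivAt.ofReal_comp
  simp only [Complex.Gamma_ofReal] at h1
  rw [psi, logDeriv_apply, logDeriv_apply, Complex.Gamma_ofReal, h1.unique h2]
  push_cast; rfl

end Digamma

/-! ### The resolvent sum at infinity -/

section Asymptotics

/-- The von Mangoldt series starts at n = 2, so it is O(2^(-y)) by comparison with its value at 3/2,
and is invisible to an expansion in powers of 1/y. -/
lemma exists_norm_logDeriv_riemannZeta_le (N : ℕ) : ∃ C : ℝ, 0 ≤ C ∧ ∀ y : ℝ, 1 ≤ y →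
    ‖logDeriv riemannZeta (1 / 2 + y)‖ ≤ C / y ^ N := by
  have hs0 : 1 < ((3 / 2 : ℝ) : ℂ).re := by norm_num
  have hsum := (ArithmeticFunction.LSeriesSummable_vonMangoldt hs0).norm
  set K : ℝ := ∑' n, ‖LSeries.term (fun n => (ArithmeticFunction.vonMangoldt n : ℂ))
    ((3 / 2 : ℝ) : ℂ) n‖
  have hK : 0 ≤ K := tsum_nonneg fun _ => norm_nonneg _
  have hl := Real.log_pos one_lt_two
  refine ⟨K * 2 * (N.factorial / Real.log 2 ^ N), by positivity, fun y hy => ?_⟩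
  have hs : 1 < (1 / 2 + y : ℂ).re := by
    have : (1 / 2 + y : ℂ).re = 1 / 2 + y := by simp
    rw [this]; linarith
  have hre : (1 / 2 + y : ℂ).re = 3 / 2 + (y - 1) := by simp; ring
  have h1 := ArithmeticFunction.LSeries_vonMangoldt_eq_deriv_riemannZeta_div hs
  have h2 : ‖logDeriv riemannZeta (1 / 2 + y)‖ =
      ‖LSeries (fun n => (ArithmeticFunction.vonMangoldt n : ℂ)) (1 / 2 + y)‖ := by
    rw [h1, logDeriv_apply, neg_div, norm_neg]
  rw [h2, LSeries]
  have h3 : ‖∑' n, LSeries.term (fun n => (ArithmeticFunction.vonMangoldt n : ℂ)) (1 / 2 + y) n‖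
      ≤ K * (2 : ℝ) ^ (-(y - 1)) := by
    refine tsum_of_norm_bounded (hsum.hasSum.mul_right _) fun n => ?_
    rw [LSeries.norm_term_eq, LSeries.norm_term_eq]
    rcases eq_or_ne n 0 with rfl | hn
    · simp
    rw [if_neg hn, if_neg hn, ofReal_re, hre]
    rcases eq_or_ne n 1 with rfl | hn1
    · simp
    have hn2 : (2 : ℝ) ≤ n := by exact_mod_cast (by omega : 2 ≤ n)
    rw [Real.rpow_add (by linarith), Real.rpow_neg (by norm_num), ← div_eq_mul_inv, div_div]
    gcongr
  refine h3.trans ?_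
  have h4 := Real.pow_div_factorial_le_exp (y * Real.log 2) (by positivity) N
  have h5 : Real.exp (y * Real.log 2) = 2 ^ y := by
    rw [Real.rpow_def_of_pos two_pos, mul_comm]
  rw [h5] at h4
  have h6 : (2 : ℝ) ^ (-(y - 1)) = 2 / 2 ^ y := by
    rw [neg_sub, Real.rpow_sub two_pos, Real.rpow_one]
  have h7 : (1 : ℝ) / 2 ^ y ≤ N.factorial / (y * Real.log 2) ^ N := by
    rw [div_le_div_iff₀ (by positivity) (by positivity), one_mul]
    rw [div_le_iff₀ (by positivity)] at h4
    linarith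
  rw [h6]
  calc K * (2 / 2 ^ y) = K * 2 * (1 / 2 ^ y) := by ring
    _ ≤ K * 2 * (N.factorial / (y * Real.log 2) ^ N) := by gcongr
    _ = _ := by rw [mul_pow]; field_simp

lemma logDeriv_Gammaℝ {s : ℂ} (hs : 0 < s.re) :
    DifferentiableAt ℂ Gammaℝ s ∧
      logDeriv Gammaℝ s = -(Real.log Real.pi) / 2 + logDeriv Gamma (s / 2) / 2 := by
  have hpi : (Real.pi : ℂ) ≠ 0 := by exact_mod_cast Real.pi_ne_zero
  have hm : ∀ m : ℕ, s / 2 ≠ -m := by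
    intro m h
    have h' : 0 < (s / 2).re := by simpa using hs
    rw [h] at h'
    simp at h'
    linarith [(Nat.cast_nonneg m : (0 : ℝ) ≤ m)]
  have hG : DifferentiableAt ℂ Gamma (s / 2) := differentiableAt_Gamma _ hm
  have h1 : HasDerivAt (fun z : ℂ => z / 2) (1 / 2) s := (hasDerivAt_id s).div_const 2
  have h2 : HasDerivAt (fun z : ℂ => Gamma (z / 2)) (deriv Gamma (s / 2) * (1 / 2)) s :=
    HasDerivAt.comp s hG.hasDerivAt h1
  have h3 : HasDerivAt (fun z : ℂ => -z / 2) (-1 / 2) s := (hasDerivAt_neg s).div_const 2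
  have h4 := h3.const_cpow (c := (Real.pi : ℂ)) (Or.inl hpi)
  have h5 : HasDerivAt Gammaℝ _ s := h4.mul h2
  refine ⟨h5.differentiableAt, ?_⟩
  rw [logDeriv_apply, h5.deriv, logDeriv_apply, Gammaℝ_def]
  have h6 : (Real.pi : ℂ) ^ (-s / 2) ≠ 0 := by
    rw [cpow_def_of_ne_zero hpi]; exact exp_ne_zero _
  have h7 := Gamma_ne_zero hm
  rw [← ofReal_log Real.pi_pos.le]
  field_simp

lemma logDeriv_xiEven_eq {y : ℝ} (hy : 1 / 2 < y) :
    logDeriv xiEven y = ((1 / (y + 1 / 2) + 1 / (y - 1 / 2) - Real.log Real.pi / 2 +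
      psi (y / 2 + 1 / 4) / 2 : ℝ) : ℂ) + logDeriv riemannZeta (1 / 2 + y) := by
  set s : ℂ := 1 / 2 + y with hs
  have hre : s.re = 1 / 2 + y := by simp [hs]
  have hre1 : 1 < s.re := by rw [hre]; linarith
  have hs1 : s ≠ 1 := by rintro h; rw [h] at hre1; simp at hre1
  have hs0 : s ≠ 0 := by rintro h; rw [h] at hre1; norm_num at hre1
  have e1 : logDeriv xiEven y = logDeriv riemannXi s := by
    have : xiEven = riemannXi ∘ fun z => 1 / 2 + z := rfl
    rw [this, logDeriv_comp (differentiable_riemannXi _) (by fun_prop)]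
    simp [hs]
  have hev : riemannXi =ᶠ[𝓝 s] fun z => z * (z - 1) * Gammaℝ z * riemannZeta z := by
    have o1 : ∀ᶠ z : ℂ in 𝓝 s, 0 < z.re :=
      (isOpen_lt continuous_const continuous_re).mem_nhds (show 0 < s.re by linarith)
    filter_upwards [o1, isOpen_ne.mem_nhds hs1] with z hz hz1
    exact riemannXi_eq_zeta hz hz1
  obtain ⟨hGd, hG⟩ := logDeriv_Gammaℝ (s := s) (by linarith)
  have hG0 := Gammaℝ_ne_zero_of_re_pos (s := s) (by linarith)
  have hz0 := riemannZeta_ne_zero_of_one_le_re hre1.le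
  have hs1' := sub_ne_zero.2 hs1
  rw [e1, (logDeriv_congr_nhds hev).self_of_nhds,
    logDeriv_mul (f := fun z => z * (z - 1) * Gammaℝ z) (g := riemannZeta) s
      (mul_ne_zero (mul_ne_zero hs0 hs1') hG0) hz0 (by fun_prop) (differentiableAt_riemannZeta hs1),
    logDeriv_mul (f := fun z => z * (z - 1)) (g := Gammaℝ) s
      (mul_ne_zero hs0 hs1') hG0 (by fun_prop) hGd,
    logDeriv_mul (f := fun z => z) (g := fun z => z - 1) s hs0 hs1' (by fun_prop) (by fun_prop),
    hG]
  congr 1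
  have e2 : s / 2 = ((y / 2 + 1 / 4 : ℝ) : ℂ) := by rw [hs]; push_cast; ring
  rw [e2, logDeriv_Gamma_ofReal (by linarith), logDeriv_apply, logDeriv_apply]
  have e3 : deriv (fun z : ℂ => z) s = 1 := deriv_id s
  have e4 : deriv (fun z : ℂ => z - 1) s = 1 := by rw [deriv_sub_const, deriv_id'']
  rw [e3, e4, hs]
  push_cast
  rw [show (1 / 2 + y - 1 : ℂ) = y - 1 / 2 by ring, add_comm (1 / 2 : ℂ) y]
  ring

/-- The coefficient of `y ^ (-(j + 1))` in the expansion of `xiEven' / xiEven`. -/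
noncomputable def xiCoeff (j : ℕ) : ℝ :=
  (-(1 / 2)) ^ j + (1 / 2) ^ j + gaussCoeff j * j.factorial * 2 ^ j

lemma abs_one_div_sub_le {a y : ℝ} (ha : |a| = 1 / 2) (hy : 1 ≤ y) (N : ℕ) :
    |1 / (y - a) - ∑ j ∈ Finset.range N, a ^ j / y ^ (j + 1)| ≤ 2 / y ^ (N + 1) := by
  have hy0 : 0 < y := by linarith
  have hay : a ≤ 1 / 2 := ha ▸ le_abs_self a
  have h1 : y / 2 ≤ y - a := by linarith
  have h2 : 0 < y - a := by linarith
  have h3 : ∑ j ∈ Finset.range N, a ^ j / y ^ (j + 1) = 1 / (y - a) - (a / y) ^ N / (y - a) := by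
    have hne : a / y ≠ 1 := by
      intro h; rw [div_eq_one_iff_eq hy0.ne'] at h; linarith
    have h4 := geom_sum_eq hne N
    have h5 : ∑ j ∈ Finset.range N, a ^ j / y ^ (j + 1) =
        (∑ j ∈ Finset.range N, (a / y) ^ j) / y := by
      rw [Finset.sum_div]
      refine Finset.sum_congr rfl fun j _ => ?_
      rw [div_pow, pow_succ]; field_simp
    have h6 : a / y - 1 ≠ 0 := sub_ne_zero.2 hne
    rw [h5, h4]
    have h7 : a / y - 1 = -(y - a) / y := by field_simp; ring
    rw [h7]
    field_simp
    ring
  rw [h3, sub_sub_cancel, abs_div, abs_pow, abs_div, ha, abs_of_pos hy0, abs_of_pos h2,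
    div_pow, div_div, div_le_div_iff₀ (by positivity) (by positivity)]
  have h8 : (1 / 2 : ℝ) ^ N ≤ 1 := pow_le_one₀ (by norm_num) (by norm_num)
  have h9 : (0 : ℝ) < y ^ N := by positivity
  calc (1 / 2 : ℝ) ^ N * y ^ (N + 1) ≤ 1 * y ^ (N + 1) := by gcongr
    _ = 2 * (y ^ N * (y / 2)) := by ring
    _ ≤ 2 * (y ^ N * (y - a)) := by gcongr

/-- The factors s and s − 1 contribute two geometric series, the Gamma factor contributes the
digamma expansion at u = y/2, and ζ'/ζ contributes only to the error. -/
lemma norm_logDeriv_xiEven_sub_le (N : ℕ) : ∃ C : ℝ, 0 ≤ C ∧ ∀ y : ℝ, 1 ≤ y →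
    ‖logDeriv xiEven y - ((Real.log (y / 2) / 2 - Real.log Real.pi / 2 +
      ∑ j ∈ Finset.range N, xiCoeff j / y ^ (j + 1) : ℝ) : ℂ)‖ ≤ C / y ^ (N + 1) := by
  obtain ⟨C₁, hC₁, hb₁⟩ := exists_norm_logDeriv_riemannZeta_le (N + 1)
  obtain ⟨C₂, hC₂, hb₂⟩ := abs_psi_sub_le N
  refine ⟨2 + 2 + C₂ * 2 ^ (N + 1) / 2 + C₁, by positivity, fun y hy => ?_⟩
  have hy0 : 0 < y := by linarith
  rw [logDeriv_xiEven_eq (by linarith)]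
  have k1 := abs_one_div_sub_le (a := -(1 / 2)) (by norm_num) hy N
  have k2 := abs_one_div_sub_le (a := 1 / 2) (by norm_num) hy N
  have k3 := hb₂ (y / 2) (by linarith)
  have k4 := hb₁ y hy
  rw [sub_neg_eq_add] at k1
  have e : ∑ j ∈ Finset.range N, xiCoeff j / y ^ (j + 1) =
      (∑ j ∈ Finset.range N, (-(1 / 2)) ^ j / y ^ (j + 1)) +
      (∑ j ∈ Finset.range N, (1 / 2) ^ j / y ^ (j + 1)) +
      (∑ j ∈ Finset.range N, gaussCoeff j * (j.factorial / (y / 2) ^ (j + 1))) / 2 := by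
    rw [Finset.sum_div, ← Finset.sum_add_distrib, ← Finset.sum_add_distrib]
    refine Finset.sum_congr rfl fun j _ => ?_
    rw [xiCoeff, add_div, add_div, div_pow y, pow_succ (2 : ℝ) j]
    congr 1
    field_simp
  rw [e]
  set S₁ := ∑ j ∈ Finset.range N, (-(1 / 2) : ℝ) ^ j / y ^ (j + 1)
  set S₂ := ∑ j ∈ Finset.range N, (1 / 2 : ℝ) ^ j / y ^ (j + 1)
  set S₃ := ∑ j ∈ Finset.range N, gaussCoeff j * (j.factorial / (y / 2) ^ (j + 1))
  set r : ℝ := (1 / (y + 1 / 2) - S₁) + (1 / (y - 1 / 2) - S₂) +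
    (psi (y / 2 + 1 / 4) - Real.log (y / 2) - S₃) / 2
  have e2 : ((1 / (y + 1 / 2) + 1 / (y - 1 / 2) - Real.log Real.pi / 2 +
      psi (y / 2 + 1 / 4) / 2 : ℝ) : ℂ) + logDeriv riemannZeta (1 / 2 + y) -
      ((Real.log (y / 2) / 2 - Real.log Real.pi / 2 + (S₁ + S₂ + S₃ / 2) : ℝ) : ℂ) =
      (r : ℂ) + logDeriv riemannZeta (1 / 2 + y) := by
    simp only [r]; push_cast; ring
  rw [e2]
  refine (norm_add_le _ _).trans ?_
  rw [norm_real, Real.norm_eq_abs]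
  have k5 : |r| ≤ 2 / y ^ (N + 1) + 2 / y ^ (N + 1) + C₂ / (y / 2) ^ (N + 1) / 2 := by
    refine (abs_add_le _ _).trans (add_le_add ((abs_add_le _ _).trans (add_le_add k1 k2)) ?_)
    rw [abs_div, abs_two]
    gcongr
  have k6 : C₂ / (y / 2) ^ (N + 1) / 2 = C₂ * 2 ^ (N + 1) / 2 / y ^ (N + 1) := by
    rw [div_pow]; field_simp
  rw [k6] at k5
  rw [add_div, add_div, add_div]
  linarith

/-- The function `∑ₖ 1 / (τₖ² + v)`. -/
noncomputable def resolventSum (v : ℝ) : ℂ := ∑' ρ : UpperZero, (ρ.mult : ℂ) / (v + ρ.tau ^ 2)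

/-- Take y = √v and divide by 2y: the leading term (1/2) log(y/2π) becomes ((1/8) log v − (1/4) log
2π) v^(-1/2), which will be the double pole at σ = 1/2. -/
lemma norm_resolventSum_sub_le (N : ℕ) : ∃ C : ℝ, 0 ≤ C ∧ ∀ v : ℝ, 1 ≤ v →
    ‖resolventSum v - ((1 / 8 * Real.log v * v ^ (-(1 / 2) : ℝ) -
      Real.log (2 * Real.pi) / 4 * v ^ (-(1 / 2) : ℝ) +
      ∑ j ∈ Finset.range N, xiCoeff j / 2 * v ^ (-((j + 2) / 2) : ℝ) : ℝ) : ℂ)‖ ≤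
      C * v ^ (-((N + 2) / 2) : ℝ) := by
  obtain ⟨C, hC, hb⟩ := norm_logDeriv_xiEven_sub_le N
  refine ⟨C / 2, by positivity, fun v hv => ?_⟩
  have hv0 : 0 < v := by linarith
  set y := Real.sqrt v with hy
  have hy1 : 1 ≤ y := Real.one_le_sqrt.2 hv
  have hy0 : 0 < y := by linarith
  have hyv : y ^ 2 = v := Real.sq_sqrt hv0.le
  have hpow : ∀ j : ℕ, v ^ (-((j + 2) / 2) : ℝ) = 1 / y ^ (j + 1) / y := by
    intro j
    rw [← hyv, ← Real.rpow_natCast y 2, ← Real.rpow_mul hy0.le, div_div, ← pow_succ, one_div,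
      ← Real.rpow_natCast y (j + 1 + 1), ← Real.rpow_neg hy0.le]
    congr 1
    push_cast; ring
  have hhalf : v ^ (-(1 / 2) : ℝ) = 1 / y := by
    rw [Real.rpow_neg hv0.le, ← Real.sqrt_eq_rpow, one_div]
  have hlog : Real.log v = 2 * Real.log y := by rw [← hyv, Real.log_pow]; push_cast; ring
  have hL := UpperZero.logDeriv_xiEven_eq_tsum (y := y)
  rw [hyv] at hL
  have hM : resolventSum v = logDeriv xiEven y / (2 * y) := by
    have : (y : ℂ) ≠ 0 := by exact_mod_cast hy0.ne'
    rw [hL, resolventSum]; field_simp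
  have e : ((1 / 8 * Real.log v * v ^ (-(1 / 2) : ℝ) -
      Real.log (2 * Real.pi) / 4 * v ^ (-(1 / 2) : ℝ) +
      ∑ j ∈ Finset.range N, xiCoeff j / 2 * v ^ (-((j + 2) / 2) : ℝ) : ℝ) : ℂ) =
      ((Real.log (y / 2) / 2 - Real.log Real.pi / 2 +
      ∑ j ∈ Finset.range N, xiCoeff j / y ^ (j + 1) : ℝ) : ℂ) / (2 * y) := by
    rw [← ofReal_ofNat, ← ofReal_mul, ← ofReal_div]
    congr 1
    rw [add_div, Finset.sum_div, hlog, hhalf, Real.log_mul two_ne_zero Real.pi_ne_zero,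
      Real.log_div hy0.ne' two_ne_zero]
    congr 1
    · field_simp; ring
    · refine Finset.sum_congr rfl fun j _ => ?_
      rw [hpow]; field_simp
  rw [hM, e, ← sub_div, norm_div, hpow]
  have hn : ‖(2 * y : ℂ)‖ = 2 * y := by
    rw [norm_mul, Complex.norm_two, norm_real, Real.norm_of_nonneg hy0.le]
  rw [hn]
  calc _ ≤ C / y ^ (N + 1) / (2 * y) := by gcongr; exact hb y hy1
    _ = _ := by field_simp

end Asymptotics

/-! ### Calculus of Laurent expansions with at most a double pole -/

section Laurent

variable {F F' : ℂ → ℂ} {p c₂ c₁ c₀ d₂ d₁ d₀ : ℂ}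

lemma AnalyticAt.hasLaurentAt (h : AnalyticAt ℂ F p) : HasLaurentAt F p 0 0 (F p) :=
  ⟨F, h, rfl, Eventually.of_forall fun σ => by simp⟩

lemma HasLaurentAt.congr (h : HasLaurentAt F p c₂ c₁ c₀) (hF : F =ᶠ[𝓝[≠] p] F') :
    HasLaurentAt F' p c₂ c₁ c₀ := by
  obtain ⟨G, hG, hG0, hev⟩ := h
  refine ⟨G, hG, hG0, ?_⟩
  filter_upwards [hev, hF] with σ h1 h2
  rw [← h2, h1]

lemma HasLaurentAt.add (h : HasLaurentAt F p c₂ c₁ c₀) (h' : HasLaurentAt F' p d₂ d₁ d₀) :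
    HasLaurentAt (fun σ => F σ + F' σ) p (c₂ + d₂) (c₁ + d₁) (c₀ + d₀) := by
  obtain ⟨G, hG, hG0, hev⟩ := h
  obtain ⟨G', hG', hG0', hev'⟩ := h'
  refine ⟨G + G', hG.add hG', by simp [hG0, hG0'], ?_⟩
  filter_upwards [hev, hev'] with σ h1 h2
  rw [h1, h2, Pi.add_apply]; ring

lemma HasLaurentAt.sum {ι : Type*} (s : Finset ι) {f : ι → ℂ → ℂ} {c₂ c₁ c₀ : ι → ℂ}
    (h : ∀ i ∈ s, HasLaurentAt (f i) p (c₂ i) (c₁ i) (c₀ i)) :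
    HasLaurentAt (fun σ => ∑ i ∈ s, f i σ) p (∑ i ∈ s, c₂ i) (∑ i ∈ s, c₁ i) (∑ i ∈ s, c₀ i) := by
  classical
  induction s using Finset.induction_on with
  | empty =>
    simpa using AnalyticAt.hasLaurentAt (F := fun _ => 0) (p := p) analyticAt_const
  | insert a s ha ih =>
    simp only [Finset.sum_insert ha]
    exact (h a (Finset.mem_insert_self a s)).add
      (ih fun i hi => h i (Finset.mem_insert_of_mem hi))

lemma analyticAt_dslope {A : ℂ → ℂ} (hA : AnalyticAt ℂ A p) : AnalyticAt ℂ (dslope A p) p := by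
  obtain ⟨q, hq⟩ := hA
  exact ⟨_, hq.has_fpower_series_dslope_fslope⟩

lemma eq_add_mul_dslope (A : ℂ → ℂ) (p σ : ℂ) : A σ = A p + (σ - p) * dslope A p σ := by
  have := sub_smul_dslope A p σ
  rw [smul_eq_mul] at this
  rw [this]; ring

/-- Expand A to second order at p; the iterated slope at p stands for A''(p)/2. -/
lemma HasLaurentAt.analytic_mul {A : ℂ → ℂ} (hA : AnalyticAt ℂ A p)
    (h : HasLaurentAt F p c₂ c₁ c₀) :
    HasLaurentAt (fun σ => A σ * F σ) p (A p * c₂) (deriv A p * c₂ + A p * c₁)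
      (dslope (dslope A p) p p * c₂ + deriv A p * c₁ + A p * c₀) := by
  obtain ⟨G, hG, hG0, hev⟩ := h
  have h1 := analyticAt_dslope hA
  have h2 := analyticAt_dslope h1
  refine ⟨fun σ => dslope (dslope A p) p σ * c₂ + dslope A p σ * c₁ + A σ * G σ, ?_, ?_, ?_⟩
  · exact ((h2.mul analyticAt_const).add (h1.mul analyticAt_const)).add (hA.mul hG)
  · simp only [hG0, dslope_same A p]
  · filter_upwards [hev, self_mem_nhdsWithin] with σ hσ hne
    have hne' : σ - p ≠ 0 := sub_ne_zero.2 hne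
    have e1 := eq_add_mul_dslope A p σ
    have e2 := eq_add_mul_dslope (dslope A p) p σ
    rw [dslope_same] at e2
    have k1 : A σ * (c₁ / (σ - p)) = A p * c₁ / (σ - p) + dslope A p σ * c₁ := by
      rw [e1]; field_simp
    have k2 : A σ * (c₂ / (σ - p) ^ 2) = A p * c₂ / (σ - p) ^ 2 + deriv A p * c₂ / (σ - p) +
        dslope (dslope A p) p σ * c₂ := by
      rw [e1, e2]; field_simp; ring
    rw [hσ, mul_add, mul_add, k1, k2]
    ring

lemma HasLaurentAt.const_mul (c : ℂ) (h : HasLaurentAt F p c₂ c₁ c₀) :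
    HasLaurentAt (fun σ => c * F σ) p (c * c₂) (c * c₁) (c * c₀) := by
  obtain ⟨G, hG, hG0, hev⟩ := h
  refine ⟨fun σ => c * G σ, analyticAt_const.mul hG, by simp [hG0], ?_⟩
  filter_upwards [hev] with σ h1
  rw [h1]; ring

lemma HasLaurentAt.comp_affine {α β : ℂ} (hα : α ≠ 0)
    (h : HasLaurentAt F (α * p + β) c₂ c₁ c₀) :
    HasLaurentAt (fun s => F (α * s + β)) p (c₂ / α ^ 2) (c₁ / α) c₀ := by
  obtain ⟨G, hG, hG0, hev⟩ := h
  have ha : AnalyticAt ℂ (fun s => α * s + β) p := by fun_prop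
  refine ⟨fun s => G (α * s + β), AnalyticAt.comp (f := fun s => α * s + β) hG ha, hG0, ?_⟩
  have ht : Tendsto (fun s => α * s + β) (𝓝[≠] p) (𝓝[≠] (α * p + β)) := by
    refine tendsto_nhdsWithin_iff.2 ⟨ha.continuousAt.tendsto.mono_left nhdsWithin_le_nhds, ?_⟩
    filter_upwards [self_mem_nhdsWithin] with s hs hs'
    exact hs (mul_left_cancel₀ hα (add_right_cancel hs'))
  filter_upwards [ht.eventually hev] with s hs
  rw [hs, show α * s + β - (α * p + β) = α * (s - p) by ring]
  rw [mul_pow, div_div, div_div]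

lemma HasLaurentAt.eventually_analyticAt (h : HasLaurentAt F p c₂ c₁ c₀) :
    ∀ᶠ σ in 𝓝[≠] p, AnalyticAt ℂ F σ := by
  obtain ⟨G, hG, -, hev⟩ := h
  have h1 : ∀ᶠ σ in 𝓝[≠] p, AnalyticAt ℂ G σ :=
    hG.eventually_analyticAt.filter_mono nhdsWithin_le_nhds
  filter_upwards [eventually_eventually_nhdsWithin.2 hev, h1, self_mem_nhdsWithin] with σ h2 h3 h4
  have hne : σ - p ≠ 0 := sub_ne_zero.2 h4
  rw [nhdsWithin_eq_nhds.2 (isOpen_compl_singleton.mem_nhds h4)] at h2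
  have h6 : AnalyticAt ℂ (fun σ => c₂ / (σ - p) ^ 2 + c₁ / (σ - p) + G σ) σ := by
    have a1 : AnalyticAt ℂ (fun σ : ℂ => σ - p) σ := by fun_prop
    exact ((analyticAt_const.div (a1.pow 2) (pow_ne_zero 2 hne)).add
      (analyticAt_const.div a1 hne)).add h3
  exact h6.congr (h2.mono fun _ h => h.symm)

lemma HasLaurentAt.tendsto (h : HasLaurentAt F p 0 0 c₀) : Tendsto F (𝓝[≠] p) (𝓝 c₀) := by
  obtain ⟨G, hG, hG0, hev⟩ := h
  have h1 : Tendsto G (𝓝[≠] p) (𝓝 c₀) := by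
    rw [← hG0]; exact hG.continuousAt.tendsto.mono_left nhdsWithin_le_nhds
  refine h1.congr' ?_
  filter_upwards [hev] with σ h2
  rw [h2]; simp

open Classical in
/-- The function `F` with its removable singularities removed. -/
noncomputable def regularized (F : ℂ → ℂ) (p : ℂ) : ℂ :=
  if h : ∃ c, HasLaurentAt F p 0 0 c then h.choose else F p

lemma HasLaurentAt.regularized_eq (h : HasLaurentAt F p 0 0 c₀) : regularized F p = c₀ := by
  have h' : ∃ c, HasLaurentAt F p 0 0 c := ⟨c₀, h⟩
  rw [regularized, dif_pos h']
  exact tendsto_nhds_unique h'.choose_spec.tendsto h.tendsto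

lemma AnalyticAt.regularized_eq (h : AnalyticAt ℂ F p) : regularized F p = F p :=
  (AnalyticAt.hasLaurentAt h).regularized_eq

/-- Close to p but off it F is analytic, so regularizing changes nothing there. -/
lemma HasLaurentAt.regularized (h : HasLaurentAt F p c₂ c₁ c₀) :
    HasLaurentAt (regularized F) p c₂ c₁ c₀ :=
  h.congr (h.eventually_analyticAt.mono fun _ h => (AnalyticAt.regularized_eq h).symm)

lemma HasLaurentAt.analyticAt_regularized (h : HasLaurentAt F p 0 0 c₀) :
    AnalyticAt ℂ (RiemannZetaZeros.regularized F) p := by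
  have h1 := h.regularized_eq
  obtain ⟨G, hG, hG0, hev⟩ := h.regularized
  refine hG.congr ?_
  filter_upwards [eventually_nhdsWithin_iff.1 hev] with σ hσ
  by_cases hp : σ = p
  · rw [hp, h1, hG0]
  · rw [hσ hp]; simp

lemma hasLaurentAt_pole (p d₂ d₁ : ℂ) :
    HasLaurentAt (fun σ => d₂ / (σ - p) ^ 2 + d₁ / (σ - p)) p d₂ d₁ 0 :=
  ⟨fun _ => 0, analyticAt_const, rfl, Eventually.of_forall fun _ => by simp⟩

end Laurent

/-! ### The Mellin transform of 1/(v + w) -/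

section MellinKernel

open MeasureTheory

/-- Integrating the modulus over v first gives Γ(1 − Re σ) t^(Re σ − 1) e^(-t Re w): the v-integral
needs Re σ < 1, the t-integral Re σ > 0. This justifies the interchange below. -/
lemma integrable_mellinKernel {w σ : ℂ} (hw : 0 < w.re) (h0 : 0 < σ.re) (h1 : σ.re < 1) :
    Integrable (fun z : ℝ × ℝ => (z.1 : ℂ) ^ (-σ) * (exp (-(z.1 * z.2)) * exp (-(w * z.2))))
      ((volume.restrict (Set.Ioi 0)).prod (volume.restrict (Set.Ioi 0))) := by
  have hmeas : AEStronglyMeasurable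
      (fun z : ℝ × ℝ => (z.1 : ℂ) ^ (-σ) * (exp (-(z.1 * z.2)) * exp (-(w * z.2))))
      ((volume.restrict (Set.Ioi 0)).prod (volume.restrict (Set.Ioi 0))) :=
    Measurable.aestronglyMeasurable (by fun_prop)
  have hnorm : ∀ t : ℝ, ∀ v ∈ Set.Ioi (0 : ℝ),
      ‖(v : ℂ) ^ (-σ) * (exp (-(v * t)) * exp (-(w * t)))‖ =
        (v ^ (-σ.re) * Real.exp (-t * v ^ (1 : ℝ))) * Real.exp (-(w.re * t)) := by
    intro t v hv
    rw [norm_mul, norm_mul, norm_cpow_eq_rpow_re_of_pos hv, Complex.norm_exp, Complex.norm_exp]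
    simp
    ring_nf
  rw [integrable_prod_iff' hmeas]
  constructor
  · filter_upwards [ae_restrict_mem measurableSet_Ioi] with t ht
    rw [← integrable_norm_iff (Measurable.aestronglyMeasurable (by fun_prop))]
    have h2 : IntegrableOn (fun v : ℝ => (v ^ (-σ.re) * Real.exp (-t * v ^ (1 : ℝ))) *
        Real.exp (-(w.re * t))) (Set.Ioi 0) :=
      (integrableOn_rpow_mul_exp_neg_mul_rpow (by linarith) one_pos ht).mul_const _
    exact h2.congr_fun (fun v hv => (hnorm t v hv).symm) measurableSet_Ioi
  · have h3 : IntegrableOn (fun t : ℝ => Real.Gamma (1 - σ.re) *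
        (t ^ (σ.re - 1) * Real.exp (-w.re * t ^ (1 : ℝ)))) (Set.Ioi 0) :=
      (integrableOn_rpow_mul_exp_neg_mul_rpow (by linarith) one_pos hw).const_mul _
    refine h3.congr_fun (fun t ht => ?_) measurableSet_Ioi
    have ht' : (0 : ℝ) < t := ht
    dsimp only
    rw [setIntegral_congr_fun measurableSet_Ioi (hnorm t), integral_mul_const]
    have h4 := Real.integral_rpow_mul_exp_neg_mul_Ioi (a := 1 - σ.re) (r := t) (by linarith) ht'
    have h5 : ∀ v : ℝ, v ^ (-σ.re) * Real.exp (-t * v ^ (1 : ℝ)) =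
        v ^ (1 - σ.re - 1) * Real.exp (-(t * v)) := fun v => by
      rw [Real.rpow_one]; ring_nf
    simp only [h5]
    rw [h4, one_div, Real.inv_rpow ht'.le, ← Real.rpow_neg ht'.le, Real.rpow_one]
    ring_nf

lemma integral_exp_mellinKernel {w : ℂ} {v : ℝ} (hw : 0 < w.re) (hv : 0 < v) :
    ∫ t in Set.Ioi (0 : ℝ), exp (-(v * t)) * exp (-(w * t)) = 1 / (v + w) := by
  have h := integral_exp_mul_complex_Ioi (a := -(v + w)) (by simp; linarith) 0
  have e : ∀ t : ℝ, exp (-(v * t)) * exp (-(w * t)) = exp (-(v + w) * t) := fun t => by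
    rw [← Complex.exp_add]; congr 1; ring
  simp only [e, h]
  rw [ofReal_zero, mul_zero, Complex.exp_zero, neg_div_neg_eq]

/-- The Laplace transform of `t ↦ t ^ (σ - 1)` on the right half-plane. -/
lemma integral_cpow_mul_exp_neg_mul {w σ : ℂ} (h0 : 0 < σ.re) (hw : 0 < w.re) :
    ∫ t in Set.Ioi (0 : ℝ), (t : ℂ) ^ (σ - 1) * exp (-(w * t)) = w ^ (-σ) * Gamma σ := by
  set U : Set ℂ := {w : ℂ | 0 < w.re} with hU
  have hUo : IsOpen U := isOpen_lt continuous_const continuous_re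
  have hUc : IsPreconnected U := (convex_halfSpace_re_gt 0).isPreconnected
  have hf : AnalyticOnNhd ℂ
      (fun w => ∫ t in Set.Ioi (0 : ℝ), (t : ℂ) ^ (σ - 1) * exp (-(w * t))) U := by
    refine DifferentiableOn.analyticOnNhd (fun w₀ hw₀ => ?_) hUo
    have hw₀' : 0 < w₀.re := hw₀
    have hn : ∀ w : ℂ, ∀ t ∈ Set.Ioi (0 : ℝ),
        ‖(t : ℂ) ^ (σ - 1) * exp (-(w * t))‖ = t ^ (σ.re - 1) * Real.exp (-w.re * t ^ (1 : ℝ)) := by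
      intro w t ht
      rw [norm_mul, norm_cpow_eq_rpow_re_of_pos ht, Complex.norm_exp]
      simp
    have hd := hasDerivAt_integral_of_dominated_loc_of_deriv_le
      (μ := volume.restrict (Set.Ioi (0 : ℝ))) (𝕜 := ℂ) (E := ℂ)
      (F := fun w (t : ℝ) => (t : ℂ) ^ (σ - 1) * exp (-(w * t)))
      (F' := fun w (t : ℝ) => (t : ℂ) ^ (σ - 1) * (exp (-(w * t)) * (-t)))
      (bound := fun t : ℝ => t ^ σ.re * Real.exp (-(w₀.re / 2) * t ^ (1 : ℝ)))
      (x₀ := w₀) (s := Metric.ball w₀ (w₀.re / 2)) (Metric.ball_mem_nhds _ (by positivity))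
      (Eventually.of_forall fun w => Measurable.aestronglyMeasurable (by fun_prop)) ?_
      (Measurable.aestronglyMeasurable (by fun_prop)) ?_
      (integrableOn_rpow_mul_exp_neg_mul_rpow (by linarith) one_pos (by positivity)) ?_
    · exact hd.2.differentiableAt.differentiableWithinAt
    · rw [← integrable_norm_iff (Measurable.aestronglyMeasurable (by fun_prop))]
      exact IntegrableOn.congr_fun
        (integrableOn_rpow_mul_exp_neg_mul_rpow (by linarith) one_pos hw₀')
        (fun t ht => (hn w₀ t ht).symm) measurableSet_Ioi
    · filter_upwards [ae_restrict_mem measurableSet_Ioi] with t ht w hw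
      have ht' : (0 : ℝ) < t := ht
      rw [← mul_assoc, norm_mul, hn w t ht, norm_neg, norm_real, Real.norm_of_nonneg ht'.le,
        Real.rpow_one]
      have h1 : w₀.re / 2 ≤ w.re := by
        have h2 := (abs_re_le_norm (w - w₀)).trans (mem_ball_iff_norm.1 hw).le
        rw [sub_re, abs_le] at h2
        linarith [h2.1]
      have h3 : t ^ σ.re = t ^ (σ.re - 1) * t := by
        rw [← Real.rpow_add_one ht'.ne', sub_add_cancel]
      rw [h3, mul_right_comm]
      gcongr
    · filter_upwards with t w _
      have h1 : HasDerivAt (fun w : ℂ => -(w * t)) (-t) w := by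
        have h2 := ((hasDerivAt_id w).mul_const (t : ℂ)).neg
        rw [one_mul] at h2
        exact h2
      exact h1.cexp.const_mul _
  have hg : AnalyticOnNhd ℂ (fun w : ℂ => w ^ (-σ) * Gamma σ) U := by
    refine DifferentiableOn.analyticOnNhd (fun w₀ hw₀ => ?_) hUo
    have : w₀ ∈ slitPlane := Or.inl hw₀
    exact ((differentiableAt_id.cpow_const this).mul_const _).differentiableWithinAt
  -- Both sides are analytic in w on the right half-plane and agree at real w > 1, which accumulate
  -- at 1.
  refine hf.eqOn_of_preconnected_of_frequently_eq hg hUc (z₀ := 1) (by simp [hU]) ?_ hw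
  have ht : Tendsto (fun x : ℝ => (x : ℂ)) (𝓝[>] 1) (𝓝[≠] 1) := by
    refine tendsto_nhdsWithin_iff.2 ⟨?_, ?_⟩
    · exact (Complex.continuous_ofReal.tendsto' 1 1 (by simp)).mono_left nhdsWithin_le_nhds
    · filter_upwards [self_mem_nhdsWithin] with x hx h
      have : x = 1 := by exact_mod_cast Set.mem_singleton_iff.1 h
      exact (ne_of_gt hx) this
  refine ht.frequently (Eventually.frequently ?_)
  filter_upwards [self_mem_nhdsWithin] with x hx
  have hx' : (0 : ℝ) < x := lt_trans one_pos hx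
  rw [Complex.integral_cpow_mul_exp_neg_mul_Ioi h0 hx', one_div, inv_cpow _ _ (by
      rw [arg_ofReal_of_nonneg hx'.le]; exact Real.pi_pos.ne), ← cpow_neg]

/-- The Mellin transform of `v ↦ 1 / (v + w)`. -/
lemma integral_cpow_div_add {w σ : ℂ} (hw : 0 < w.re) (h0 : 0 < σ.re) (h1 : σ.re < 1) :
    IntegrableOn (fun v : ℝ => (v : ℂ) ^ (-σ) * (1 / (v + w))) (Set.Ioi 0) ∧
    ∫ v in Set.Ioi (0 : ℝ), (v : ℂ) ^ (-σ) * (1 / (v + w)) =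
      Gamma (1 - σ) * Gamma σ * w ^ (-σ) := by
  have hI := integrable_mellinKernel hw h0 h1
  have e1 : ∀ v ∈ Set.Ioi (0 : ℝ), ∫ t in Set.Ioi (0 : ℝ),
      (v : ℂ) ^ (-σ) * (exp (-(v * t)) * exp (-(w * t))) = (v : ℂ) ^ (-σ) * (1 / (v + w)) := by
    intro v hv
    rw [integral_const_mul, integral_exp_mellinKernel hw hv]
  refine ⟨IntegrableOn.congr_fun hI.integral_prod_left e1 measurableSet_Ioi, ?_⟩
  -- With 1/(v + w) written as a Laplace integral, swapping the order leaves two Gamma integrals.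
  rw [← setIntegral_congr_fun measurableSet_Ioi e1, integral_integral_swap hI]
  have e2 : ∀ t ∈ Set.Ioi (0 : ℝ), ∫ v in Set.Ioi (0 : ℝ),
      (v : ℂ) ^ (-σ) * (exp (-(v * t)) * exp (-(w * t))) =
      Gamma (1 - σ) * ((t : ℂ) ^ (σ - 1) * exp (-(w * t))) := by
    intro t ht
    have ht' : (0 : ℝ) < t := ht
    have h2 := Complex.integral_cpow_mul_exp_neg_mul_Ioi (a := 1 - σ) (r := t)
      (by simp; linarith) (by simpa using ht')
    have h3 : ∀ v : ℝ, (v : ℂ) ^ (-σ) * (exp (-(v * t)) * exp (-(w * t))) =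
        (v : ℂ) ^ (1 - σ - 1) * exp (-(t * v)) * exp (-(w * t)) := fun v => by
      rw [mul_assoc, show 1 - σ - 1 = -σ by ring, mul_comm (t : ℂ)]
    simp only [h3]
    rw [integral_mul_const, h2, one_div, inv_cpow _ _ (by
      rw [arg_ofReal_of_nonneg ht'.le]; exact Real.pi_pos.ne), ← cpow_neg, neg_sub]
    ring
  rw [setIntegral_congr_fun measurableSet_Ioi e2, integral_const_mul,
    integral_cpow_mul_exp_neg_mul h0 hw]
  ring

lemma norm_add_le_two_mul_norm {w : ℂ} {v : ℝ} (hw : 0 < w.re) (hv : 0 < v) :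
    v + ‖w‖ ≤ 2 * ‖(v : ℂ) + w‖ := by
  have h1 : v ≤ ‖(v : ℂ) + w‖ := by
    refine le_trans ?_ (re_le_norm _)
    simp; linarith
  have h2 : ‖w‖ ≤ ‖(v : ℂ) + w‖ := by
    refine abs_le_of_sq_le_sq' ?_ (norm_nonneg _) |>.2
    rw [Complex.sq_norm, Complex.sq_norm, normSq_apply, normSq_apply]
    simp only [add_re, ofReal_re, add_im, ofReal_im, zero_add]
    nlinarith
  linarith

/-- In the right half-plane |v + w| ≥ (v + |w|)/2, which reduces the bound to the exact integral at
the positive number |w|. The decay in |w| then makes the sum over zeros summable. -/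
lemma integral_norm_cpow_div_add_le {w σ : ℂ} (hw : 0 < w.re) (h0 : 0 < σ.re) (h1 : σ.re < 1) :
    ∫ v in Set.Ioi (0 : ℝ), ‖(v : ℂ) ^ (-σ) * (1 / (v + w))‖ ≤
      2 * (Real.Gamma (1 - σ.re) * Real.Gamma σ.re * ‖w‖ ^ (-σ.re)) := by
  have hw0 : 0 < ‖w‖ := norm_pos_iff.2 (by rintro rfl; simp at hw)
  obtain ⟨hI, hE⟩ := integral_cpow_div_add (w := (‖w‖ : ℂ)) (σ := (σ.re : ℂ))
    (by simpa using hw0) (by simpa using h0) (by simpa using h1)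
  have e : ∀ v ∈ Set.Ioi (0 : ℝ), (v : ℂ) ^ (-(σ.re : ℂ)) * (1 / (v + (‖w‖ : ℂ))) =
      ((v ^ (-σ.re) * (1 / (v + ‖w‖)) : ℝ) : ℂ) := by
    intro v hv
    push_cast
    rw [ofReal_cpow (le_of_lt hv)]
    push_cast; rfl
  rw [setIntegral_congr_fun measurableSet_Ioi e, integral_complex_ofReal] at hE
  have hE' : ∫ v in Set.Ioi (0 : ℝ), v ^ (-σ.re) * (1 / (v + ‖w‖)) =
      Real.Gamma (1 - σ.re) * Real.Gamma σ.re * ‖w‖ ^ (-σ.re) := by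
    have : ((1 : ℂ) - σ.re) = ((1 - σ.re : ℝ) : ℂ) := by push_cast; rfl
    rw [this, Gamma_ofReal, Gamma_ofReal, ← ofReal_neg, ← ofReal_cpow hw0.le] at hE
    exact_mod_cast hE
  have hI' : IntegrableOn (fun v : ℝ => v ^ (-σ.re) * (1 / (v + ‖w‖))) (Set.Ioi 0) := by
    have := hI.norm
    refine IntegrableOn.congr_fun this (fun v hv => ?_) measurableSet_Ioi
    have hv' : (0 : ℝ) < v := hv
    rw [e v hv, norm_real, Real.norm_of_nonneg (by positivity)]
  rw [← hE', ← integral_const_mul]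
  refine setIntegral_mono_on (integral_cpow_div_add hw h0 h1).1.norm (hI'.const_mul 2)
    measurableSet_Ioi fun v hv => ?_
  have hv' : (0 : ℝ) < v := hv
  rw [norm_mul, norm_cpow_eq_rpow_re_of_pos hv, norm_div, norm_one, neg_re]
  have h2 := norm_add_le_two_mul_norm hw hv'
  have h3 : 1 / ‖(v : ℂ) + w‖ ≤ 2 * (1 / (v + ‖w‖)) := by
    rw [mul_one_div, div_le_div_iff₀ (by linarith) (by linarith)]
    linarith
  calc _ ≤ v ^ (-σ.re) * (2 * (1 / (v + ‖w‖))) := by gcongr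
    _ = _ := by ring

end MellinKernel

/-! ### The sum over τ as a Mellin transform of the resolvent sum -/

section Series

open MeasureTheory

instance : Countable UpperZero := by
  have h : (Set.univ : Set UpperZero) = ⋃ n : ℕ, {ρ | ‖ρ.tau‖ ≤ n} := by
    ext ρ
    obtain ⟨n, hn⟩ := exists_nat_ge ‖ρ.tau‖
    simp only [Set.mem_univ, Set.mem_iUnion, true_iff]
    exact ⟨n, hn⟩
  rw [← Set.countable_univ_iff, h]
  exact Set.countable_iUnion fun n => (UpperZero.finite_norm_tau_le n).countable

lemma norm_cpow_neg_le_of_re_pos {w : ℂ} (hw : 0 < w.re) (s : ℂ) :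
    ‖w ^ (-s)‖ ≤ ‖w‖ ^ (-s.re) * Real.exp (Real.pi * |s.im|) := by
  have hw0 : w ≠ 0 := by rintro rfl; simp at hw
  rw [norm_cpow_of_ne_zero hw0, div_eq_mul_inv, ← Real.exp_neg]
  simp only [neg_re, neg_im]
  gcongr
  have := abs_arg_le_pi w
  calc -(w.arg * -s.im) = w.arg * s.im := by ring
    _ ≤ |w.arg * s.im| := le_abs_self _
    _ ≤ _ := by rw [abs_mul]; gcongr

lemma norm_calZTerm_le (σ : ℂ) (ρ : UpperZero) :
    ‖calZTerm σ ρ‖ ≤ Real.exp (Real.pi * |σ.im|) * (ρ.mult * ‖ρ.tau‖ ^ (-(2 * σ.re))) := by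
  rw [calZTerm, ρ.zeroMult_eq, norm_mul, Complex.norm_natCast]
  have h := norm_cpow_neg_le_of_re_pos ρ.tau_sq_re_pos σ
  have h2 : ‖ρ.tau ^ 2‖ ^ (-σ.re) = ‖ρ.tau‖ ^ (-(2 * σ.re)) := by
    rw [norm_pow, ← Real.rpow_natCast, ← Real.rpow_mul (norm_nonneg _)]
    congr 1; push_cast; ring
  rw [h2] at h
  calc _ ≤ (ρ.mult : ℝ) * (‖ρ.tau‖ ^ (-(2 * σ.re)) * Real.exp (Real.pi * |σ.im|)) := by gcongr
    _ = _ := by ring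

lemma summable_calZTerm {σ : ℂ} (hσ : 1 / 2 < σ.re) : Summable (calZTerm σ) :=
  Summable.of_norm_bounded
    ((UpperZero.summable_mult_mul_rpow (r := 2 * σ.re) (by linarith)).mul_left _)
    (norm_calZTerm_le σ)

lemma continuousOn_resolventSum : ContinuousOn resolventSum (Set.Ici 0) := by
  refine continuousOn_tsum (u := fun ρ : UpperZero => (ρ.mult : ℝ) * ‖ρ.tau‖ ^ (-2 : ℝ))
    (fun ρ => ?_) (UpperZero.summable_mult_mul_rpow one_lt_two)
    (fun ρ v hv => UpperZero.norm_mult_div_le hv ρ)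
  refine ContinuousOn.div continuousOn_const (by fun_prop) fun v hv h => ?_
  have h3 := UpperZero.norm_tau_sq_le_norm_add hv ρ
  rw [h, norm_zero] at h3
  have := ρ.one_lt_norm_tau
  nlinarith

/-- The Mellin transform of the resolvent sum. -/
lemma mellin_resolventSum {σ : ℂ} (h0 : 1 / 2 < σ.re) (h1 : σ.re < 1) :
    ∑' ρ, calZTerm σ ρ = sin (Real.pi * σ) / Real.pi * mellin resolventSum (1 - σ) := by
  have h0' : 0 < σ.re := by linarith
  set F : UpperZero → ℝ → ℂ := fun ρ v =>
    (ρ.mult : ℂ) * ((v : ℂ) ^ (-σ) * (1 / (v + ρ.tau ^ 2))) with hF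
  have hFi : ∀ ρ, Integrable (F ρ) (volume.restrict (Set.Ioi 0)) := fun ρ =>
    (integral_cpow_div_add ρ.tau_sq_re_pos h0' h1).1.const_mul _
  have hFn : Summable fun ρ => ∫ v in Set.Ioi (0 : ℝ), ‖F ρ v‖ := by
    refine Summable.of_nonneg_of_le (fun ρ => integral_nonneg fun _ => norm_nonneg _) (fun ρ => ?_)
      ((UpperZero.summable_mult_mul_rpow (r := 2 * σ.re) (by linarith)).mul_left
        (2 * (Real.Gamma (1 - σ.re) * Real.Gamma σ.re)))
    have e : ∀ v : ℝ, ‖F ρ v‖ = ρ.mult * ‖(v : ℂ) ^ (-σ) * (1 / (v + ρ.tau ^ 2))‖ := fun v => by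
      rw [hF, norm_mul, Complex.norm_natCast]
    simp only [e]
    rw [integral_const_mul]
    have h2 : ‖ρ.tau ^ 2‖ ^ (-σ.re) = ‖ρ.tau‖ ^ (-(2 * σ.re)) := by
      rw [norm_pow, ← Real.rpow_natCast, ← Real.rpow_mul (norm_nonneg _)]
      congr 1; push_cast; ring
    have h3 := integral_norm_cpow_div_add_le ρ.tau_sq_re_pos h0' h1
    rw [h2] at h3
    calc _ ≤ (ρ.mult : ℝ) * (2 * (Real.Gamma (1 - σ.re) * Real.Gamma σ.re *
          ‖ρ.tau‖ ^ (-(2 * σ.re)))) := by gcongr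
      _ = _ := by ring
  have hsum := hasSum_integral_of_summable_integral_norm hFi hFn
  -- The two Gamma factors combine by the reflection formula into π / sin πσ, independent of the
  -- zero.
  have hint : ∀ ρ, ∫ v in Set.Ioi (0 : ℝ), F ρ v =
      Real.pi / sin (Real.pi * σ) * calZTerm σ ρ := by
    intro ρ
    rw [hF, integral_const_mul, (integral_cpow_div_add ρ.tau_sq_re_pos h0' h1).2, calZTerm,
      ρ.zeroMult_eq, mul_comm (Gamma (1 - σ)), Gamma_mul_Gamma_one_sub]
    ring
  have hmel : ∫ v in Set.Ioi (0 : ℝ), ∑' ρ, F ρ v = mellin resolventSum (1 - σ) := by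
    rw [mellin]
    refine setIntegral_congr_fun measurableSet_Ioi fun v hv => ?_
    have hv' : (0 : ℝ) < v := hv
    rw [resolventSum, smul_eq_mul, ← tsum_mul_left]
    refine tsum_congr fun ρ => ?_
    rw [hF, show 1 - σ - 1 = -σ by ring]
    ring
  simp only [hint] at hsum
  rw [hmel] at hsum
  have hsin : sin (Real.pi * σ) ≠ 0 := by
    intro h
    obtain ⟨k, hk⟩ := Complex.sin_eq_zero_iff.1 h
    have hpi : (Real.pi : ℂ) ≠ 0 := by exact_mod_cast Real.pi_ne_zero
    have hk' : σ = k := by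
      rw [mul_comm (k : ℂ)] at hk
      exact mul_left_cancel₀ hpi hk
    rw [hk', intCast_re] at h0' h1
    have a1 : (0 : ℤ) < k := by exact_mod_cast h0'
    have a2 : k < (1 : ℤ) := by exact_mod_cast h1
    omega
  rw [← hsum.tsum_eq, tsum_mul_left]
  have hpi : (Real.pi : ℂ) ≠ 0 := by exact_mod_cast Real.pi_ne_zero
  field_simp

end Series

/-! ### Subtracting the expansion at infinity; continuation strip by strip -/

section Tail

open MeasureTheory

lemma locallyIntegrableOn_indicator_Ioi_one {f : ℝ → ℂ} (hf : ContinuousOn f (Set.Ioi 0)) :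
    LocallyIntegrableOn (Set.indicator (Set.Ioi 1) f) (Set.Ioi 0) := by
  intro x hx
  obtain ⟨u, hu, hI⟩ := hf.locallyIntegrableOn (μ := volume) measurableSet_Ioi x hx
  exact ⟨u, hu, hI.indicator measurableSet_Ioi⟩

lemma indicator_Ioi_one_isBigO_zero (f : ℝ → ℂ) (b : ℝ) :
    Set.indicator (Set.Ioi 1) f =O[𝓝[>] 0] (fun v : ℝ => v ^ (-b)) := by
  refine Asymptotics.IsBigO.of_bound 0 ?_
  filter_upwards [Ioo_mem_nhdsGT one_pos] with v hv
  rw [Set.indicator_of_notMem (by simpa using hv.2.le)]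
  simp

/-- The function `v ^ (-c)` on `v > 1`, extended by zero. -/
noncomputable def powTail (c : ℝ) : ℝ → ℂ :=
  Set.indicator (Set.Ioi 1) fun v => ((v ^ (-c) : ℝ) : ℂ)

lemma powTail_isBigO (c : ℝ) : powTail c =O[atTop] (fun v : ℝ => v ^ (-c)) := by
  refine Asymptotics.IsBigO.of_bound 1 ?_
  filter_upwards [eventually_gt_atTop 1] with v hv
  rw [powTail, Set.indicator_of_mem (show v ∈ Set.Ioi 1 from hv), norm_real, one_mul]

lemma locallyIntegrableOn_powTail (c : ℝ) : LocallyIntegrableOn (powTail c) (Set.Ioi 0) :=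
  locallyIntegrableOn_indicator_Ioi_one (by
    refine Complex.continuous_ofReal.comp_continuousOn ?_
    exact continuousOn_id.rpow_const fun v hv => Or.inl (ne_of_gt hv))

lemma hasMellin_powTail {c : ℝ} {s : ℂ} (hs : s.re < c) :
    HasMellin (powTail c) s (1 / (c - s)) := by
  refine ⟨mellinConvergent_of_isBigO_rpow (locallyIntegrableOn_powTail c) (powTail_isBigO c) hs
    (indicator_Ioi_one_isBigO_zero _ (s.re - 1)) (by linarith), ?_⟩
  have e : ∀ v ∈ Set.Ioi (0 : ℝ), (v : ℂ) ^ (s - 1) • powTail c v =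
      Set.indicator (Set.Ioi 1) (fun v : ℝ => (v : ℂ) ^ (s - 1 - c)) v := by
    intro v hv
    rw [powTail]
    by_cases h : v ∈ Set.Ioi (1 : ℝ)
    · have hv' : (v : ℂ) ≠ 0 := by exact_mod_cast (ne_of_gt hv)
      rw [Set.indicator_of_mem h, Set.indicator_of_mem h, ofReal_cpow (le_of_lt hv), smul_eq_mul,
        ← cpow_add _ _ hv']
      push_cast
      ring_nf
    · rw [Set.indicator_of_notMem h, Set.indicator_of_notMem h, smul_zero]
  rw [mellin, setIntegral_congr_fun measurableSet_Ioi e, setIntegral_indicator measurableSet_Ioi,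
    Set.inter_eq_right.2 (Set.Ioi_subset_Ioi zero_le_one),
    integral_Ioi_cpow_of_lt (by simp; linarith) one_pos]
  rw [ofReal_one, one_cpow, ← neg_div_neg_eq, neg_neg]
  congr 1
  ring

/-- Differentiating the preceding Mellin transform in s brings down log v and doubles the pole. -/
lemma hasMellin_log_powTail {c : ℝ} {s : ℂ} (hs : s.re < c) :
    HasMellin (fun v => Real.log v • powTail c v) s (1 / (c - s) ^ 2) := by
  obtain ⟨h1, h2⟩ := mellin_hasDerivAt_of_isBigO_rpow (locallyIntegrableOn_powTail c)
    (powTail_isBigO c) hs (indicator_Ioi_one_isBigO_zero _ (s.re - 1)) (by linarith)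
  refine ⟨h1, h2.unique ?_⟩
  have hne : (c : ℂ) - s ≠ 0 := by
    intro h
    have := congrArg re h
    simp at this
    linarith
  have h3 : HasDerivAt (fun z : ℂ => 1 / (c - z)) (1 / (c - s) ^ 2) s := by
    have := (((hasDerivAt_id s).const_sub (c : ℂ)).inv hne)
    simpa [one_div] using! this
  refine h3.congr_of_eventuallyEq ?_
  filter_upwards [(isOpen_lt continuous_re continuous_const).mem_nhds hs] with z hz
  exact (hasMellin_powTail hz).2

/-- The resolvent sum minus `N + 2` terms of its expansion at infinity. -/
noncomputable def resolventRem (N : ℕ) (v : ℝ) : ℂ :=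
  resolventSum v - ((1 / 8 : ℂ) • (Real.log v • powTail (1 / 2) v) -
    (Real.log (2 * Real.pi) / 4 : ℂ) • powTail (1 / 2) v +
    ∑ j ∈ Finset.range N, (xiCoeff j / 2 : ℂ) • powTail ((j + 2) / 2) v)

lemma resolventRem_succ (N : ℕ) : resolventRem (N + 1) =
    fun v => resolventRem N v - (xiCoeff N / 2 : ℂ) • powTail ((N + 2) / 2) v := by
  funext v
  rw [resolventRem, resolventRem, Finset.sum_range_succ]
  ring

lemma locallyIntegrableOn_log_powTail (c : ℝ) :
    LocallyIntegrableOn (fun v => Real.log v • powTail c v) (Set.Ioi 0) := by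
  have : (fun v => Real.log v • powTail c v) =
      Set.indicator (Set.Ioi 1) fun v => Real.log v • ((v ^ (-c) : ℝ) : ℂ) := by
    funext v
    rw [powTail, Set.indicator_smul_apply]
  rw [this]
  refine locallyIntegrableOn_indicator_Ioi_one ?_
  refine ContinuousOn.smul (Real.continuousOn_log.mono fun v hv => ?_) ?_
  · exact ne_of_gt hv
  · refine Complex.continuous_ofReal.comp_continuousOn ?_
    exact continuousOn_id.rpow_const fun v hv => Or.inl (ne_of_gt hv)

lemma locallyIntegrableOn_resolventRem (N : ℕ) :
    LocallyIntegrableOn (resolventRem N) (Set.Ioi 0) := by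
  induction N with
  | zero =>
    have h1 : LocallyIntegrableOn resolventSum (Set.Ioi 0) :=
      (continuousOn_resolventSum.mono Set.Ioi_subset_Ici_self).locallyIntegrableOn
        measurableSet_Ioi
    have e : resolventRem 0 = resolventSum - (((1 / 8 : ℂ) • fun v =>
        Real.log v • powTail (1 / 2) v) - (Real.log (2 * Real.pi) / 4 : ℂ) • powTail (1 / 2)) := by
      funext v
      simp [resolventRem]
    rw [e]
    exact h1.sub (((locallyIntegrableOn_log_powTail _).smul _).sub
      ((locallyIntegrableOn_powTail _).smul _))
  | succ N ih =>
    rw [resolventRem_succ]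
    exact ih.sub ((locallyIntegrableOn_powTail _).smul (xiCoeff N / 2 : ℂ))

lemma resolventRem_isBigO (N : ℕ) :
    resolventRem N =O[atTop] (fun v : ℝ => v ^ (-((N + 2) / 2) : ℝ)) := by
  obtain ⟨C, hC, hb⟩ := norm_resolventSum_sub_le N
  refine Asymptotics.IsBigO.of_bound C ?_
  filter_upwards [eventually_gt_atTop 1] with v hv
  have hp : ∀ c, powTail c v = ((v ^ (-c) : ℝ) : ℂ) := fun c =>
    Set.indicator_of_mem (show v ∈ Set.Ioi 1 from hv) _
  have h := hb v hv.le
  rw [Real.norm_of_nonneg (by positivity : 0 ≤ v ^ (-((N + 2) / 2) : ℝ))]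
  refine le_trans (le_of_eq ?_) h
  rw [resolventRem]
  simp only [hp, smul_eq_mul, real_smul]
  push_cast
  congr 3
  ring

/-- The subtracted tails vanish for v ≤ 1, so near 0 the remainder is the bounded resolvent sum
itself. Hence more subtraction enlarges the strip of convergence on one side and costs nothing on
the other. -/
lemma resolventRem_isBigO_zero (N : ℕ) :
    resolventRem N =O[𝓝[>] 0] (fun v : ℝ => v ^ (-(0 : ℝ))) := by
  have h1 : resolventRem N =ᶠ[𝓝[>] 0] resolventSum := by
    filter_upwards [Ioo_mem_nhdsGT one_pos] with v hv
    have hp : ∀ c, powTail c v = 0 := fun c =>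
      Set.indicator_of_notMem (by simpa using hv.2.le) _
    simp [resolventRem, hp]
  have h2 : Tendsto resolventSum (𝓝[>] 0) (𝓝 (resolventSum 0)) :=
    (continuousOn_resolventSum 0 Set.self_mem_Ici).mono_left
      (nhdsWithin_mono _ Set.Ioi_subset_Ici_self)
  simp only [neg_zero, Real.rpow_zero]
  exact h1.trans_isBigO (h2.isBigO_one ℝ)

lemma mellinConvergent_resolventRem {N : ℕ} {s : ℂ} (h0 : 0 < s.re) (h1 : s.re < (N + 2) / 2) :
    MellinConvergent (resolventRem N) s :=
  mellinConvergent_of_isBigO_rpow (locallyIntegrableOn_resolventRem N) (resolventRem_isBigO N) h1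
    (resolventRem_isBigO_zero N) h0

lemma differentiableAt_mellin_resolventRem {N : ℕ} {s : ℂ} (h0 : 0 < s.re)
    (h1 : s.re < (N + 2) / 2) : DifferentiableAt ℂ (mellin (resolventRem N)) s :=
  mellin_differentiableAt_of_isBigO_rpow (locallyIntegrableOn_resolventRem N)
    (resolventRem_isBigO N) h1 (resolventRem_isBigO_zero N) h0

/-- The polar terms of the Mellin transform of the resolvent sum at `1 - σ`. -/
noncomputable def polarTerms (N : ℕ) (σ : ℂ) : ℂ :=
  (1 / 8 / (σ - 1 / 2) ^ 2 + -(Real.log (2 * Real.pi) / 4) / (σ - 1 / 2)) +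
    ∑ j ∈ Finset.range N, (xiCoeff j / 2 : ℂ) / (σ - (-(j / 2)))

/-- The continuation of `∑ (τ ^ 2) ^ (-σ)` to `-N / 2 < re σ < 1`. -/
noncomputable def calZStrip (N : ℕ) (σ : ℂ) : ℂ :=
  sin (Real.pi * σ) / Real.pi * (mellin (resolventRem N) (1 - σ) + polarTerms N σ)

/-- The newly subtracted tail has Mellin transform equal, at 1 − σ, to the simple fraction added to
the polar terms. -/
lemma calZStrip_succ {N : ℕ} {σ : ℂ} (h0 : -(N / 2 : ℝ) < σ.re) (h1 : σ.re < 1) :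
    calZStrip (N + 1) σ = calZStrip N σ := by
  have hs : (1 - σ).re < ((N + 2) / 2 : ℝ) := by rw [sub_re, one_re]; linarith
  have h2 := hasMellin_const_smul (hasMellin_powTail hs).1 (xiCoeff N / 2 : ℂ)
  rw [(hasMellin_powTail hs).2] at h2
  have h3 := (hasMellin_sub (mellinConvergent_resolventRem (N := N)
    (by rw [sub_re, one_re]; linarith) hs) h2.1).2
  rw [h2.2] at h3
  rw [calZStrip, calZStrip, resolventRem_succ, h3, polarTerms, polarTerms, Finset.sum_range_succ,
    smul_eq_mul]
  have : (((N + 2) / 2 : ℝ) : ℂ) - (1 - σ) = σ - (-(N / 2)) := by push_cast; ring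
  rw [this]
  ring

lemma calZStrip_add {N : ℕ} {σ : ℂ} (h0 : -(N / 2 : ℝ) < σ.re) (h1 : σ.re < 1) (k : ℕ) :
    calZStrip (N + k) σ = calZStrip N σ := by
  induction k with
  | zero => rfl
  | succ k ih =>
    rw [← add_assoc, calZStrip_succ _ h1, ih]
    push_cast
    have : (0 : ℝ) ≤ k := Nat.cast_nonneg k
    linarith

lemma calZStrip_zero_eq_tsum {σ : ℂ} (h0 : 1 / 2 < σ.re) (h1 : σ.re < 1) :
    calZStrip 0 σ = ∑' ρ, calZTerm σ ρ := by
  have hs : (1 - σ).re < (1 / 2 : ℝ) := by rw [sub_re, one_re]; linarith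
  have hs' : 0 < (1 - σ).re := by rw [sub_re, one_re]; linarith
  have a1 := hasMellin_const_smul (hasMellin_log_powTail hs).1 (1 / 8 : ℂ)
  have a2 := hasMellin_const_smul (hasMellin_powTail hs).1 (Real.log (2 * Real.pi) / 4 : ℂ)
  have a3 := hasMellin_sub a1.1 a2.1
  have a4 := hasMellin_add (mellinConvergent_resolventRem (N := 0) hs' (by
    push_cast; linarith)) a3.1
  have e : (fun v => resolventRem 0 v + ((1 / 8 : ℂ) • (Real.log v • powTail (1 / 2) v) -
      (Real.log (2 * Real.pi) / 4 : ℂ) • powTail (1 / 2) v)) = resolventSum := by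
    funext v
    simp [resolventRem]
  rw [e] at a4
  have h5 := a4.2
  rw [a3.2, a1.2, a2.2, (hasMellin_log_powTail hs).2, (hasMellin_powTail hs).2] at h5
  rw [mellin_resolventSum h0 h1, h5, calZStrip, polarTerms, Finset.sum_range_zero]
  have : ((1 / 2 : ℝ) : ℂ) - (1 - σ) = σ - 1 / 2 := by push_cast; ring
  rw [this, smul_eq_mul, smul_eq_mul]
  ring

lemma calZStrip_eq_tsum {N : ℕ} {σ : ℂ} (h0 : 1 / 2 < σ.re) (h1 : σ.re < 1) :
    calZStrip N σ = ∑' ρ, calZTerm σ ρ := by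
  rw [← calZStrip_zero_eq_tsum h0 h1, ← calZStrip_add (N := 0) (by simp; linarith) h1 N, zero_add]

lemma calZStrip_eq_calZStrip {N N' : ℕ} {σ : ℂ} (h0 : -(N / 2 : ℝ) < σ.re)
    (h0' : -(N' / 2 : ℝ) < σ.re) (h1 : σ.re < 1) : calZStrip N σ = calZStrip N' σ := by
  rw [← calZStrip_add h0 h1 N', ← calZStrip_add h0' h1 N, add_comm]

end Tail

/-! ### The glued continuation and its Laurent expansions -/

section Continuation

/-- The sum `∑ (τ ^ 2) ^ (-σ)`, continued to the whole plane up to removable singularities. -/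
noncomputable def calZAux (σ : ℂ) : ℂ :=
  if 1 / 2 < σ.re then ∑' ρ, calZTerm σ ρ else calZStrip (⌊-(2 * σ.re)⌋₊ + 1) σ

/-- The index ⌊−2 Re σ⌋₊ + 1 exceeds −2 Re σ, so the strip chosen in the definition contains σ; any
other admissible index gives the same value. -/
lemma calZAux_eq_calZStrip {N : ℕ} {σ : ℂ} (h0 : -(N / 2 : ℝ) < σ.re) (h1 : σ.re < 1) :
    calZAux σ = calZStrip N σ := by
  rw [calZAux]
  split_ifs with h
  · rw [calZStrip_eq_tsum h h1]
  · refine calZStrip_eq_calZStrip ?_ h0 h1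
    have := Nat.lt_floor_add_one (-(2 * σ.re))
    push_cast
    linarith

lemma calZAux_eventuallyEq {N : ℕ} {p : ℂ} (h0 : -(N / 2 : ℝ) < p.re) (h1 : p.re < 1) :
    calZAux =ᶠ[𝓝 p] calZStrip N := by
  filter_upwards [(isOpen_lt continuous_const continuous_re).mem_nhds h0,
    (isOpen_lt continuous_re continuous_const).mem_nhds h1] with σ h2 h3
  exact calZAux_eq_calZStrip h2 h3

lemma analyticAt_calZAux_of_re_gt {p : ℂ} (hp : 1 / 2 < p.re) : AnalyticAt ℂ calZAux p := by
  obtain ⟨r, hr, hrp⟩ := exists_between hp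
  set U : Set ℂ := {σ | r < σ.re} ∩ {σ | |σ.im| < |p.im| + 1} with hU
  have hUo : IsOpen U := (isOpen_lt continuous_const continuous_re).inter
    (isOpen_lt continuous_im.abs continuous_const)
  have hpU : p ∈ U := ⟨hrp, show |p.im| < |p.im| + 1 from lt_add_one _⟩
  have hd : DifferentiableOn ℂ (fun σ => ∑' ρ, calZTerm σ ρ) U := by
    refine differentiableOn_tsum_of_summable_norm (u := fun ρ : UpperZero =>
      Real.exp (Real.pi * (|p.im| + 1)) * (ρ.mult * ‖ρ.tau‖ ^ (-(2 * r))))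
      ((UpperZero.summable_mult_mul_rpow (by linarith)).mul_left _) (fun ρ σ hσ => ?_) hUo
      (fun ρ σ hσ => ?_)
    · refine DifferentiableAt.differentiableWithinAt ?_
      exact (differentiableAt_id.neg.const_cpow (Or.inl (pow_ne_zero 2 ρ.tau_ne_zero))).const_mul _
    · refine (norm_calZTerm_le σ ρ).trans ?_
      have h1 := ρ.one_lt_norm_tau.le
      have h2 : r < σ.re := hσ.1
      have h3 : |σ.im| ≤ |p.im| + 1 := le_of_lt hσ.2
      gcongr
  refine (hd.analyticAt (hUo.mem_nhds hpU)).congr ?_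
  filter_upwards [hUo.mem_nhds hpU] with σ hσ
  rw [calZAux, if_pos (lt_trans hr hσ.1)]

lemma analyticAt_mellin_resolventRem {N : ℕ} {p : ℂ} (h0 : -(N / 2 : ℝ) < p.re) (h1 : p.re < 1) :
    AnalyticAt ℂ (fun σ => mellin (resolventRem N) (1 - σ)) p := by
  have hUo : IsOpen ({σ : ℂ | -(N / 2 : ℝ) < σ.re} ∩ {σ | σ.re < 1}) :=
    (isOpen_lt continuous_const continuous_re).inter (isOpen_lt continuous_re continuous_const)
  refine DifferentiableOn.analyticAt (s := {σ | -(N / 2 : ℝ) < σ.re} ∩ {σ | σ.re < 1})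
    (fun σ hσ => ?_) (hUo.mem_nhds ⟨h0, h1⟩)
  have a1 : -(N / 2 : ℝ) < σ.re := hσ.1
  have a2 : σ.re < 1 := hσ.2
  refine DifferentiableAt.differentiableWithinAt ?_
  exact DifferentiableAt.comp (f := fun σ => 1 - σ) σ
    (differentiableAt_mellin_resolventRem (by rw [sub_re, one_re]; linarith)
      (by rw [sub_re, one_re]; linarith)) (by fun_prop)

lemma analyticAt_sin_pi_div (p : ℂ) :
    AnalyticAt ℂ (fun σ : ℂ => sin (Real.pi * σ) / Real.pi) p := by
  have : Differentiable ℂ (fun σ : ℂ => sin (Real.pi * σ) / Real.pi) := by fun_prop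
  exact this.analyticAt p

lemma deriv_sin_pi_div (p : ℂ) :
    deriv (fun σ : ℂ => sin (Real.pi * σ) / Real.pi) p = cos (Real.pi * p) := by
  have h1 : HasDerivAt (fun σ : ℂ => (Real.pi : ℂ) * σ) Real.pi p := by
    simpa using (hasDerivAt_id p).const_mul (Real.pi : ℂ)
  rw [((h1.csin).div_const (Real.pi : ℂ)).deriv]
  have : (Real.pi : ℂ) ≠ 0 := by exact_mod_cast Real.pi_ne_zero
  field_simp

open Classical in
lemma hasLaurentAt_const_div (d q p : ℂ) :
    ∃ c, HasLaurentAt (fun σ => d / (σ - q)) p 0 (if p = q then d else 0) c := by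
  split_ifs with h
  · subst h
    exact ⟨0, by simpa using hasLaurentAt_pole p 0 d⟩
  · refine ⟨_, AnalyticAt.hasLaurentAt ?_⟩
    exact analyticAt_const.div (by fun_prop) (sub_ne_zero.2 h)

-- The factor sin(πσ)/π has value sin(πp)/π and derivative cos(πp) at p. Where the sine vanishes a
-- simple pole of the bracket is no longer a pole, and cos(πp) times its residue appears in the
-- finite part.
open Classical in
lemma hasLaurentAt_calZAux {N : ℕ} {p c₂ c₁ : ℂ} (h0 : -(N / 2 : ℝ) < p.re) (h1 : p.re < 1)
    (h : ∃ c, HasLaurentAt (fun σ : ℂ => 1 / 8 / (σ - 1 / 2) ^ 2 +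
      -(Real.log (2 * Real.pi) / 4) / (σ - 1 / 2)) p c₂ c₁ c) :
    ∃ c, HasLaurentAt calZAux p (sin (Real.pi * p) / Real.pi * c₂)
      (cos (Real.pi * p) * c₂ + sin (Real.pi * p) / Real.pi * (c₁ + ∑ j ∈ Finset.range N,
        if p = -(j / 2) then (xiCoeff j / 2 : ℂ) else 0))
      (dslope (dslope (fun σ : ℂ => sin (Real.pi * σ) / Real.pi) p) p p * c₂ +
        cos (Real.pi * p) * (c₁ + ∑ j ∈ Finset.range N,
          if p = -(j / 2) then (xiCoeff j / 2 : ℂ) else 0) + sin (Real.pi * p) / Real.pi * c) := by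
  obtain ⟨c, hc⟩ := h
  choose d hd using fun j : ℕ => hasLaurentAt_const_div (xiCoeff j / 2 : ℂ) (-(j / 2)) p
  have h2 := hc.add (HasLaurentAt.sum (Finset.range N) fun j _ => hd j)
  have h3 := (AnalyticAt.hasLaurentAt (analyticAt_mellin_resolventRem h0 h1)).add h2
  have h4 := h3.analytic_mul (analyticAt_sin_pi_div p)
  simp only [Finset.sum_const_zero, zero_add, add_zero] at h4
  rw [deriv_sin_pi_div] at h4
  exact ⟨_, h4.congr ((calZAux_eventuallyEq h0 h1).symm.filter_mono nhdsWithin_le_nhds)⟩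

end Continuation

/-! ### Coefficients of the expansion in terms of Bernoulli and Euler numbers -/

section Coefficients

lemma eulerNumber_eq_zero_of_odd {n : ℕ} (hn : Odd n) : eulerNumber n = 0 := by
  set C : PowerSeries ℚ := PowerSeries.mk fun k => if Even k then ((k.factorial : ℚ))⁻¹ else 0
    with hC
  have h0 : PowerSeries.constantCoeff C ≠ 0 := by
    rw [← PowerSeries.coeff_zero_eq_constantCoeff_apply, hC, PowerSeries.coeff_mk]
    simp
  have hCr : PowerSeries.evalNegHom C = C := by
    ext k
    rw [PowerSeries.evalNegHom, PowerSeries.coeff_rescale, hC, PowerSeries.coeff_mk]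
    split_ifs with h
    · rw [h.neg_one_pow, one_mul]
    · rw [mul_zero]
  have h1 : PowerSeries.evalNegHom C⁻¹ = C⁻¹ := by
    have h2 : PowerSeries.evalNegHom C⁻¹ * C = 1 := by
      conv_lhs => rw [← hCr]
      rw [← map_mul, hCr, PowerSeries.inv_mul_cancel _ h0, map_one]
    rw [PowerSeries.eq_inv_iff_mul_eq_one h0, h2]
  have h3 := congrArg (PowerSeries.coeff n) h1
  rw [PowerSeries.evalNegHom, PowerSeries.coeff_rescale, hn.neg_one_pow] at h3
  rw [eulerNumber, ← hC]
  have : PowerSeries.coeff n C⁻¹ = 0 := by linarith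
  rw [this, mul_zero]

/-- At even index the two geometric terms reinforce each other and the Bernoulli term drops out: odd
Bernoulli numbers vanish, and B₁ comes with the factor 2 − 2 = 0. -/
lemma xiCoeff_two_mul (m : ℕ) :
    (xiCoeff (2 * m) : ℂ) / 2 = 2 ^ (-2 * (m : ℤ)) * (1 - (eulerNumber (2 * m) : ℂ) / 8) := by
  have hB : ((2 : ℝ) - 2 ^ (2 * m + 1)) * (bernoulli (2 * m + 1) : ℝ) = 0 := by
    rcases Nat.eq_zero_or_pos m with rfl | hm
    · norm_num
    · rw [bernoulli_eq_zero_of_odd ⟨m, rfl⟩ (by omega)]; simp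
  have hf : ((2 * m).factorial : ℝ) ≠ 0 := by exact_mod_cast Nat.factorial_ne_zero _
  have h4 : ((4 : ℝ) ^ m) ≠ 0 := by positivity
  have e1 : (1 / 2 : ℝ) ^ (2 * m) = 1 / 4 ^ m := by
    rw [div_pow, one_pow, show (4 : ℝ) = 2 ^ 2 by norm_num, ← pow_mul]
  have e2 : (4 : ℝ) ^ (2 * m + 1) = 4 * 4 ^ m * 4 ^ m := by
    rw [show 2 * m + 1 = m + m + 1 by ring, pow_add, pow_add]; ring
  have e3 : (2 : ℝ) ^ (2 * m) = 4 ^ m := by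
    rw [show (4 : ℝ) = 2 ^ 2 by norm_num, ← pow_mul]
  have h : xiCoeff (2 * m) / 2 = (4 ^ m)⁻¹ * (1 - (eulerNumber (2 * m) : ℝ) / 8) := by
    rw [xiCoeff, gaussCoeff, hB, zero_div, neg_zero, zero_sub, (even_two_mul m).neg_pow, e1, e2, e3]
    field_simp
    ring
  rw [← ofReal_ofNat, ← ofReal_div, h]
  push_cast
  rw [zpow_mul, zpow_natCast, ← inv_pow]
  norm_num

/-- At odd index the geometric terms cancel and the Euler number vanishes, so only the Bernoulli
term remains. -/
lemma neg_one_pow_mul_xiCoeff (m : ℕ) :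
    (-1) ^ (m + 1) / Real.pi * ((xiCoeff (2 * m + 1) : ℂ) / 2) = calR (m + 1) := by
  have hf : ((2 * m + 1).factorial : ℝ) ≠ 0 := by exact_mod_cast Nat.factorial_ne_zero _
  have h4 : ((4 : ℝ) ^ m) ≠ 0 := by positivity
  have hm : ((m : ℝ) + 1) ≠ 0 := by positivity
  have h : xiCoeff (2 * m + 1) =
      (1 - 2 ^ (1 - 2 * ((m + 1 : ℕ) : ℤ))) * (bernoulli (2 * (m + 1)) : ℝ) / (4 * (m + 1)) := by
    have e : (2 : ℝ) ^ (1 - 2 * ((m + 1 : ℕ) : ℤ)) = 2 / (4 * 4 ^ m) := by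
      rw [zpow_sub₀ two_ne_zero, zpow_mul, zpow_natCast, pow_succ]
      norm_num
      ring
    have e1 : (2 : ℝ) ^ (2 * m + 1) = 2 * 4 ^ m := by rw [pow_succ, pow_mul]; norm_num; ring
    have e2 : (2 : ℝ) ^ (2 * m + 1 + 1) = 4 * 4 ^ m := by rw [pow_succ, e1]; ring
    have e3 : (4 : ℝ) ^ (2 * m + 1 + 1) = 16 * 4 ^ m * 4 ^ m := by
      rw [show 2 * m + 1 + 1 = m + m + 2 by ring, pow_add, pow_add]; ring
    have e4 : ((2 * m + 1 + 1).factorial : ℝ) = 2 * (m + 1) * (2 * m + 1).factorial := by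
      rw [Nat.factorial_succ]; push_cast; ring
    rw [e, xiCoeff, gaussCoeff, eulerNumber_eq_zero_of_odd ⟨m, rfl⟩, Rat.cast_zero, zero_div,
      sub_zero, (show Odd (2 * m + 1) from ⟨m, rfl⟩).neg_pow, neg_add_cancel, zero_add,
      e1, e2, e3, e4, show 2 * m + 1 + 1 = 2 * (m + 1) by ring]
    field_simp
    ring
  have hpi : (Real.pi : ℂ) ≠ 0 := by exact_mod_cast Real.pi_ne_zero
  have hm' : ((m : ℂ) + 1) ≠ 0 := by exact_mod_cast hm
  rw [calR, h]
  push_cast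
  field_simp
  ring

end Coefficients

/-! ### Poles, residues and special values of 𝒵 -/

section CalZ

lemma HasLaurentAt.of_eq {F : ℂ → ℂ} {p c₂ c₁ c₀ d₂ d₁ d₀ : ℂ} (h : HasLaurentAt F p c₂ c₁ c₀)
    (h₂ : c₂ = d₂) (h₁ : c₁ = d₁) (h₀ : c₀ = d₀) : HasLaurentAt F p d₂ d₁ d₀ := by
  subst h₂ h₁ h₀
  exact h

lemma sin_nat_mul_pi_add (n : ℕ) (x : ℂ) : sin (x + n * Real.pi) = (-1) ^ n * sin x :=
  Complex.sin_antiperiodic.add_nat_mul_eq n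

lemma cos_nat_mul_pi_add (n : ℕ) (x : ℂ) : cos (x + n * Real.pi) = (-1) ^ n * cos x :=
  Complex.cos_antiperiodic.add_nat_mul_eq n

lemma hasLaurentAt_calZAux_half : ∃ c, HasLaurentAt calZAux (1 / 2)
    (1 / (8 * Real.pi)) (-(Real.log (2 * Real.pi)) / (4 * Real.pi)) c := by
  have hpi : (Real.pi : ℂ) ≠ 0 := by exact_mod_cast Real.pi_ne_zero
  obtain ⟨c, hc⟩ := hasLaurentAt_calZAux (N := 0) (p := 1 / 2) (by norm_num) (by norm_num)
    ⟨0, hasLaurentAt_pole (1 / 2) (1 / 8) (-(Real.log (2 * Real.pi) / 4))⟩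
  have h1 : (Real.pi : ℂ) * (1 / 2) = Real.pi / 2 := by ring
  rw [h1, Complex.sin_pi_div_two, Complex.cos_pi_div_two] at hc
  exact ⟨_, hc.of_eq (by field_simp) (by simp; field_simp) rfl⟩

/-- The terms of the polar part at `1 / 2` are analytic elsewhere. -/
lemma exists_hasLaurentAt_half_pole {p : ℂ} (hp : p ≠ 1 / 2) (d₂ d₁ : ℂ) :
    ∃ c, HasLaurentAt (fun σ : ℂ => d₂ / (σ - 1 / 2) ^ 2 + d₁ / (σ - 1 / 2)) p 0 0 c := by
  refine ⟨_, AnalyticAt.hasLaurentAt ?_⟩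
  have h := sub_ne_zero.2 hp
  have a1 : AnalyticAt ℂ (fun σ : ℂ => σ - 1 / 2) p := by fun_prop
  exact (analyticAt_const.div (a1.pow 2) (pow_ne_zero 2 h)).add (analyticAt_const.div a1 h)

/-- Common source of residues and special values: for odd j the sine is ±1 and gives a residue, for
even j it is 0 and the cosine gives a value. -/
lemma hasLaurentAt_calZAux_neg_half (j : ℕ) : ∃ c, HasLaurentAt calZAux (-(j / 2)) 0
    (sin (Real.pi * -(j / 2)) / Real.pi * (xiCoeff j / 2))
    (cos (Real.pi * -(j / 2)) * (xiCoeff j / 2) + sin (Real.pi * -(j / 2)) / Real.pi * c) := by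
  have hre : (-((j : ℂ) / 2)).re = -(j / 2 : ℝ) := by
    rw [show -((j : ℂ) / 2) = ((-(j / 2 : ℝ) : ℝ) : ℂ) by push_cast; rfl, ofReal_re]
  have hj : (0 : ℝ) ≤ j := Nat.cast_nonneg j
  have hne : -((j : ℂ) / 2) ≠ 1 / 2 := by
    intro h
    have := congrArg re h
    rw [hre] at this
    norm_num at this
    linarith
  obtain ⟨c, hc⟩ := hasLaurentAt_calZAux (N := j + 1) (p := -(j / 2))
    (by rw [hre]; push_cast; linarith) (by rw [hre]; linarith)
    (exists_hasLaurentAt_half_pole hne _ _)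
  have hs : ∑ i ∈ Finset.range (j + 1),
      (if -((j : ℂ) / 2) = -(i / 2) then (xiCoeff i / 2 : ℂ) else 0) = xiCoeff j / 2 := by
    rw [Finset.sum_eq_single j]
    · simp
    · intro i _ hij
      rw [if_neg]
      intro h
      refine hij ?_
      have h2 : (j : ℂ) = i := by linear_combination -2 * h
      exact_mod_cast h2.symm
    · simp
  rw [hs] at hc
  simp only [mul_zero, zero_add] at hc
  exact ⟨_, hc⟩

lemma exists_hasLaurentAt_calZAux {p : ℂ} (hp : ∀ m : ℕ, p ≠ 1 / 2 - m) :
    ∃ c, HasLaurentAt calZAux p 0 0 c := by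
  rcases lt_or_ge (1 / 2) p.re with h | h
  · exact ⟨_, AnalyticAt.hasLaurentAt (analyticAt_calZAux_of_re_gt h)⟩
  · by_cases hj : ∃ j : ℕ, p = -(j / 2)
    · obtain ⟨j, rfl⟩ := hj
      obtain ⟨m, rfl | rfl⟩ := Nat.even_or_odd' j
      · obtain ⟨c, hc⟩ := hasLaurentAt_calZAux_neg_half (2 * m)
        have e : sin (Real.pi * -(((2 * m : ℕ) : ℂ) / 2)) = 0 := by
          rw [show (Real.pi : ℂ) * -(((2 * m : ℕ) : ℂ) / 2) = -(m * Real.pi) by push_cast; ring,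
            Complex.sin_neg, Complex.sin_nat_mul_pi, neg_zero]
        simp only [e, zero_div, zero_mul] at hc
        exact ⟨_, hc⟩
      · exact absurd (by push_cast; ring) (hp (m + 1))
    · push Not at hj
      have h0 := Nat.lt_floor_add_one (-(2 * p.re))
      obtain ⟨c, hc⟩ := hasLaurentAt_calZAux (N := ⌊-(2 * p.re)⌋₊ + 1) (p := p)
        (by push_cast; linarith) (by linarith)
        (exists_hasLaurentAt_half_pole (by simpa using hp 0) _ _)
      rw [Finset.sum_eq_zero fun j _ => if_neg (hj j)] at hc
      simp only [mul_zero, zero_add, add_zero] at hc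
      exact ⟨_, hc⟩

/-- The continuation of `∑ (τ ^ 2) ^ (-σ)`. -/
noncomputable def calZ : ℂ → ℂ := regularized calZAux

lemma calZ_eq_tsum {σ : ℂ} (hσ : 1 / 2 < σ.re) : calZ σ = ∑' ρ, calZTerm σ ρ := by
  rw [calZ, AnalyticAt.regularized_eq (analyticAt_calZAux_of_re_gt hσ), calZAux, if_pos hσ]

lemma hasSum_calZ {σ : ℂ} (hσ : 1 / 2 < σ.re) : HasSum (calZTerm σ) (calZ σ) := by
  rw [calZ_eq_tsum hσ]
  exact (summable_calZTerm hσ).hasSum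

lemma analyticAt_calZ {σ : ℂ} (hσ : ∀ m : ℕ, σ ≠ 1 / 2 - m) : AnalyticAt ℂ calZ σ := by
  obtain ⟨c, hc⟩ := exists_hasLaurentAt_calZAux hσ
  exact hc.analyticAt_regularized

lemma hasLaurentAt_calZ_half : ∃ c, HasLaurentAt calZ (1 / 2)
    (1 / (8 * Real.pi)) (-(Real.log (2 * Real.pi)) / (4 * Real.pi)) c :=
  hasLaurentAt_calZAux_half.imp fun _ h => h.regularized

lemma hasLaurentAt_calZ_half_sub {m : ℕ} (hm : 1 ≤ m) :
    ∃ c, HasLaurentAt calZ (1 / 2 - m) 0 (calR m) c := by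
  obtain ⟨m, rfl⟩ := Nat.exists_eq_add_of_le' hm
  obtain ⟨c, hc⟩ := hasLaurentAt_calZAux_neg_half (2 * m + 1)
  have e : sin (Real.pi * -(((2 * m + 1 : ℕ) : ℂ) / 2)) = (-1) ^ (m + 1) := by
    rw [show (Real.pi : ℂ) * -(((2 * m + 1 : ℕ) : ℂ) / 2) = -(Real.pi / 2 + m * Real.pi) by
      push_cast; ring, Complex.sin_neg, sin_nat_mul_pi_add, Complex.sin_pi_div_two]
    ring
  rw [e, neg_one_pow_mul_xiCoeff] at hc
  rw [show -(((2 * m + 1 : ℕ) : ℂ) / 2) = 1 / 2 - ((m + 1 : ℕ) : ℂ) by push_cast; ring] at hc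
  exact ⟨_, hc.regularized⟩

lemma hasLaurentAt_calZAux_neg_nat (m : ℕ) : HasLaurentAt calZAux (-m) 0 0
    ((-1) ^ m * 2 ^ (-2 * (m : ℤ)) * (1 - (eulerNumber (2 * m) : ℂ) / 8)) := by
  obtain ⟨c, hc⟩ := hasLaurentAt_calZAux_neg_half (2 * m)
  have e0 : (Real.pi : ℂ) * -(((2 * m : ℕ) : ℂ) / 2) = -(m * Real.pi) := by push_cast; ring
  have e : sin (-(m * Real.pi : ℂ)) = 0 := by
    rw [Complex.sin_neg, Complex.sin_nat_mul_pi, neg_zero]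
  have e' : cos (-(m * Real.pi : ℂ)) = (-1) ^ m := by
    rw [Complex.cos_neg, ← zero_add ((m : ℂ) * Real.pi), cos_nat_mul_pi_add,
      Complex.cos_zero, mul_one]
  rw [e0, e, e', xiCoeff_two_mul] at hc
  simp only [zero_div, zero_mul, add_zero] at hc
  rw [← mul_assoc] at hc
  convert! hc using 1
  push_cast; ring

lemma calZ_neg_nat (m : ℕ) :
    calZ (-m) = (-1) ^ m * 2 ^ (-2 * (m : ℤ)) * (1 - (eulerNumber (2 * m) : ℂ) / 8) :=
  (hasLaurentAt_calZAux_neg_nat m).regularized_eq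

end CalZ

/-! ### Binomial coefficients with complex upper entry -/

section Binomial

lemma choose_eq_prod_div (z : ℂ) (k : ℕ) :
    Ring.choose z k = (∏ i ∈ Finset.range k, (z - i)) / k.factorial := by
  rw [Ring.choose_eq_smul, smul_eq_mul, div_eq_inv_mul]
  congr 1
  induction k with
  | zero => simp
  | succ k ih =>
    rw [descPochhammer_succ_right, Polynomial.smeval_mul, ih, Finset.prod_range_succ]
    simp [Polynomial.smeval_sub, Polynomial.smeval_X, Polynomial.smeval_natCast]

lemma differentiable_choose_neg (k : ℕ) : Differentiable ℂ fun s : ℂ => Ring.choose (-s) k := by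
  simp only [choose_eq_prod_div]
  fun_prop

/-- Each factor satisfies |z − i| ≤ S + 1 + i, and the product of these bounds is a rising
factorial. The bound is uniform in z, as needed for analyticity in the exponent. -/
lemma norm_choose_le {z : ℂ} {S : ℕ} (hz : ‖z‖ ≤ S + 1) (k : ℕ) :
    ‖Ring.choose z k‖ ≤ (k + S).choose S := by
  rw [choose_eq_prod_div, norm_div, norm_prod, Complex.norm_natCast,
    div_le_iff₀ (by exact_mod_cast Nat.factorial_pos k)]
  have h : (((k + S).choose S : ℕ) : ℝ) * k.factorial =
      ∏ i ∈ Finset.range k, ((S : ℝ) + 1 + i) := by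
    have h1 : (k + S).choose S * k.factorial = (S + 1).ascFactorial k := by
      rw [Nat.ascFactorial_eq_factorial_mul_choose, mul_comm, add_comm k S, Nat.choose_symm_add]
    rw [← Nat.cast_mul, h1, Nat.ascFactorial_eq_prod_range]
    push_cast
    rfl
  rw [h]
  refine Finset.prod_le_prod (fun _ _ => norm_nonneg _) fun i _ => ?_
  calc ‖z - i‖ ≤ ‖z‖ + ‖(i : ℂ)‖ := norm_sub_le _ _
    _ ≤ _ := by rw [Complex.norm_natCast]; linarith

lemma hasSum_choose_mul_pow (c : ℂ) {z : ℂ} (hz : ‖z‖ < 1) :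
    HasSum (fun k : ℕ => Ring.choose c k * z ^ k) ((1 + z) ^ c) := by
  have h := (Complex.one_add_cpow_hasFPowerSeriesOnBall_zero (a := c)).hasSum
    (y := z) (by simpa [← ofReal_norm] using hz)
  simpa [binomialSeries, mul_comm] using h

/-- A bound for the remainder of the binomial series that is locally uniform in the exponent. -/
lemma norm_one_add_cpow_sub_sum_le (S N : ℕ) : ∃ C : ℝ, 0 ≤ C ∧ ∀ c z : ℂ, ‖c‖ ≤ S + 1 →
    ‖z‖ ≤ 1 / 2 →
    ‖(1 + z) ^ c - ∑ k ∈ Finset.range N, Ring.choose c k * z ^ k‖ ≤ C * ‖z‖ ^ N := by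
  have hs : Summable fun k : ℕ => ((k + S).choose S : ℝ) * (1 / 2) ^ k :=
    summable_choose_mul_geometric_of_norm_lt_one S (by norm_num)
  have hs' := (summable_nat_add_iff N).2 hs
  refine ⟨2 ^ N * ∑' k : ℕ, ((k + N + S).choose S : ℝ) * (1 / 2) ^ (k + N),
    mul_nonneg (by positivity) (tsum_nonneg fun _ => by positivity), fun c z hc hz => ?_⟩
  have h1 := hasSum_choose_mul_pow c (z := z) (by linarith)
  have h2 := (hasSum_nat_add_iff' N).2 h1
  rw [← h2.tsum_eq]
  have h3 : ∀ k : ℕ, ‖Ring.choose c (k + N) * z ^ (k + N)‖ ≤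
      2 ^ N * ‖z‖ ^ N * (((k + N + S).choose S : ℝ) * (1 / 2) ^ (k + N)) := by
    intro k
    rw [norm_mul, norm_pow, pow_add, pow_add]
    calc ‖Ring.choose c (k + N)‖ * (‖z‖ ^ k * ‖z‖ ^ N)
        ≤ ((k + N + S).choose S : ℝ) * ((1 / 2) ^ k * ‖z‖ ^ N) := by
          gcongr
          exact norm_choose_le hc _
      _ = _ := by
          have : (2 : ℝ) ^ N * (1 / 2) ^ N = 1 := by rw [← mul_pow]; norm_num
          linear_combination (-(((k + N + S).choose S : ℝ) * (1 / 2) ^ k * ‖z‖ ^ N)) * this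
  refine (tsum_of_norm_bounded (hs'.mul_left _).hasSum h3).trans (le_of_eq ?_)
  rw [tsum_mul_left]
  ring

lemma choose_neg_one_sub {n : ℕ} (hn : 1 ≤ n) (k : ℕ) :
    Ring.choose (-(1 - n : ℂ)) k = ((n - 1).choose k : ℂ) := by
  have : (-(1 - n : ℂ)) = ((n - 1 : ℕ) : ℂ) := by push_cast [Nat.cast_sub hn]; ring
  rw [this, Ring.choose_natCast]

/-- At s = 1 − n only the last factor (−s − (n − 1))/n vanishes, and its cofactor is C(n−1, n−1) =
1. Against the double pole of 𝒵 this derivative produces the term −aⁿ/(4πn) of rₙ. -/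
lemma deriv_choose_neg_one_sub {n : ℕ} (hn : 1 ≤ n) :
    deriv (fun s : ℂ => Ring.choose (-s) n) (1 - n) = -1 / n := by
  obtain ⟨m, rfl⟩ := Nat.exists_eq_add_of_le' hn
  have e : (fun s : ℂ => Ring.choose (-s) (m + 1)) =
      fun s : ℂ => Ring.choose (-s) m * ((-s - m) / (m + 1)) := by
    funext s
    rw [choose_eq_prod_div, choose_eq_prod_div, Finset.prod_range_succ, Nat.factorial_succ]
    have h1 : ((m : ℂ) + 1) ≠ 0 := by exact_mod_cast m.succ_ne_zero
    have h2 : (m.factorial : ℂ) ≠ 0 := by exact_mod_cast m.factorial_ne_zero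
    push_cast
    field_simp
  have h3 : HasDerivAt (fun s : ℂ => (-s - m) / (m + 1)) (-1 / (m + 1)) (1 - ((m + 1 : ℕ) : ℂ)) :=
    (((hasDerivAt_id _).neg).sub_const _).div_const _
  have h4 := (differentiable_choose_neg m (1 - ((m + 1 : ℕ) : ℂ))).hasDerivAt.mul h3
  rw [e]
  refine h4.deriv.trans ?_
  rw [choose_neg_one_sub hn]
  push_cast
  simp

end Binomial

/-! ### Principal powers of τ and τ + a -/

section Powers

lemma mul_cpow_of_arg {x y : ℂ} (hx : x ≠ 0) (hy : y ≠ 0)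
    (h : x.arg + y.arg ∈ Set.Ioc (-Real.pi) Real.pi) (s : ℂ) : (x * y) ^ s = x ^ s * y ^ s := by
  rw [cpow_def_of_ne_zero (mul_ne_zero hx hy), cpow_def_of_ne_zero hx, cpow_def_of_ne_zero hy,
    (log_mul_eq_add_log_iff hx hy).2 h, add_mul, Complex.exp_add]

lemma UpperZero.abs_arg_tau_lt (ρ : UpperZero) : |ρ.tau.arg| < Real.pi / 2 :=
  abs_arg_lt_pi_div_two_iff.2 (Or.inl (by linarith [ρ.one_lt_tau_re]))

lemma UpperZero.tau_sq_cpow (ρ : UpperZero) (σ : ℂ) : (ρ.tau ^ 2) ^ (-σ) = ρ.tau ^ (-(2 * σ)) := by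
  have h := abs_lt.1 ρ.abs_arg_tau_lt
  rw [← cpow_nat_mul' (n := 2) (by push_cast; linarith) (by push_cast; linarith)]
  congr 1
  push_cast
  ring

lemma UpperZero.norm_tau_cpow_le (ρ : UpperZero) (s : ℂ) :
    ‖ρ.tau ^ (-s)‖ ≤ ‖ρ.tau‖ ^ (-s.re) * Real.exp (Real.pi * |s.im|) :=
  norm_cpow_neg_le_of_re_pos (by linarith [ρ.one_lt_tau_re]) s

/-- Both τ and 1 + a/τ have argument in (−π/2, π/2), so the power of their product splits. -/
lemma UpperZero.tau_add_cpow {a : ℂ} {ρ : UpperZero} (h : 2 * ‖a‖ ≤ ‖ρ.tau‖) (s : ℂ) :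
    (ρ.tau + a) ^ s = ρ.tau ^ s * (1 + a / ρ.tau) ^ s := by
  have h0 := ρ.tau_ne_zero
  have hz : ‖a / ρ.tau‖ ≤ 1 / 2 := by
    rw [norm_div, div_le_iff₀ (norm_pos_iff.2 h0)]
    linarith
  have hre : 0 < (1 + a / ρ.tau).re := by
    have := (abs_le.1 ((abs_re_le_norm (a / ρ.tau)).trans hz)).1
    rw [add_re, one_re]
    linarith
  have h1 : (1 + a / ρ.tau) ≠ 0 := by
    intro h
    rw [h, zero_re] at hre
    exact lt_irrefl _ hre
  have a1 := abs_lt.1 ρ.abs_arg_tau_lt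
  have a2 := abs_lt.1 (abs_arg_lt_pi_div_two_iff.2 (Or.inl hre))
  rw [← mul_cpow_of_arg h0 h1 ⟨by linarith, by linarith⟩]
  congr 1
  field_simp

end Powers

/-! ### Continuation of the shifted sum by binomial expansion in a/τ -/

section Shift

lemma hasSum_tau_cpow {s : ℂ} (hs : 1 < s.re) :
    HasSum (fun ρ : UpperZero => (ρ.mult : ℂ) * ρ.tau ^ (-s)) (calZ (s / 2)) := by
  have h2 : (s / 2).re = s.re / 2 := by simp
  have h := hasSum_calZ (σ := s / 2) (by rw [h2]; linarith)
  convert! h using 2 with ρ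
  rw [calZTerm, ρ.zeroMult_eq, ρ.tau_sq_cpow]
  congr 3
  ring

/-- The terms of `∑ (τ + a) ^ (-s)`, minus `N` terms of their expansion in powers of `a`. -/
noncomputable def shiftRem (N : ℕ) (a s : ℂ) (ρ : UpperZero) : ℂ :=
  ρ.mult * ((ρ.tau + a) ^ (-s) -
    ∑ k ∈ Finset.range N, Ring.choose (-s) k * a ^ k * ρ.tau ^ (-(s + k)))

lemma shiftRem_eq_succ_add (N : ℕ) (a s : ℂ) (ρ : UpperZero) : shiftRem N a s ρ =
    shiftRem (N + 1) a s ρ + Ring.choose (-s) N * a ^ N * (ρ.mult * ρ.tau ^ (-(s + N))) := by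
  rw [shiftRem, shiftRem, Finset.sum_range_succ]
  ring

/-- After factoring out τ^(-s) this is the binomial remainder in a/τ, which gains |τ|^(-N),
uniformly for s in a disc. -/
lemma norm_shiftRem_le (S N : ℕ) : ∃ C : ℝ, 0 ≤ C ∧ ∀ (a s : ℂ) (ρ : UpperZero), ‖s‖ ≤ S + 1 →
    2 * ‖a‖ ≤ ‖ρ.tau‖ → ‖shiftRem N a s ρ‖ ≤
      C * ‖a‖ ^ N * Real.exp (Real.pi * |s.im|) * (ρ.mult * ‖ρ.tau‖ ^ (-(s.re + N))) := by
  obtain ⟨C, hC, hb⟩ := norm_one_add_cpow_sub_sum_le S N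
  refine ⟨C, hC, fun a s ρ hs ha => ?_⟩
  have h0 := ρ.tau_ne_zero
  have hn0 : 0 < ‖ρ.tau‖ := norm_pos_iff.2 h0
  have hz : ‖a / ρ.tau‖ ≤ 1 / 2 := by
    rw [norm_div, div_le_iff₀ hn0]
    linarith
  have h := hb (-s) (a / ρ.tau) (by rwa [norm_neg]) hz
  have e : shiftRem N a s ρ = ρ.mult * (ρ.tau ^ (-s) * ((1 + a / ρ.tau) ^ (-s) -
      ∑ k ∈ Finset.range N, Ring.choose (-s) k * (a / ρ.tau) ^ k)) := by
    rw [shiftRem, UpperZero.tau_add_cpow ha, mul_sub (ρ.tau ^ (-s)), Finset.mul_sum]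
    refine congrArg (fun w => (ρ.mult : ℂ) * (_ - w)) (Finset.sum_congr rfl fun k _ => ?_)
    rw [neg_add, cpow_add _ _ h0, cpow_neg _ (k : ℂ), cpow_natCast, div_pow]
    field_simp
  rw [e, norm_mul, norm_mul, Complex.norm_natCast]
  have e2 : ‖ρ.tau‖ ^ (-(s.re + N)) = ‖ρ.tau‖ ^ (-s.re) / ‖ρ.tau‖ ^ N := by
    rw [neg_add, Real.rpow_add hn0, Real.rpow_neg hn0.le (N : ℝ), Real.rpow_natCast]
    rfl
  rw [norm_div, div_pow] at h
  calc _ ≤ (ρ.mult : ℝ) * ((‖ρ.tau‖ ^ (-s.re) * Real.exp (Real.pi * |s.im|)) *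
        (C * (‖a‖ ^ N / ‖ρ.tau‖ ^ N))) := by
        gcongr
        exact ρ.norm_tau_cpow_le s
    _ = _ := by rw [e2]; ring

lemma summable_shiftRem {N : ℕ} (a : ℂ) {s : ℂ} (hs : 1 - N < s.re) :
    Summable (shiftRem N a s) := by
  obtain ⟨S, hS⟩ := exists_nat_ge ‖s‖
  obtain ⟨C, hC, hb⟩ := norm_shiftRem_le S N
  refine Summable.of_norm_bounded_eventually
    ((UpperZero.summable_mult_mul_rpow (r := s.re + N) (by linarith)).mul_left
      (C * ‖a‖ ^ N * Real.exp (Real.pi * |s.im|))) ?_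
  refine (UpperZero.finite_norm_tau_le (2 * ‖a‖)).subset fun ρ hρ => ?_
  by_contra h
  have h' : 2 * ‖a‖ < ‖ρ.tau‖ := not_le.1 h
  exact hρ (hb a s ρ (by linarith) h'.le)

lemma differentiable_shiftRem {N : ℕ} {a : ℂ} {ρ : UpperZero} (h : ρ.tau + a ≠ 0) :
    Differentiable ℂ fun s => shiftRem N a s ρ := by
  have h1 : Differentiable ℂ fun s : ℂ => (ρ.tau + a) ^ (-s) :=
    differentiable_id.neg.const_cpow (Or.inl h)
  have h2 : ∀ k : ℕ, Differentiable ℂ fun s : ℂ => ρ.tau ^ (-(s + k)) := fun k =>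
    (differentiable_id.add_const _).neg.const_cpow (Or.inl ρ.tau_ne_zero)
  have h3 : Differentiable ℂ fun s : ℂ =>
      ∑ k ∈ Finset.range N, Ring.choose (-s) k * a ^ k * ρ.tau ^ (-(s + k)) :=
    Differentiable.fun_sum fun k _ => ((differentiable_choose_neg k).mul_const _).mul (h2 k)
  exact (h1.sub h3).const_mul _

lemma analyticAt_tsum_shiftRem {N : ℕ} {a p : ℂ} (ha : ∀ ρ : UpperZero, ρ.tau + a ≠ 0)
    (hp : 1 - N < p.re) : AnalyticAt ℂ (fun s => ∑' ρ, shiftRem N a s ρ) p := by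
  obtain ⟨S, hS⟩ := exists_nat_ge ‖p‖
  obtain ⟨C, hC, hb⟩ := norm_shiftRem_le S N
  obtain ⟨r, hr, hrp⟩ := exists_between hp
  set U : Set ℂ := {s | 1 - N < s.re} ∩ ({s | r < s.re} ∩ ({s | |s.im| < |p.im| + 1} ∩
    {s | ‖s‖ < S + 1})) with hU
  have hUo : IsOpen U := (isOpen_lt continuous_const continuous_re).inter
    ((isOpen_lt continuous_const continuous_re).inter
    ((isOpen_lt continuous_im.abs continuous_const).inter
    (isOpen_lt continuous_norm continuous_const)))
  have hpU : p ∈ U := ⟨hp, hrp, show |p.im| < |p.im| + 1 from lt_add_one _,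
    show ‖p‖ < S + 1 by linarith⟩
  -- The finitely many zeros where a/τ is not small contribute entire terms; over the rest the
  -- convergence is locally uniform.
  set T := UpperZero.upTo (2 * ‖a‖)
  have hd : DifferentiableOn ℂ (fun s => ∑' ρ : {ρ // ρ ∉ T}, shiftRem N a s ρ) U := by
    refine differentiableOn_tsum_of_summable_norm (u := fun ρ : {ρ // ρ ∉ T} =>
      C * ‖a‖ ^ N * Real.exp (Real.pi * (|p.im| + 1)) *
        ((ρ : UpperZero).mult * ‖(ρ : UpperZero).tau‖ ^ (-(r + N))))
      (((UpperZero.summable_mult_mul_rpow (r := r + N) (by linarith)).mul_left _).subtype _)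
      (fun ρ => (differentiable_shiftRem (ha ρ)).differentiableOn) hUo (fun ρ s hs => ?_)
    have h1 := (ρ : UpperZero).one_lt_norm_tau.le
    have h2 : r < s.re := hs.2.1
    have h3 : |s.im| ≤ |p.im| + 1 := le_of_lt hs.2.2.1
    have h4 : ‖s‖ < S + 1 := hs.2.2.2
    have h5 : 2 * ‖a‖ < ‖(ρ : UpperZero).tau‖ :=
      not_le.1 fun h => ρ.2 (UpperZero.mem_upTo.2 h)
    refine (hb a s ρ h4.le h5.le).trans ?_
    gcongr
  have hf : AnalyticAt ℂ (fun s => ∑ ρ ∈ T, shiftRem N a s ρ) p :=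
    Differentiable.analyticAt
      (Differentiable.fun_sum fun ρ _ => differentiable_shiftRem (ha ρ)) p
  refine (hf.add (hd.analyticAt (hUo.mem_nhds hpU))).congr ?_
  filter_upwards [hUo.mem_nhds hpU] with s hs
  exact (summable_shiftRem a hs.1).sum_add_tsum_subtype_compl T

/-- The continuation of `∑ (τ + a) ^ (-s)` to `1 - N < re s`. -/
noncomputable def shiftStrip (N : ℕ) (a s : ℂ) : ℂ :=
  ∑ k ∈ Finset.range N, Ring.choose (-s) k * a ^ k * calZ ((s + k) / 2) +
    ∑' ρ, shiftRem N a s ρ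

/-- Since Re s + N > 1, the extra binomial term may be summed over the zeros, and its sum is a value
of 𝒵. -/
lemma shiftStrip_succ {N : ℕ} {a s : ℂ} (hs : 1 - N < s.re) :
    shiftStrip (N + 1) a s = shiftStrip N a s := by
  have h1 := hasSum_tau_cpow (s := s + N) (by simp; linarith)
  have h2 := (summable_shiftRem (N := N + 1) a (s := s) (by push_cast; linarith)).hasSum.add
    (h1.mul_left (Ring.choose (-s) N * a ^ N))
  have h3 : ∑' ρ, shiftRem N a s ρ = _ :=
    (h2.congr_fun fun ρ => shiftRem_eq_succ_add N a s ρ).tsum_eq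
  rw [shiftStrip, shiftStrip, h3, Finset.sum_range_succ]
  ring

lemma shiftStrip_add {N : ℕ} {a s : ℂ} (hs : 1 - N < s.re) (k : ℕ) :
    shiftStrip (N + k) a s = shiftStrip N a s := by
  induction k with
  | zero => rfl
  | succ k ih =>
    rw [← add_assoc, shiftStrip_succ, ih]
    push_cast
    have : (0 : ℝ) ≤ k := Nat.cast_nonneg k
    linarith

/-- The sum `∑ (τ + a) ^ (-s)`, continued to the whole plane up to removable singularities. -/
noncomputable def shiftAux (a s : ℂ) : ℂ := shiftStrip (⌊1 - s.re⌋₊ + 1) a s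

lemma shiftAux_eq_shiftStrip {N : ℕ} {a s : ℂ} (hs : 1 - N < s.re) :
    shiftAux a s = shiftStrip N a s := by
  have h := Nat.lt_floor_add_one (1 - s.re)
  rw [shiftAux, ← shiftStrip_add hs (⌊1 - s.re⌋₊ + 1),
    ← shiftStrip_add (N := ⌊1 - s.re⌋₊ + 1) (by push_cast; linarith) N, add_comm]

lemma hasSum_shiftAux {a s : ℂ} (hs : 1 < s.re) :
    HasSum (fun ρ : UpperZero => (ρ.mult : ℂ) * (ρ.tau + a) ^ (-s)) (shiftAux a s) := by
  rw [shiftAux_eq_shiftStrip (N := 0) (by simpa using hs), shiftStrip, Finset.sum_range_zero,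
    zero_add]
  have h := (summable_shiftRem (N := 0) a (s := s) (by simpa using hs)).hasSum
  have e : shiftRem 0 a s = fun ρ : UpperZero => (ρ.mult : ℂ) * (ρ.tau + a) ^ (-s) := by
    funext ρ
    simp [shiftRem]
  rw [e] at h ⊢
  exact h

lemma shiftAux_eventuallyEq {N : ℕ} {a p : ℂ} (hp : 1 - N < p.re) :
    shiftAux a =ᶠ[𝓝 p] shiftStrip N a := by
  filter_upwards [(isOpen_lt continuous_const continuous_re).mem_nhds hp] with s hs
  exact shiftAux_eq_shiftStrip hs

end Shift

/-! ### Laurent expansions of the shifted sum at 1 − n -/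

section ShiftLaurent

lemma hasLaurentAt_calZ_add_div_two {p c₂ c₁ c₀ : ℂ} (k : ℕ)
    (h : HasLaurentAt calZ ((p + k) / 2) c₂ c₁ c₀) :
    HasLaurentAt (fun s : ℂ => calZ ((s + k) / 2)) p (4 * c₂) (2 * c₁) c₀ := by
  have e : ∀ s : ℂ, (s + k) / 2 = 1 / 2 * s + k / 2 := fun s => by ring
  simp only [e] at h ⊢
  refine (h.comp_affine (by norm_num)).of_eq ?_ ?_ rfl <;> ring

lemma hasLaurentAt_shiftAux {N : ℕ} {a p : ℂ} (ha : ∀ ρ : UpperZero, ρ.tau + a ≠ 0)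
    (hp : 1 - N < p.re) {c₂ c₁ c₀ : ℕ → ℂ}
    (h : ∀ k ∈ Finset.range N, HasLaurentAt calZ ((p + k) / 2) (c₂ k) (c₁ k) (c₀ k)) :
    HasLaurentAt (shiftAux a) p
      (∑ k ∈ Finset.range N, a ^ k * (Ring.choose (-p) k * (4 * c₂ k)))
      (∑ k ∈ Finset.range N, a ^ k * (deriv (fun s : ℂ => Ring.choose (-s) k) p * (4 * c₂ k) +
        Ring.choose (-p) k * (2 * c₁ k)))
      (∑ k ∈ Finset.range N, a ^ k *
        (dslope (dslope (fun s : ℂ => Ring.choose (-s) k) p) p p * (4 * c₂ k) +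
        deriv (fun s : ℂ => Ring.choose (-s) k) p * (2 * c₁ k) + Ring.choose (-p) k * c₀ k) +
        ∑' ρ, shiftRem N a p ρ) := by
  have h1 := HasLaurentAt.sum (Finset.range N) fun k hk =>
    ((hasLaurentAt_calZ_add_div_two k (h k hk)).analytic_mul
      ((differentiable_choose_neg k).analyticAt p)).const_mul (a ^ k)
  have h2 := h1.add (AnalyticAt.hasLaurentAt (analyticAt_tsum_shiftRem ha hp))
  simp only [add_zero] at h2
  refine h2.congr (Eventually.filter_mono nhdsWithin_le_nhds ?_)
  filter_upwards [shiftAux_eventuallyEq (a := a) hp] with s hs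
  rw [hs, shiftStrip]
  congr 1
  refine Finset.sum_congr rfl fun k _ => ?_
  ring

lemma exists_hasLaurentAt_shiftAux {a p : ℂ} (ha : ∀ ρ : UpperZero, ρ.tau + a ≠ 0)
    (hp : ∀ n : ℕ, p ≠ 1 - n) : ∃ c, HasLaurentAt (shiftAux a) p 0 0 c := by
  have h : ∀ k : ℕ, ∃ c, HasLaurentAt calZ ((p + k) / 2) 0 0 c := by
    intro k
    refine ⟨_, AnalyticAt.hasLaurentAt (analyticAt_calZ fun m hm => hp (2 * m + k) ?_)⟩
    push_cast
    linear_combination 2 * hm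
  choose c hc using h
  have h0 := Nat.lt_floor_add_one (1 - p.re)
  have h1 := hasLaurentAt_shiftAux (N := ⌊1 - p.re⌋₊ + 1) ha (by push_cast; linarith)
    fun k _ => hc k
  simp only [mul_zero, add_zero, Finset.sum_const_zero] at h1
  exact ⟨_, h1⟩

lemma analyticAt_shiftAux_of_re_gt {a p : ℂ} (ha : ∀ ρ : UpperZero, ρ.tau + a ≠ 0)
    (hp : 1 < p.re) : AnalyticAt ℂ (shiftAux a) p := by
  have hp' : 1 - ((0 : ℕ) : ℝ) < p.re := by simpa using hp
  refine (analyticAt_tsum_shiftRem ha hp').congr ?_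
  filter_upwards [shiftAux_eventuallyEq (a := a) hp'] with s hs
  rw [hs, shiftStrip, Finset.sum_range_zero, zero_add]

/-- The residues of `calZ` at `(1 - d) / 2`. -/
noncomputable def calZRes (d : ℕ) : ℂ :=
  if d = 0 then -(Real.log (2 * Real.pi)) / (4 * Real.pi) else if Even d then calR (d / 2) else 0

/-- One indexing for all points (1 − d)/2: d = 0 is the double pole, even d > 0 are the poles with
residue ℛ, and odd d = 2m + 1 are the regular points −m, where the finite part is the value. -/
lemma exists_hasLaurentAt_calZ (d : ℕ) : ∃ c, HasLaurentAt calZ ((1 - d) / 2)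
    (if d = 0 then 1 / (8 * Real.pi) else 0) (calZRes d) c ∧
      ∀ m, d = 2 * m + 1 → c = calZ (-m) := by
  rcases Nat.eq_zero_or_pos d with rfl | hd
  · obtain ⟨c, hc⟩ := hasLaurentAt_calZ_half
    refine ⟨c, by simpa [calZRes] using hc, fun m hm => by omega⟩
  obtain ⟨m, rfl | rfl⟩ := Nat.even_or_odd' d
  · obtain ⟨c, hc⟩ := hasLaurentAt_calZ_half_sub (m := m) (by omega)
    refine ⟨c, ?_, fun m hm => by omega⟩
    rw [calZRes, if_neg hd.ne', if_neg hd.ne', if_pos (even_two_mul m),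
      Nat.mul_div_cancel_left _ two_pos,
      show (1 - ((2 * m : ℕ) : ℂ)) / 2 = 1 / 2 - m by push_cast; ring]
    exact hc
  · refine ⟨calZ (-m), ?_, fun m' hm => by rw [show m = m' by omega]⟩
    rw [calZRes, if_neg hd.ne', if_neg hd.ne', if_neg (by simp),
      show (1 - ((2 * m + 1 : ℕ) : ℂ)) / 2 = -m by push_cast; ring]
    have h := (hasLaurentAt_calZAux_neg_nat m).regularized
    rwa [← calZ_neg_nat] at h

lemma hasLaurentAt_shiftAux_one {a : ℂ} (ha : ∀ ρ : UpperZero, ρ.tau + a ≠ 0) :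
    ∃ c, HasLaurentAt (shiftAux a) 1
      (1 / (2 * Real.pi)) (-(Real.log (2 * Real.pi)) / (2 * Real.pi)) c := by
  obtain ⟨c, hc⟩ := hasLaurentAt_calZ_half
  have h1 := hasLaurentAt_shiftAux (N := 1) (p := 1) (c₂ := fun _ => 1 / (8 * Real.pi))
    (c₁ := fun _ => -(Real.log (2 * Real.pi)) / (4 * Real.pi)) (c₀ := fun _ => c) ha (by simp)
    fun k hk => by
      have : k = 0 := by simpa using hk
      subst this
      simpa using hc
  refine ⟨_, h1.of_eq ?_ ?_ rfl⟩
  · simp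
    ring
  · simp
    ring

/-- Here −s = n − 1 is a natural number and the binomial expansion terminates; the extra term k = n
has coefficient 0. -/
lemma shiftRem_one_sub_nat {n : ℕ} (hn : 1 ≤ n) (a : ℂ) (ρ : UpperZero) :
    shiftRem (n + 1) a (1 - n) ρ = 0 := by
  have e1 : (-(1 - n : ℂ)) = ((n - 1 : ℕ) : ℂ) := by push_cast [Nat.cast_sub hn]; ring
  have e2 : (ρ.tau + a) ^ (-(1 - n : ℂ)) = ∑ k ∈ Finset.range (n + 1),
      Ring.choose (-(1 - n : ℂ)) k * a ^ k * ρ.tau ^ (-((1 - n : ℂ) + k)) := by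
    rw [e1, cpow_natCast, add_comm, add_pow, Nat.sub_add_cancel hn, Finset.sum_range_succ,
      Ring.choose_natCast, Nat.choose_eq_zero_of_lt (by omega), Nat.cast_zero, zero_mul, zero_mul,
      add_zero]
    refine Finset.sum_congr rfl fun k hk => ?_
    have hk' : k ≤ n - 1 := by have := Finset.mem_range.1 hk; omega
    rw [neg_add, e1, Ring.choose_natCast, ← sub_eq_add_neg, ← Nat.cast_sub hk', cpow_natCast]
    ring
  rw [shiftRem, ← e2, sub_self, mul_zero]

lemma sum_range_of_odd_sub {n : ℕ} {f : ℕ → ℂ} (hf : ∀ k < n, Odd (n - k) → f k = 0) :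
    ∑ k ∈ Finset.range n, f k =
      ∑ m ∈ (Finset.range (n + 1)).filter (fun m => 0 < 2 * m ∧ 2 * m ≤ n), f (n - 2 * m) := by
  symm
  refine Finset.sum_of_injOn (fun m => n - 2 * m) ?_ ?_ ?_ fun _ _ => rfl
  · intro x hx y hy hxy
    simp only [Finset.coe_filter, Finset.mem_range, Set.mem_ofPred_eq] at hx hy hxy
    omega
  · intro x hx
    simp only [Finset.coe_filter, Finset.mem_range, Set.mem_ofPred_eq] at hx
    simp only [Finset.coe_range, Set.mem_Iio]
    omega
  · intro k hk hk'
    have hk := Finset.mem_range.1 hk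
    refine hf k hk (Nat.not_even_iff_odd.1 fun ⟨m, hm⟩ => hk' ⟨m, ?_, ?_⟩)
    · simp only [Finset.coe_filter, Finset.mem_range, Set.mem_ofPred_eq]
      omega
    · dsimp only
      omega

lemma sum_range_of_even_sub {n : ℕ} {f : ℕ → ℂ} (hf : ∀ k < n, Even (n - k) → f k = 0) :
    ∑ k ∈ Finset.range n, f k =
      ∑ m ∈ (Finset.range n).filter (fun m => 2 * m < n), f (n - 2 * m - 1) := by
  symm
  refine Finset.sum_of_injOn (fun m => n - 2 * m - 1) ?_ ?_ ?_ fun _ _ => rfl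
  · intro x hx y hy hxy
    simp only [Finset.coe_filter, Finset.mem_range, Set.mem_ofPred_eq] at hx hy hxy
    omega
  · intro x hx
    simp only [Finset.coe_filter, Finset.mem_range, Set.mem_ofPred_eq] at hx
    simp only [Finset.coe_range, Set.mem_Iio]
    omega
  · intro k hk hk'
    have hk := Finset.mem_range.1 hk
    refine hf k hk (Nat.not_odd_iff_even.1 fun ⟨m, hm⟩ => hk' ⟨m, ?_, ?_⟩)
    · simp only [Finset.coe_filter, Finset.mem_range, Set.mem_ofPred_eq]
      omega
    · dsimp only
      omega

/-- The Laurent expansion of `∑ (τ + a) ^ (-s)` at `1 - n`: the finite part is a polynomial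
in `a`. -/
lemma exists_hasLaurentAt_shiftAux_one_sub {n : ℕ} (hn : 1 ≤ n) : ∃ γ : ℕ → ℂ,
    (∀ m, 2 * m < n → γ (n - 2 * m - 1) = ((n - 1).choose (2 * m) : ℂ) * calZ (-m)) ∧
    (n = 1 → γ 1 = Real.log (2 * Real.pi) / (2 * Real.pi)) ∧
    ∀ a : ℂ, (∀ ρ : UpperZero, ρ.tau + a ≠ 0) →
      HasLaurentAt (shiftAux a) (1 - n) 0 (2 * resR n a)
        (∑ k ∈ Finset.range (n + 1), γ k * a ^ k) := by
  choose c hc hcz using exists_hasLaurentAt_calZ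
  have hn0 : (n : ℂ) ≠ 0 := by exact_mod_cast (by omega : n ≠ 0)
  have hpi : (Real.pi : ℂ) ≠ 0 := by exact_mod_cast Real.pi_ne_zero
  refine ⟨fun k => dslope (dslope (fun s : ℂ => Ring.choose (-s) k) (1 - n)) (1 - n) (1 - n) *
        (4 * if n - k = 0 then (1 / (8 * Real.pi) : ℂ) else 0) +
        deriv (fun s : ℂ => Ring.choose (-s) k) (1 - n) * (2 * calZRes (n - k)) +
        Ring.choose (-(1 - n : ℂ)) k * c (n - k), fun m hm => ?_, fun h1 => ?_, fun a ha => ?_⟩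
  -- For k = n − 2m − 1 the function 𝒵 is taken at its regular point −m.
  · have e : n - (n - 2 * m - 1) = 2 * m + 1 := by omega
    have e' : ¬ Even (2 * m + 1) := by simp
    simp only [e, calZRes]
    rw [if_neg (by omega), if_neg (by omega), if_neg e', hcz _ m rfl, choose_neg_one_sub hn,
      ← Nat.choose_symm (show 2 * m ≤ n - 1 by omega),
      show n - 1 - 2 * m = n - 2 * m - 1 by omega]
    simp
  -- For n = k = 1 the binomial coefficient is −s: its second-order term vanishes, and its
  -- derivative −1 meets twice the residue −log 2π/(4π) of 𝒵 at 1/2.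
  · subst h1
    have e : (fun s : ℂ => Ring.choose (-s) 1) = fun s => -s := by
      funext s; rw [Ring.choose_one_right]
    have e2 : dslope (fun s : ℂ => -s) (1 - ((1 : ℕ) : ℂ)) = fun _ => -1 := by
      funext s
      by_cases h : s = 1 - ((1 : ℕ) : ℂ)
      · rw [h, dslope_same]
        simp
      · rw [dslope_of_ne _ h, slope_def_field, div_eq_iff (sub_ne_zero.2 h)]
        ring
    have e3 : deriv (fun s : ℂ => -s) (1 - ((1 : ℕ) : ℂ)) = -1 := by simp
    simp only [e, e2, e3, choose_neg_one_sub hn, calZRes]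
    rw [dslope_same]
    simp
    ring
  · have h := hasLaurentAt_shiftAux (N := n + 1) (p := 1 - n)
      (c₂ := fun k => if n - k = 0 then 1 / (8 * Real.pi) else 0)
      (c₁ := fun k => calZRes (n - k)) (c₀ := fun k => c (n - k)) ha (by simp) fun k hk => by
        have hk' : k ≤ n := by have := Finset.mem_range.1 hk; omega
        have h2 := hc (n - k)
        rw [Nat.cast_sub hk'] at h2
        rw [show (1 - n + k : ℂ) = 1 - (n - k) by ring]
        exact h2
    refine h.of_eq ?_ ?_ ?_
    -- Only k = n meets the double pole of 𝒵, and there the coefficient C(n−1, n) is 0.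
    · refine Finset.sum_eq_zero fun k hk => ?_
      have hk' : k ≤ n := by have := Finset.mem_range.1 hk; omega
      rcases hk'.eq_or_lt with rfl | hlt
      · rw [choose_neg_one_sub hn, Nat.choose_eq_zero_of_lt (by omega)]
        simp
      · rw [if_neg (by omega)]
        simp
    -- The term k = n contributes (−1/n)·4/(8π)·aⁿ to the residue; the others contribute for k = n −
    -- 2m with m ≥ 1, where the residue of 𝒵 is ℛₘ.
    · rw [Finset.sum_range_succ, sum_range_of_odd_sub, deriv_choose_neg_one_sub hn,
        choose_neg_one_sub hn, Nat.choose_eq_zero_of_lt (show n - 1 < n by omega), resR,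
        mul_add (2 : ℂ), Finset.mul_sum, add_comm]
      · congr 1
        · simp
          field_simp
          ring
        · refine Finset.sum_congr rfl fun m hm => ?_
          have hm := (Finset.mem_filter.1 hm).2
          have e : n - (n - 2 * m) = 2 * m := by omega
          rw [e, if_neg (by omega), choose_neg_one_sub hn, calZRes, if_neg (by omega),
            if_pos (even_two_mul m), Nat.mul_div_cancel_left _ two_pos,
            ← Nat.choose_symm (show 2 * m - 1 ≤ n - 1 by omega),
            show n - 1 - (2 * m - 1) = n - 2 * m by omega]
          ring
      · intro k hk hodd
        rw [if_neg (by omega), calZRes, if_neg (by omega), if_neg (Nat.not_even_iff_odd.2 hodd)]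
        simp
    · have : ∀ ρ, shiftRem (n + 1) a (1 - n) ρ = 0 := shiftRem_one_sub_nat hn a
      simp only [this, tsum_zero, add_zero]
      refine Finset.sum_congr rfl fun k _ => ?_
      ring

end ShiftLaurent

/-! ### All nontrivial zeros as pairs 1/2 ± iτ -/

section Zeros

lemma UpperZero.ne_one (ρ : UpperZero) : ρ.1 ≠ 1 := by
  intro h
  have := ρ.2.2.2.1
  rw [h] at this
  simp at this

lemma UpperZero.riemannXi_one_sub_eq_zero (ρ : UpperZero) : riemannXi (1 - ρ.1) = 0 := by
  rw [riemannXi_one_sub]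
  exact riemannXi_eq_zero_iff.2 ⟨ρ.2.1, ρ.2.2.1, ρ.2.2.2.1⟩

/-- The zeros `1/2 + i τ` and `1/2 - i τ`. -/
def zeroOfSum : UpperZero ⊕ UpperZero → NontrivialZero
  | Sum.inl ρ => ⟨ρ.1, ρ.2.1, ρ.2.2.1, ρ.2.2.2.1⟩
  | Sum.inr ρ => ⟨1 - ρ.1, riemannXi_eq_zero_iff.1 ρ.riemannXi_one_sub_eq_zero⟩

lemma bijective_zeroOfSum : Function.Bijective zeroOfSum := by
  have h1 : ∀ ρ, (zeroOfSum (Sum.inl ρ)).1 = ρ.1 := fun _ => rfl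
  have h2 : ∀ ρ, (zeroOfSum (Sum.inr ρ)).1 = 1 - ρ.1 := fun _ => rfl
  constructor
  · rintro (ρ | ρ) (ρ' | ρ') h
    all_goals
      have h' := congrArg Subtype.val h
      simp only [h1, h2] at h'
    · rw [Subtype.ext h']
    · have h3 := congrArg im h'
      have := ρ.2.2.2.2
      have := ρ'.2.2.2.2
      simp at h3
      linarith
    · have h3 := congrArg im h'
      have := ρ.2.2.2.2
      have := ρ'.2.2.2.2
      simp at h3
      linarith
    · rw [Subtype.ext (sub_right_injective h')]
  · intro ρ
    have h0 := riemannXi_eq_zero_iff.2 ρ.2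
    have him := one_lt_abs_im_of_riemannXi_eq_zero h0
    rcases le_or_gt ρ.1.im 0 with h | h
    · have h3 := riemannXi_eq_zero_iff.1 ((riemannXi_one_sub ρ.1).trans h0)
      have h4 : 0 < (1 - ρ.1).im := by
        rw [abs_of_nonpos h] at him
        simp
        linarith
      exact ⟨Sum.inr ⟨1 - ρ.1, h3.1, h3.2.1, h3.2.2, h4⟩, Subtype.ext (sub_sub_cancel 1 ρ.1)⟩
    · exact ⟨Sum.inl ⟨ρ.1, ρ.2.1, ρ.2.2.1, ρ.2.2.2, h⟩, rfl⟩

/-- The symmetry s ↦ 1 − s preserves the orders of the entire function, which agree with those of ζ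
at both points. -/
lemma zeroMult_one_sub (ρ : UpperZero) : zeroMult (1 - ρ.1) = ρ.mult := by
  have h1 : AnalyticAt ℂ (fun z : ℂ => 1 - z) ρ.1 := by fun_prop
  have e : riemannXi ∘ (fun z : ℂ => 1 - z) = riemannXi := funext riemannXi_one_sub
  have h2 := analyticOrderAt_comp_of_deriv_ne_zero (f := riemannXi) h1 (by simp)
  have h3 := riemannXi_eq_zero_iff.1 ρ.riemannXi_one_sub_eq_zero
  rw [e, analyticOrderAt_riemannXi ρ.2.2.1 ρ.ne_one, analyticOrderAt_riemannXi h3.2.1 (by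
    intro h
    have := h3.2.2
    rw [h] at this
    simp at this)] at h2
  rw [zeroMult, analyticOrderNatAt, ← h2]
  rfl

lemma sub_zeroOfSum_inl (x : ℂ) (ρ : UpperZero) :
    x - (zeroOfSum (Sum.inl ρ)).1 = -I * (ρ.tau + I * (x - 1 / 2)) := by
  have h : (zeroOfSum (Sum.inl ρ)).1 = ρ.1 := rfl
  rw [h]
  linear_combination ρ.I_mul_tau + (x - 1 / 2) * I_mul_I

lemma sub_zeroOfSum_inr (x : ℂ) (ρ : UpperZero) :
    x - (zeroOfSum (Sum.inr ρ)).1 = I * (ρ.tau + -(I * (x - 1 / 2))) := by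
  have h : (zeroOfSum (Sum.inr ρ)).1 = 1 - ρ.1 := rfl
  rw [h]
  linear_combination (-1 : ℂ) * ρ.I_mul_tau + (x - 1 / 2) * I_mul_I

lemma neg_I_mul_cpow {w : ℂ} (hw : 0 < w.re) (s : ℂ) : (-I * w) ^ s = (-I) ^ s * w ^ s := by
  have h0 : w ≠ 0 := by rintro rfl; simp at hw
  have h := abs_lt.1 (abs_arg_lt_pi_div_two_iff.2 (Or.inl hw))
  exact mul_cpow_of_arg (neg_ne_zero.2 I_ne_zero) h0
    (by rw [arg_neg_I]; constructor <;> linarith [Real.pi_pos]) s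

lemma I_mul_cpow {w : ℂ} (hw : 0 < w.re) (s : ℂ) : (I * w) ^ s = I ^ s * w ^ s := by
  have h0 : w ≠ 0 := by rintro rfl; simp at hw
  have h := abs_lt.1 (abs_arg_lt_pi_div_two_iff.2 (Or.inl hw))
  exact mul_cpow_of_arg I_ne_zero h0
    (by rw [arg_I]; constructor <;> linarith [Real.pi_pos]) s

/-- As Re τ ≥ |τ| − |Im τ| > |τ| − 1/2, only finitely many τ + a can leave the right half-plane,
where the factors ±i split off without a branch jump. -/
lemma UpperZero.tau_add_re_pos {a : ℂ} {ρ : UpperZero} (h : ‖a‖ + 1 / 2 < ‖ρ.tau‖) :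
    0 < (ρ.tau + a).re := by
  have h1 := norm_le_abs_re_add_abs_im ρ.tau
  have h2 := ρ.abs_tau_im_lt
  rw [abs_of_pos (by linarith [ρ.one_lt_tau_re] : 0 < ρ.tau.re)] at h1
  have h3 := (abs_le.1 (abs_re_le_norm a)).1
  rw [add_re]
  linarith

end Zeros

/-! ### The function ξ(s, x): pole and special values -/

section Xi

/-- The contribution of the zeros for which `(c * (τ + a)) ^ (-s) ≠ c ^ (-s) * (τ + a) ^ (-s)`. -/
noncomputable def branchCorr (c a s : ℂ) : ℂ :=
  ∑ ρ ∈ UpperZero.upTo (‖a‖ + 1 / 2),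
    (ρ.mult : ℂ) * ((c * (ρ.tau + a)) ^ (-s) - c ^ (-s) * (ρ.tau + a) ^ (-s))

lemma hasSum_mul_tau_add_cpow {c a s : ℂ}
    (hc : ∀ w : ℂ, 0 < w.re → (c * w) ^ (-s) = c ^ (-s) * w ^ (-s)) (hs : 1 < s.re) :
    HasSum (fun ρ : UpperZero => (ρ.mult : ℂ) * (c * (ρ.tau + a)) ^ (-s))
      (c ^ (-s) * shiftAux a s + branchCorr c a s) := by
  have h1 := (hasSum_shiftAux (a := a) hs).mul_left (c ^ (-s))
  have h2 : HasSum (fun ρ : UpperZero => (ρ.mult : ℂ) *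
      ((c * (ρ.tau + a)) ^ (-s) - c ^ (-s) * (ρ.tau + a) ^ (-s))) (branchCorr c a s) := by
    refine hasSum_sum_of_ne_finset_zero fun ρ hρ => ?_
    have h3 : ‖a‖ + 1 / 2 < ‖ρ.tau‖ := not_le.1 fun h => hρ (UpperZero.mem_upTo.2 h)
    rw [hc _ (UpperZero.tau_add_re_pos h3), sub_self, mul_zero]
  refine (h1.add h2).congr_fun fun ρ => ?_
  ring

lemma differentiable_branchCorr {c a : ℂ} (hc : c ≠ 0) (ha : ∀ ρ : UpperZero, ρ.tau + a ≠ 0) :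
    Differentiable ℂ (branchCorr c a) := by
  have h : ∀ w : ℂ, w ≠ 0 → Differentiable ℂ fun s : ℂ => w ^ (-s) := fun w hw =>
    differentiable_id.neg.const_cpow (Or.inl hw)
  exact Differentiable.fun_sum fun ρ _ => (((h _ (mul_ne_zero hc (ha ρ))).sub
    ((h c hc).mul (h _ (ha ρ)))).const_mul _)

lemma neg_one_sub_nat {n : ℕ} (hn : 1 ≤ n) : (-(1 - n : ℂ)) = ((n - 1 : ℕ) : ℂ) := by
  push_cast [Nat.cast_sub hn]; ring

/-- At s = 1 − n the exponents are natural numbers and no branch choice is involved, so the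
exceptional zeros do not affect the special values. -/
lemma branchCorr_one_sub_nat {n : ℕ} (hn : 1 ≤ n) (c a : ℂ) : branchCorr c a (1 - n) = 0 := by
  refine Finset.sum_eq_zero fun ρ _ => ?_
  rw [neg_one_sub_nat hn, cpow_natCast, cpow_natCast, cpow_natCast, mul_pow, sub_self, mul_zero]

/-- The sum `(2 π) ^ s * ∑ (x - ρ) ^ (-s)`, continued to the whole plane up to removable
singularities. -/
noncomputable def xiAux (x s : ℂ) : ℂ :=
  (2 * Real.pi) ^ s * ((-I) ^ (-s) * shiftAux (I * (x - 1 / 2)) s +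
    I ^ (-s) * shiftAux (-(I * (x - 1 / 2))) s +
    (branchCorr (-I) (I * (x - 1 / 2)) s + branchCorr I (-(I * (x - 1 / 2))) s))

variable {x : ℂ}

lemma tau_add_ne_zero (hx : ∀ ρ : NontrivialZero, x ≠ ρ.1) (ρ : UpperZero) :
    ρ.tau + I * (x - 1 / 2) ≠ 0 := by
  intro h
  have h1 := sub_zeroOfSum_inl x ρ
  rw [h, mul_zero] at h1
  exact hx _ (sub_eq_zero.1 h1)

lemma tau_add_neg_ne_zero (hx : ∀ ρ : NontrivialZero, x ≠ ρ.1) (ρ : UpperZero) :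
    ρ.tau + -(I * (x - 1 / 2)) ≠ 0 := by
  intro h
  have h1 := sub_zeroOfSum_inr x ρ
  rw [h, mul_zero] at h1
  exact hx _ (sub_eq_zero.1 h1)

lemma hasSum_xiTerm (x : ℂ) {s : ℂ} (hs : 1 < s.re) :
    ∃ S, HasSum (xiTerm s x) S ∧ xiAux x s = (2 * Real.pi) ^ s * S := by
  have h1 := hasSum_mul_tau_add_cpow (c := -I) (a := I * (x - 1 / 2)) (s := s)
    (fun w hw => neg_I_mul_cpow hw _) hs
  have h2 := hasSum_mul_tau_add_cpow (c := I) (a := -(I * (x - 1 / 2))) (s := s)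
    (fun w hw => I_mul_cpow hw _) hs
  refine ⟨_, ((Equiv.ofBijective _ bijective_zeroOfSum).hasSum_iff).1
    (HasSum.sum (f := xiTerm s x ∘ zeroOfSum) (h1.congr_fun fun ρ => ?_)
      (h2.congr_fun fun ρ => ?_)), ?_⟩
  · simp only [Function.comp, xiTerm, sub_zeroOfSum_inl]
    rfl
  · simp only [Function.comp, xiTerm, sub_zeroOfSum_inr, ← zeroMult_one_sub]
    rfl
  · rw [xiAux]
    ring

lemma hasDerivAt_const_cpow_neg {c : ℂ} (hc : c ≠ 0) (p : ℂ) :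
    HasDerivAt (fun s : ℂ => c ^ (-s)) (-log c * c ^ (-p)) p := by
  have := (hasDerivAt_id p).neg.const_cpow (c := c) (Or.inl hc)
  refine this.congr_deriv ?_
  simp
  ring

lemma hasLaurentAt_cpow_neg_mul {F : ℂ → ℂ} {c p c₂ c₁ c₀ : ℂ} (hc : c ≠ 0)
    (h : HasLaurentAt F p c₂ c₁ c₀) : ∃ D, HasLaurentAt (fun s => c ^ (-s) * F s) p
      (c ^ (-p) * c₂) (-log c * c ^ (-p) * c₂ + c ^ (-p) * c₁)
      (D * c₂ + -log c * c ^ (-p) * c₁ + c ^ (-p) * c₀) := by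
  have hd : Differentiable ℂ fun s : ℂ => c ^ (-s) := differentiable_id.neg.const_cpow (Or.inl hc)
  have h1 := h.analytic_mul (hd.analyticAt p)
  rw [(hasDerivAt_const_cpow_neg hc p).deriv] at h1
  exact ⟨_, h1⟩

lemma differentiable_two_pi_cpow : Differentiable ℂ fun s : ℂ => (2 * Real.pi : ℂ) ^ s :=
  differentiable_id.const_cpow (Or.inl (by
    exact_mod_cast (by positivity : (2 * Real.pi : ℝ) ≠ 0)))

/-- The derivatives of (∓i)^(-s) enter through log(∓i) = ∓iπ/2. The hypothesis `h2` says that the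
double poles cancel; quantifying over e₁ and e₀ allows simplified values to be supplied. -/
lemma hasLaurentAt_xiAux (hx : ∀ ρ : NontrivialZero, x ≠ ρ.1) {p c₂ c₁ c₀ d₂ d₁ d₀ : ℂ}
    (h : HasLaurentAt (shiftAux (I * (x - 1 / 2))) p c₂ c₁ c₀)
    (h' : HasLaurentAt (shiftAux (-(I * (x - 1 / 2)))) p d₂ d₁ d₀)
    (h2 : (-I) ^ (-p) * c₂ + I ^ (-p) * d₂ = 0) : ∃ D D' : ℂ, ∀ e₁ e₀,
      e₁ = Real.pi / 2 * I * (-I) ^ (-p) * c₂ + (-I) ^ (-p) * c₁ +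
        (-(Real.pi / 2 * I) * I ^ (-p) * d₂ + I ^ (-p) * d₁) →
      e₀ = D * c₂ + Real.pi / 2 * I * (-I) ^ (-p) * c₁ + (-I) ^ (-p) * c₀ +
        (D' * d₂ + -(Real.pi / 2 * I) * I ^ (-p) * d₁ + I ^ (-p) * d₀) +
        (branchCorr (-I) (I * (x - 1 / 2)) p + branchCorr I (-(I * (x - 1 / 2))) p) →
      HasLaurentAt (xiAux x) p 0 ((2 * Real.pi) ^ p * e₁)
        (deriv (fun s : ℂ => (2 * Real.pi : ℂ) ^ s) p * e₁ + (2 * Real.pi) ^ p * e₀) := by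
  obtain ⟨D, hD⟩ := hasLaurentAt_cpow_neg_mul (neg_ne_zero.2 I_ne_zero) h
  obtain ⟨D', hD'⟩ := hasLaurentAt_cpow_neg_mul I_ne_zero h'
  have h3 := AnalyticAt.hasLaurentAt
    (((differentiable_branchCorr (neg_ne_zero.2 I_ne_zero) (tau_add_ne_zero hx)).add
      (differentiable_branchCorr I_ne_zero (tau_add_neg_ne_zero hx))).analyticAt p)
  have h4 := ((hD.add hD').add h3).analytic_mul (differentiable_two_pi_cpow.analyticAt p)
  rw [log_neg_I, log_I] at h4
  refine ⟨D, D', fun e₁ e₀ he₁ he₀ => h4.of_eq ?_ ?_ ?_⟩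
  · rw [h2]; ring
  · rw [h2, he₁]; ring
  · rw [h2, he₁, he₀, Pi.add_apply]; ring

/-- The continuation of `(2 π) ^ s * ∑ (x - ρ) ^ (-s)`. -/
noncomputable def xiCont (s x : ℂ) : ℂ := regularized (xiAux x) s

lemma xiCont_eq (hx : ∀ ρ : NontrivialZero, x ≠ ρ.1) {s : ℂ} (hs : 1 < s.re) :
    Summable (xiTerm s x) ∧ xiCont s x = (2 * Real.pi) ^ s * ∑' ρ, xiTerm s x ρ := by
  obtain ⟨S, hS, he⟩ := hasSum_xiTerm x hs
  refine ⟨hS.summable, ?_⟩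
  have hd : ∀ c : ℂ, c ≠ 0 → AnalyticAt ℂ (fun s : ℂ => c ^ (-s)) s := fun c hc =>
    Differentiable.analyticAt (differentiable_id.neg.const_cpow (Or.inl hc)) s
  have h1 : AnalyticAt ℂ (xiAux x) s := by
    refine (differentiable_two_pi_cpow.analyticAt s).mul (((?_ : AnalyticAt ℂ _ s).add ?_).add
      (((differentiable_branchCorr (neg_ne_zero.2 I_ne_zero) (tau_add_ne_zero hx)).analyticAt s).add
        ((differentiable_branchCorr I_ne_zero (tau_add_neg_ne_zero hx)).analyticAt s)))
    · exact (hd _ (neg_ne_zero.2 I_ne_zero)).mul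
        (analyticAt_shiftAux_of_re_gt (tau_add_ne_zero hx) hs)
    · exact (hd _ I_ne_zero).mul (analyticAt_shiftAux_of_re_gt (tau_add_neg_ne_zero hx) hs)
  rw [xiCont, AnalyticAt.regularized_eq h1, he, hS.tsum_eq]

/-- As (−i)^(-1) + i^(-1) = 0, the double poles and the log 2π residues cancel. The derivatives of
(∓i)^(-s) against the double poles leave −π/(2π) = −1/2, and the factor 2π makes this −π. -/
lemma hasLaurentAt_xiCont_one (hx : ∀ ρ : NontrivialZero, x ≠ ρ.1) :
    ∃ c, HasLaurentAt (fun s => xiCont s x) 1 0 (-Real.pi) c := by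
  obtain ⟨c, hc⟩ := hasLaurentAt_shiftAux_one (tau_add_ne_zero hx)
  obtain ⟨c', hc'⟩ := hasLaurentAt_shiftAux_one (tau_add_neg_ne_zero hx)
  have e1 : (-I) ^ (-1 : ℂ) = I := by
    rw [cpow_neg_one, inv_neg, inv_I, neg_neg]
  have e2 : I ^ (-1 : ℂ) = -I := by
    rw [cpow_neg_one, inv_I]
  obtain ⟨D, D', h⟩ := hasLaurentAt_xiAux hx hc hc' (by rw [e1, e2]; ring)
  have hpi : (Real.pi : ℂ) ≠ 0 := by exact_mod_cast Real.pi_ne_zero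
  refine ⟨_, HasLaurentAt.regularized ((h (-1 / 2) _ ?_ rfl).of_eq rfl ?_ rfl)⟩
  · rw [e1, e2]
    field_simp
    linear_combination (-2 * Real.pi : ℂ) * I_sq
  · rw [cpow_one]
    ring

lemma resR_neg (n : ℕ) (a : ℂ) : resR n (-a) = (-1) ^ n * resR n a := by
  rw [resR, resR, mul_add, Finset.mul_sum, neg_pow]
  congr 1
  · ring
  · refine Finset.sum_congr rfl fun m hm => ?_
    have hm := (Finset.mem_filter.1 hm).2.2
    have e : ((-1 : ℂ)) ^ (n - 2 * m) = (-1) ^ n := by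
      conv_rhs => rw [← Nat.sub_add_cancel hm, pow_add, (even_two_mul m).neg_one_pow, mul_one]
    rw [neg_pow a, e]
    ring

/-- The residues 2rₙ(a) and 2rₙ(−a) = (−1)ⁿ·2rₙ(a) cancel against the factors (∓i)^(n−1). They
survive in the finite part, multiplied by the derivatives of (∓i)^(-s). -/
lemma exists_hasLaurentAt_xiAux_one_sub {n : ℕ} (hn : 1 ≤ n)
    (hx : ∀ ρ : NontrivialZero, x ≠ ρ.1) : HasLaurentAt (xiAux x) (1 - n) 0 0
      (2 / (2 * Real.pi) ^ (n - 1) * (-Real.pi * (resR n (I * (x - 1 / 2)) / I ^ n) +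
        ∑ m ∈ (Finset.range n).filter (fun m => 2 * m < n),
          (-1) ^ m * ((n - 1).choose (2 * m) : ℂ) * calZ (-m) *
            (x - 1 / 2) ^ (n - 2 * m - 1))) := by
  obtain ⟨γ, hγ, -, hL⟩ := exists_hasLaurentAt_shiftAux_one_sub hn
  obtain ⟨D, D', h⟩ := hasLaurentAt_xiAux hx (hL _ (tau_add_ne_zero hx))
    (hL _ (tau_add_neg_ne_zero hx)) (by ring)
  set a := I * (x - 1 / 2) with ha
  have hI : I ^ n = I * I ^ (n - 1) := by
    rw [← pow_succ', Nat.sub_add_cancel hn]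
  have hI0 : I ^ (n - 1) ≠ 0 := pow_ne_zero _ I_ne_zero
  have hm1 : (-1 : ℂ) ^ n = -(-1) ^ (n - 1) := by
    rw [← Nat.sub_add_cancel hn, pow_succ]
    simp
  have hII : (-I) ^ (n - 1) = (-1) ^ (n - 1) * I ^ (n - 1) := neg_pow _ _
  have hinv : (-I) ^ (n - 1) * I ^ (n - 1) = 1 := by
    rw [← mul_pow]; simp
  have hp : (2 * Real.pi : ℂ) ^ (1 - n : ℂ) = 1 / (2 * Real.pi) ^ (n - 1) := by
    rw [show (1 - n : ℂ) = -((n - 1 : ℕ) : ℂ) by rw [← neg_one_sub_nat hn, neg_neg], cpow_neg,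
      cpow_natCast, one_div]
  refine (h 0 _ ?_ rfl).of_eq rfl (mul_zero _) ?_
  · rw [neg_one_sub_nat hn, cpow_natCast, cpow_natCast, resR_neg, hm1, hII]
    ring
  · rw [branchCorr_one_sub_nat hn, branchCorr_one_sub_nat hn, neg_one_sub_nat hn, cpow_natCast,
      cpow_natCast, resR_neg, hp]
    -- Adding the contributions of a and −a removes every coefficient with n − k even, that is, all
    -- finite parts not known explicitly; what remains involves only the values 𝒵(−m).
    have hS : (-I) ^ (n - 1) * ∑ k ∈ Finset.range (n + 1), γ k * a ^ k +
        I ^ (n - 1) * ∑ k ∈ Finset.range (n + 1), γ k * (-a) ^ k =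
        2 * ∑ m ∈ (Finset.range n).filter (fun m => 2 * m < n),
          (-1) ^ m * ((n - 1).choose (2 * m) : ℂ) * calZ (-m) * (x - 1 / 2) ^ (n - 2 * m - 1) := by
      rw [Finset.mul_sum, Finset.mul_sum, ← Finset.sum_add_distrib, Finset.sum_range_succ,
        sum_range_of_even_sub, Finset.mul_sum]
      · have e0 : (-I) ^ (n - 1) * (γ n * a ^ n) + I ^ (n - 1) * (γ n * (-a) ^ n) = 0 := by
          rw [neg_pow a, hm1, hII]
          ring
        rw [e0, add_zero]
        refine Finset.sum_congr rfl fun m hm => ?_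
        have hm := (Finset.mem_filter.1 hm).2
        have e1 : n - 1 = 2 * m + (n - 2 * m - 1) := by omega
        have e2 : (-I) ^ (n - 1) * a ^ (n - 2 * m - 1) =
            (-1) ^ m * (x - 1 / 2) ^ (n - 2 * m - 1) := by
          rw [ha, e1, pow_add, pow_mul, mul_assoc, ← mul_pow, ← mul_assoc]
          simp
        have e3 : I ^ (n - 1) * (-a) ^ (n - 2 * m - 1) =
            (-1) ^ m * (x - 1 / 2) ^ (n - 2 * m - 1) := by
          have e4 : (-1 : ℂ) ^ (n - 1) = (-1) ^ (n - 2 * m - 1) := by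
            rw [e1, pow_add, (even_two_mul m).neg_one_pow, one_mul]
          rw [← e2, neg_pow a, hII, e4]
          ring
        rw [hγ m hm]
        linear_combination ((n - 1).choose (2 * m) : ℂ) * calZ (-m) * (e2 + e3)
      · intro k hk heven
        have e4 : (-1 : ℂ) ^ n = (-1) ^ k := by
          conv_lhs => rw [← Nat.sub_add_cancel hk.le, pow_add, heven.neg_one_pow, one_mul]
        rw [neg_pow a, ← e4, hm1, hII]
        ring
    -- The derivative contributions have opposite signs, so here the residues add up instead of
    -- cancelling.
    have hR : Real.pi / 2 * I * (-I) ^ (n - 1) * (2 * resR n a) +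
        -(Real.pi / 2 * I) * I ^ (n - 1) * (2 * ((-1) ^ n * resR n a)) =
        -2 * Real.pi * (resR n a / I ^ n) := by
      have e5 : resR n a / I ^ n = -I * ((-I) ^ (n - 1) * resR n a) := by
        rw [hI, div_eq_iff (mul_ne_zero I_ne_zero hI0)]
        linear_combination (-resR n a) * hinv + (resR n a * ((-I) ^ (n - 1) * I ^ (n - 1))) * I_sq
      rw [e5, hm1, hII]
      ring
    rw [mul_zero, zero_add]
    linear_combination (1 / (2 * Real.pi) ^ (n - 1) : ℂ) * (hS + hR)

lemma analyticAt_xiCont (hx : ∀ ρ : NontrivialZero, x ≠ ρ.1) {s : ℂ} (hs : s ≠ 1) :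
    AnalyticAt ℂ (fun s => xiCont s x) s := by
  by_cases h : ∃ n : ℕ, s = 1 - n
  · obtain ⟨n, rfl⟩ := h
    have hn : 1 ≤ n := by
      rcases Nat.eq_zero_or_pos n with rfl | h
      · simp at hs
      · exact h
    exact (exists_hasLaurentAt_xiAux_one_sub hn hx).analyticAt_regularized
  · push Not at h
    obtain ⟨c, hc⟩ := exists_hasLaurentAt_shiftAux (tau_add_ne_zero hx) h
    obtain ⟨c', hc'⟩ := exists_hasLaurentAt_shiftAux (tau_add_neg_ne_zero hx) h
    obtain ⟨D, D', h1⟩ := hasLaurentAt_xiAux hx hc hc' (by ring)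
    exact HasLaurentAt.analyticAt_regularized
      ((h1 0 _ (by ring) rfl).of_eq rfl (mul_zero _) rfl)

end Xi

/-! ### The shifted sum in the variable σ = s/2 -/

section FrakZ

/-- The continuation of `∑ (τ + a) ^ (-2 σ)`. -/
noncomputable def frakZ (σ a : ℂ) : ℂ := regularized (fun σ => shiftAux a (2 * σ)) σ

variable {a : ℂ}

lemma hasLaurentAt_frakZ {p c₂ c₁ c₀ : ℂ} (h : HasLaurentAt (shiftAux a) (2 * p) c₂ c₁ c₀) :
    HasLaurentAt (fun σ => frakZ σ a) p (c₂ / 4) (c₁ / 2) c₀ := by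
  have h1 := HasLaurentAt.comp_affine (F := shiftAux a) (α := 2) (β := 0) (p := p) two_ne_zero
    (by rwa [add_zero])
  simp only [add_zero] at h1
  exact (h1.of_eq (by norm_num) rfl rfl).regularized

lemma hasSum_frakZ (ha : ∀ ρ : UpperZero, ρ.tau + a ≠ 0) {σ : ℂ} (hσ : 1 / 2 < σ.re) :
    HasSum (frakZTerm σ a) (frakZ σ a) := by
  have h2 : 1 < (2 * σ).re := by simp; linarith
  have h1 : AnalyticAt ℂ (fun σ => shiftAux a (2 * σ)) σ :=
    AnalyticAt.comp (f := fun σ => 2 * σ) (analyticAt_shiftAux_of_re_gt ha h2) (by fun_prop)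
  rw [frakZ, AnalyticAt.regularized_eq h1]
  refine (hasSum_shiftAux h2).congr_fun fun ρ => ?_
  rw [frakZTerm, ρ.zeroMult_eq, neg_mul]

lemma analyticAt_frakZ (ha : ∀ ρ : UpperZero, ρ.tau + a ≠ 0) {σ : ℂ}
    (hσ : ∀ n : ℕ, σ ≠ (1 - n) / 2) : AnalyticAt ℂ (fun σ => frakZ σ a) σ := by
  obtain ⟨c, hc⟩ := exists_hasLaurentAt_shiftAux (p := 2 * σ) ha fun n hn =>
    hσ n (by rw [← hn]; ring)
  have h1 := HasLaurentAt.comp_affine (F := shiftAux a) (α := 2) (β := 0) (p := σ) two_ne_zero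
    (by rwa [add_zero])
  simp only [add_zero, zero_div] at h1
  exact h1.analyticAt_regularized

lemma hasLaurentAt_frakZ_half (ha : ∀ ρ : UpperZero, ρ.tau + a ≠ 0) :
    ∃ c, HasLaurentAt (fun σ => frakZ σ a) (1 / 2)
      (1 / (8 * Real.pi)) (-(Real.log (2 * Real.pi)) / (4 * Real.pi)) c := by
  obtain ⟨c, hc⟩ := hasLaurentAt_shiftAux_one ha
  have h := hasLaurentAt_frakZ (p := 1 / 2) (by rwa [mul_one_div_cancel two_ne_zero])
  exact ⟨c, h.of_eq (by ring) (by ring) rfl⟩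

lemma exists_hasLaurentAt_frakZ (ha : ∀ ρ : UpperZero, ρ.tau + a ≠ 0) {n : ℕ} (hn : 1 ≤ n) :
    ∃ c, HasLaurentAt (fun σ => frakZ σ a) ((1 - n) / 2) 0 (resR n a) c := by
  obtain ⟨γ, -, -, hL⟩ := exists_hasLaurentAt_shiftAux_one_sub hn
  have h := hasLaurentAt_frakZ (p := (1 - n) / 2)
    (by rw [mul_div_cancel₀ _ two_ne_zero]; exact hL a ha)
  exact ⟨_, h.of_eq (by ring) (by ring) rfl⟩

lemma calZ_zero : calZ 0 = 7 / 8 := by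
  have h := calZ_neg_nat 0
  have hE : eulerNumber 0 = 1 := by
    rw [eulerNumber, PowerSeries.coeff_zero_eq_constantCoeff_apply, PowerSeries.constantCoeff_inv,
      ← PowerSeries.coeff_zero_eq_constantCoeff_apply, PowerSeries.coeff_mk]
    simp
  rw [mul_zero, hE] at h
  simp at h
  rw [h]
  norm_num

lemma hasLaurentAt_frakZ_zero (ha : ∀ ρ : UpperZero, ρ.tau + a ≠ 0) :
    HasLaurentAt (fun σ => frakZ σ a) 0 0 (-a / (4 * Real.pi))
      (7 / 8 + Real.log (2 * Real.pi) / (2 * Real.pi) * a) := by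
  obtain ⟨γ, h1, h2, hL⟩ := exists_hasLaurentAt_shiftAux_one_sub le_rfl
  have h := hasLaurentAt_frakZ (p := 0) (by simpa using hL a ha)
  have h3 := h1 0 one_pos
  simp [calZ_zero] at h3
  refine h.of_eq (by ring) ?_ ?_
  · rw [resR, Finset.sum_eq_zero]
    · simp
    · intro m hm
      have := (Finset.mem_filter.1 hm).2
      omega
  · simp [Finset.sum_range_succ, h2 rfl, h3]

end FrakZ

end RiemannZetaZeros

open RiemannZetaZeros in
theorem mainTheorem9 :
    ∃ (calZ : ℂ → ℂ) (frakZ : ℂ → ℂ → ℂ) (ξ : ℂ → ℂ → ℂ),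
      -- `calZ` is the meromorphic continuation of `∑ (τₖ²)^(-σ)`;
      -- the `ℛₘ` are its residues at `1/2 - m`
      ((∀ σ : ℂ, 1 / 2 < σ.re → HasSum (calZTerm σ) (calZ σ)) ∧
        AnalyticOnNhd ℂ calZ {σ : ℂ | ∀ m : ℕ, σ ≠ 1 / 2 - m} ∧
        (∃ c₀ : ℂ, HasLaurentAt calZ (1 / 2)
          (1 / (8 * Real.pi)) (-(Real.log (2 * Real.pi)) / (4 * Real.pi)) c₀) ∧
        (∀ m : ℕ, 1 ≤ m → ∃ c₀ : ℂ, HasLaurentAt calZ (1 / 2 - m) 0 (calR m) c₀) ∧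
        (∀ m : ℕ, calZ (-m) =
          (-1) ^ m * 2 ^ (-2 * (m : ℤ)) * (1 - (eulerNumber (2 * m) : ℂ) / 8))) ∧
      -- the function `𝔷(σ, a)`
      (∀ a : ℂ, (∀ ρ : UpperZero, ρ.tau + a ≠ 0) →
        (∀ σ : ℂ, 1 / 2 < σ.re → HasSum (frakZTerm σ a) (frakZ σ a)) ∧
        AnalyticOnNhd ℂ (fun σ => frakZ σ a) {σ : ℂ | ∀ n : ℕ, σ ≠ (1 - n) / 2} ∧
        (∃ c₀ : ℂ, HasLaurentAt (fun σ => frakZ σ a) (1 / 2)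
          (1 / (8 * Real.pi)) (-(Real.log (2 * Real.pi)) / (4 * Real.pi)) c₀) ∧
        (∀ n : ℕ, 1 ≤ n → ∃ c₀ : ℂ,
          HasLaurentAt (fun σ => frakZ σ a) ((1 - n) / 2) 0 (resR n a) c₀) ∧
        HasLaurentAt (fun σ => frakZ σ a) 0 0 (-a / (4 * Real.pi))
          (7 / 8 + Real.log (2 * Real.pi) / (2 * Real.pi) * a)) ∧
      -- the function `ξ(s, x)`
      (∀ x : ℂ, (∀ ρ : NontrivialZero, x ≠ ρ.1) →
        (∀ s : ℂ, 1 < s.re →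
          Summable (xiTerm s x) ∧ ξ s x = (2 * Real.pi) ^ s * ∑' ρ, xiTerm s x ρ) ∧
        AnalyticOnNhd ℂ (fun s => ξ s x) {s : ℂ | s ≠ 1} ∧
        (∃ c₀ : ℂ, HasLaurentAt (fun s => ξ s x) 1 0 (-Real.pi) c₀)) ∧
      (∀ y : ℂ, (∀ ρ : NontrivialZero, 1 / 2 + y ≠ ρ.1) → ∀ n : ℕ, 1 ≤ n →
        ξ (1 - n) (1 / 2 + y) =
          2 / (2 * Real.pi) ^ (n - 1) *
            (-Real.pi * (resR n (I * y) / I ^ n) +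
              ∑ m ∈ (Finset.range n).filter (fun m => 2 * m < n),
                (-1) ^ m * ((n - 1).choose (2 * m) : ℂ) * calZ (-m) * y ^ (n - 2 * m - 1))) := by
  refine ⟨RiemannZetaZeros.calZ, RiemannZetaZeros.frakZ, xiCont,
    ⟨fun σ hσ => hasSum_calZ hσ, fun σ hσ => analyticAt_calZ hσ, hasLaurentAt_calZ_half,
      fun m hm => hasLaurentAt_calZ_half_sub hm, calZ_neg_nat⟩,
    fun a ha => ⟨fun σ hσ => hasSum_frakZ ha hσ, fun σ hσ => analyticAt_frakZ ha hσ,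
      hasLaurentAt_frakZ_half ha, fun n hn => exists_hasLaurentAt_frakZ ha hn,
      hasLaurentAt_frakZ_zero ha⟩,
    fun x hx => ⟨fun s hs => xiCont_eq hx hs, fun s hs => analyticAt_xiCont hx hs,
      hasLaurentAt_xiCont_one hx⟩, fun y hy n hn => ?_⟩
  have h := (exists_hasLaurentAt_xiAux_one_sub hn hy).regularized_eq
  rw [add_sub_cancel_left] at h
  exact h
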